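/- **Setting.** Let $X\subseteq\mathbb R^d$ be closed and convex, $g:X\to\mathbb R$ convex and lower semicontinuous, $\ell:X\to\mathbb R^m$ continuously differentiable with convex components and Jacobian $\nabla\ell$, and $h:\mathrm{dom}(h)\subseteq\mathbb R^m\to\mathbb R$ uniformly convex with conjugate $h^*$ having Hölder continuous gradient. Put $f(x,y)=g(x)+h(y)-\langle y,\ell(x)\rangle$ and assume $f(x,y)-f(x',y')\le M$ for all $x,x'\in X$, $y,y'\in\mathrm{dom}(h)$. We consider the DC case $\mathrm{dom}(h)\subseteq\mathbb R^m_+$ and the bi-convex case $\mathrm{dom}(h)\subseteq\mathbb R^m_-$. Unbiased stochastic oracles $\partial g(x;\xi_g)$, $\ell(x;\xi_\ell)$, $\nabla\ell(x;\xi_\ell)$, $\partial h(y;\xi_h)$ of a subgradient of $g$, of $\ell$, of $\nabla\ell$ and of a subgradient of $h$ are given, with $\mathrm E\|\ell(x;\xi_\ell)-\ell(x)\|^2\le\sigma^2$ on $X$ and $\mathrm E\|\partial h(y;\xi_h)\|^2\le\sigma^2$ on $\mathrm{dom}(h)$. **Algorithm.** $\mathrm{SPG}(f,R,z_1,A,T,\eta)$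 computes, for $t=1,\dots,T$, $z_{t+1}=\arg\min_{z\in A}\ \partial f(z_t;\xi_t)^\top z+R(z)+\frac1{2\eta_t}\|z-z_t\|^2$ and returns $\sum_{t=1}^T t z_t/\sum_{t=1}^T t$. St-SPG starts at $x_1\in X$, $y_1\in\mathrm{dom}(h)$ and for $k=1,\dots,K$ sets $x_{k+1}=\mathrm{SPG}(f^k_x,\frac\gamma2\|\cdot-x_k\|^2,x_k,X,T^x_k,\eta^x)$ and $y_{k+1}=\mathrm{SPG}(f^k_y,\frac\mu2\|\cdot-y_k\|^2,y_k,\mathrm{dom}(h),T^y_k,\eta^y)$, where $f^k_y(y)=h(y)-y^\top\ell(x_{k+1})$ and $f^k_x(x)=g(x)-y_k^\top(\ell(x_k)+\nabla\ell(x_k)(x-x_k))$ in the DC case, $f^k_x(x)=g(x)-y_k^\top\ell(x)$ in the bi-convex case. Stochastic gradients of $f_x^k$ at $z$ are $\partial g(z;\xi_g)-\nabla\ell(x_k;\xi_\ell)^\top y_k$ (DC), $\partial g(z;\xi_g)-\nabla\ell(z;\xi_\ell)^\top y_k$ (bi-convex), and of $f^k_y$ they are $\partial h(z;\xi_h)-\ell(x_{k+1};\xi'_\ell)$;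 all samples are fresh and independent. The step sizes are $\eta^y_t=4/(\mu t)$ and one of the following: * (non-smooth) $\eta^x_t=4/(\gamma t)$, any $\gamma>0$, with $\mathrm E\|\partial g(x;\xi_g)\|^2\le\sigma^2$ and $\mathrm E\|\nabla\ell(x;\xi_\ell)\|^2\le\sigma^2$ on $X$; in the DC case the latter may be replaced by $\mathrm E\|\nabla\ell(x;\xi_\ell)-\nabla\ell(x)\|^2\le\sigma^2$ on $X$; * (smooth) $\eta^x_t=3/(\gamma(t+1))$, with $g$ $L_g$-smooth, $\mathrm E\|\partial g(x;\xi_g)-\nabla g(x)\|^2\le\sigma^2$ on $X$, and: in the DC case, $\gamma\ge3L_g$ and either bound on the noise of $\nabla\ell$ above; in the bi-convex case, $\ell$ $L_\ell$-smooth, $\gamma\ge 3(L_g+DL_\ell)$ and $\mathrm E\|\nabla\ell(x;\xi_\ell)-\nabla\ell(x)\|^2\le\sigma^2$ on $X$. **Theorem.** Suppose moreover that $\|y_k\|^2\le D^2$ almost surely and $\mathrm E\|\ell(x_{k+1};\xi)\|^2\le D^2$ for $k=1,\dots,K$, where $K\ge1$ and $\xi$ is a fresh copy of $\xi_\ell$.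 Let $G\ge 0$ be given by $G^2=17\max\{2\sigma^2+2D^2\sigma^2,\,2\sigma^2+2D^2\}$. Let $\gamma,\mu>0$ (with $\gamma$ as above), $\alpha\ge1$, and let the stage lengths be any integers $T^x_k\ge k/\gamma+1$, $T^y_k\ge k/\mu+1$ (for instance these numbers rounded up). Let $v_k=\arg\min_{x\in X}f^k_x(x)+\frac\gamma2\|x-x_k\|^2$, $u_k=\arg\min_{y\in\mathrm{dom}(h)}f^k_y(y)+\frac\mu2\|y-y_k\|^2$, and let $\tau$ be drawn independently of the run with $P(\tau=k)=k^\alpha/\sum_{s=1}^Ks^\alpha$ for $k=1,\dots,K$. Then, in both the DC and the bi-convex case, the expectations below are finite and $$\tfrac12\mathrm E\|x_{\tau+1}-v_\tau\|^2\le\mathrm E\big[\|x_\tau-v_\tau\|^2+\|x_{\tau+1}-x_\tau\|^2\big]\le\frac{4(M+2G^2)(\alpha+1)}{\gamma K},$$ $$\tfrac12\mathrm E\|y_{\tau+1}-u_\tau\|^2\le\mathrm E\big[\|y_\tau-u_\tau\|^2+\|y_{\tau+1}-y_\tau\|^2\big]\le\frac{4(M+2G^2)(\alpha+1)}{\mu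 K}.$$ -/

import Mathlib

open MeasureTheory ProbabilityTheory Set

noncomputable section

/-- `ℝⁿ` with the Euclidean norm. -/
abbrev Vec (n : ℕ) := EuclideanSpace ℝ (Fin n)

/-- `E ‖f‖² ≤ c`, the second moment being finite. -/
def SecondMomentLE {S V : Type*} [MeasurableSpace S] [NormedAddCommGroup V]
    (P : Measure S) (f : S → V) (c : ℝ) : Prop :=
  MemLp f 2 P ∧ ∫ s, ‖f s‖ ^ 2 ∂P ≤ c

/-- `s` is a subgradient at `x` of the function `φ` with domain `A`. -/
def IsSubgradientOn {n : ℕ} (φ : Vec n → ℝ) (A : Set (Vec n)) (x s : Vec n) : Prop :=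
  ∀ z ∈ A, φ x + inner ℝ s (z - x) ≤ φ z

/-- `φ` with domain `A` is `(ϱ, p)`-uniformly convex. -/
def IsUniformlyConvexOn {n : ℕ} (φ : Vec n → ℝ) (A : Set (Vec n)) (ϱ p : ℝ) : Prop :=
  ConvexOn ℝ A φ ∧ ∀ y₂ ∈ A, ∀ s, IsSubgradientOn φ A y₂ s →
    ∀ y₁ ∈ A, inner ℝ s (y₁ - y₂) + ϱ / 2 * ‖y₁ - y₂‖ ^ p ≤ φ y₁ - φ y₂

/-- The convex conjugate of the function `φ` with domain `A`. -/
def convexConj {n : ℕ} (φ : Vec n → ℝ) (A : Set (Vec n)) (s : Vec n) : ℝ :=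
  sSup ((fun y => inner ℝ y s - φ y) '' A)

/-- The convex conjugate is finite everywhere and differentiable, with `(L, ν)`-Hölder
continuous gradient. -/
def ConjHasHolderGradient {n : ℕ} (φ : Vec n → ℝ) (A : Set (Vec n)) (L ν : ℝ) : Prop :=
  (∀ s, BddAbove ((fun y => inner ℝ y s - φ y) '' A)) ∧
    ∃ G : Vec n → Vec n, (∀ s, HasGradientAt (convexConj φ A) (G s) s) ∧
      ∀ s₁ s₂, ‖G s₁ - G s₂‖ ≤ L * ‖s₁ - s₂‖ ^ ν

/-- The two families of problems. -/
inductive ProblemCase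
  | dc
  | biconvex

/-- The data of the problem `min_{x ∈ X} g(x) + min_{y ∈ dom h} (h(y) - ⟨y, ℓ(x)⟩)`.
`Y` is `dom h`, and `J x` is the Jacobian of `ℓ` at `x`. Functions are only
looked at on their domains. -/
structure InfProjProblem (d m : ℕ) where
  X : Set (Vec d)
  g : Vec d → ℝ
  ℓ : Vec d → Vec m
  J : Vec d → Vec d →L[ℝ] Vec m
  Y : Set (Vec m)
  h : Vec m → ℝ

namespace InfProjProblem

variable {d m : ℕ}

/-- `f(x, y) = g(x) + h(y) - ⟨y, ℓ(x)⟩`. -/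
def f (P : InfProjProblem d m) (x : Vec d) (y : Vec m) : ℝ :=
  P.g x + P.h y - inner ℝ y (P.ℓ x)

/-- The standing assumptions on the (deterministic) problem, with `M` the bound on the
oscillation of `f`. -/
structure IsAdmissible (P : InfProjProblem d m) (c : ProblemCase) (M : ℝ) : Prop where
  isClosed_X : IsClosed P.X
  convex_X : Convex ℝ P.X
  lsc_g : LowerSemicontinuousOn P.g P.X
  convexOn_g : ConvexOn ℝ P.X P.g
  hasFDeriv_ℓ : ∀ x ∈ P.X, HasFDerivWithinAt P.ℓ (P.J x) P.X x
  continuousOn_J : ContinuousOn P.J P.X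
  convexOn_ℓ : ∀ i, ConvexOn ℝ P.X (fun x => P.ℓ x i)
  uniformlyConvex_h : ∃ ϱ p : ℝ, 0 < ϱ ∧ 2 ≤ p ∧ IsUniformlyConvexOn P.h P.Y ϱ p
  holder_conj : ∃ L ν : ℝ, 0 < L ∧ 0 < ν ∧ ν ≤ 1 ∧ ConjHasHolderGradient P.h P.Y L ν
  sign_Y : match c with
    | .dc => ∀ y ∈ P.Y, ∀ i, 0 ≤ y i
    | .biconvex => ∀ y ∈ P.Y, ∀ i, y i ≤ 0
  oscillation : ∀ x ∈ P.X, ∀ y ∈ P.Y, ∀ x' ∈ P.X, ∀ y' ∈ P.Y, P.f x y - P.f x' y' ≤ M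

/-- The objective `f_x^k` of the `x`-subproblem, with `xk = x_k` and `yk = y_k`. -/
def fx (P : InfProjProblem d m) (c : ProblemCase) (xk : Vec d) (yk : Vec m) (x : Vec d) : ℝ :=
  match c with
  | .dc => P.g x - inner ℝ yk (P.ℓ xk + P.J xk (x - xk))
  | .biconvex => P.g x - inner ℝ yk (P.ℓ x)

/-- The objective `f_y^k` of the `y`-subproblem, with `xk1 = x_{k+1}`. -/
def fy (P : InfProjProblem d m) (xk1 : Vec d) (y : Vec m) : ℝ :=
  P.h y - inner ℝ y (P.ℓ xk1)

end InfProjProblem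

/-- Stochastic oracles: `gO x ξ_g` for `∂g(x; ξ_g)`, `lO x ξ_ℓ` for `ℓ(x; ξ_ℓ)`,
`JO x ξ_ℓ` for `∇ℓ(x; ξ_ℓ)` and `hO y ξ_h` for `∂h(y; ξ_h)`. -/
structure Oracles (d m : ℕ) (Sg Sl Sh : Type*) where
  gO : Vec d → Sg → Vec d
  lO : Vec d → Sl → Vec m
  JO : Vec d → Sl → Vec d →L[ℝ] Vec m
  hO : Vec m → Sh → Vec m

/-- The step sizes of SPG: `4 / (γ t)` (non-smooth subproblem) and `3 / (γ (t + 1))`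
(smooth subproblem). -/
inductive StepRule
  | nonsmooth
  | smooth

def stepSize (r : StepRule) (γ : ℝ) (t : ℕ) : ℝ :=
  match r with
  | .nonsmooth => 4 / (γ * t)
  | .smooth => 3 / (γ * (t + 1))

namespace Oracles

variable {d m : ℕ} {Sg Sl Sh : Type*} [MeasurableSpace Sg] [MeasurableSpace Sl]
  [MeasurableSpace Sh]

/-- The mean of the stochastic gradient of `g`. -/
def gMean (O : Oracles d m Sg Sl Sh) (Pg : Measure Sg) (x : Vec d) : Vec d :=
  ∫ s, O.gO x s ∂Pg

/-- The oracles are measurable and unbiased, and the conditions on the noise that are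
common to all cases hold. -/
structure IsAdmissible (O : Oracles d m Sg Sl Sh) (P : InfProjProblem d m)
    (Pg : Measure Sg) (Pl : Measure Sl) (Ph : Measure Sh) (σ : ℝ) : Prop where
  measurable_gO : Measurable (fun q : Vec d × Sg => O.gO q.1 q.2)
  measurable_lO : Measurable (fun q : Vec d × Sl => O.lO q.1 q.2)
  measurable_JO : Measurable (fun q : Vec d × Sl => O.JO q.1 q.2)
  measurable_hO : Measurable (fun q : Vec m × Sh => O.hO q.1 q.2)
  subgradient_g : ∀ x ∈ P.X, IsSubgradientOn P.g P.X x (O.gMean Pg x)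
  mean_lO : ∀ x ∈ P.X, ∫ s, O.lO x s ∂Pl = P.ℓ x
  mean_JO : ∀ x ∈ P.X, ∫ s, O.JO x s ∂Pl = P.J x
  subgradient_h : ∀ y ∈ P.Y, IsSubgradientOn P.h P.Y y (∫ s, O.hO y s ∂Ph)
  variance_lO : ∀ x ∈ P.X, SecondMomentLE Pl (fun s => O.lO x s - P.ℓ x) (σ ^ 2)
  secondMoment_hO : ∀ y ∈ P.Y, SecondMomentLE Ph (O.hO y) (σ ^ 2)

/-- `E ‖∂g(x; ξ)‖² ≤ σ²` on `X`. -/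
def SecondMomentG (O : Oracles d m Sg Sl Sh) (P : InfProjProblem d m) (Pg : Measure Sg)
    (σ : ℝ) : Prop :=
  ∀ x ∈ P.X, SecondMomentLE Pg (O.gO x) (σ ^ 2)

/-- `g` is `L`-smooth on `X`, the stochastic gradients are unbiased for `∇g`, and
`E ‖∂g(x; ξ) - ∇g(x)‖² ≤ σ²` on `X`. -/
def SmoothVarianceG (O : Oracles d m Sg Sl Sh) (P : InfProjProblem d m) (Pg : Measure Sg)
    (σ L : ℝ) : Prop :=
  (∀ x ∈ P.X, HasGradientWithinAt P.g (O.gMean Pg x) P.X x) ∧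
  (∀ x ∈ P.X, ∀ z ∈ P.X, ‖O.gMean Pg x - O.gMean Pg z‖ ≤ L * ‖x - z‖) ∧
  ∀ x ∈ P.X, SecondMomentLE Pg (fun s => O.gO x s - O.gMean Pg x) (σ ^ 2)

/-- `E ‖∇ℓ(x; ξ)‖² ≤ σ²` on `X`. -/
def SecondMomentJ (O : Oracles d m Sg Sl Sh) (P : InfProjProblem d m) (Pl : Measure Sl)
    (σ : ℝ) : Prop :=
  ∀ x ∈ P.X, SecondMomentLE Pl (O.JO x) (σ ^ 2)

/-- `E ‖∇ℓ(x; ξ) - ∇ℓ(x)‖² ≤ σ²` on `X`. -/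
def VarianceJ (O : Oracles d m Sg Sl Sh) (P : InfProjProblem d m) (Pl : Measure Sl)
    (σ : ℝ) : Prop :=
  ∀ x ∈ P.X, SecondMomentLE Pl (fun s => O.JO x s - P.J x) (σ ^ 2)

/-- The conditions on the stochastic gradients of the `x`-subproblems, depending on the family
of problems and on whether SPG runs with the step sizes for non-smooth or for smooth
subproblems. In the smooth case `γ` is at least three times the smoothness constant of
`f_x^k`, which is `L_g` for DC functions, as `f_x^k` is then `g` plus an affine function, and
`L_g + D L_ℓ` for bi-convex functions, where `‖y_k‖ ≤ D`. -/
def XCondition (O : Oracles d m Sg Sl Sh) (P : InfProjProblem d m) (Pg : Measure Sg)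
    (Pl : Measure Sl) (c : ProblemCase) (r : StepRule) (σ D γ : ℝ) : Prop :=
  match c, r with
  | .dc, .nonsmooth =>
      O.SecondMomentG P Pg σ ∧ (O.VarianceJ P Pl σ ∨ O.SecondMomentJ P Pl σ)
  | .biconvex, .nonsmooth =>
      O.SecondMomentG P Pg σ ∧ O.SecondMomentJ P Pl σ
  | .dc, .smooth =>
      ∃ L : ℝ, 0 ≤ L ∧ O.SmoothVarianceG P Pg σ L ∧
        (O.VarianceJ P Pl σ ∨ O.SecondMomentJ P Pl σ) ∧ 3 * L ≤ γ
  | .biconvex, .smooth =>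
      ∃ L Lℓ : ℝ, 0 ≤ L ∧ 0 ≤ Lℓ ∧ O.SmoothVarianceG P Pg σ L ∧
        (∀ x ∈ P.X, ∀ z ∈ P.X, ‖P.J x - P.J z‖ ≤ Lℓ * ‖x - z‖) ∧
        O.VarianceJ P Pl σ ∧ 3 * (L + D * Lℓ) ≤ γ

/-- Stochastic gradient of `f_x^k` at `z`. -/
def xGrad (O : Oracles d m Sg Sl Sh) (c : ProblemCase) (xk : Vec d) (yk : Vec m)
    (ξg : Sg) (ξl : Sl) (z : Vec d) : Vec d :=
  match c with
  | .dc => O.gO z ξg - ContinuousLinearMap.adjoint (O.JO xk ξl) yk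
  | .biconvex => O.gO z ξg - ContinuousLinearMap.adjoint (O.JO z ξl) yk

/-- Stochastic gradient of `f_y^k` at `z`, with `xk1 = x_{k+1}`. -/
def yGrad (O : Oracles d m Sg Sl Sh) (xk1 : Vec d) (ξh : Sh) (ξl : Sl) (z : Vec m) : Vec m :=
  O.hO z ξh - O.lO xk1 ξl

end Oracles

/-- `out` is the output of a run of SPG over the set `A`, with regularizer `R`, started
at `z₁`, with `T` steps, step sizes `η`, and stochastic gradient `G t z` at the
point `z` in step `t`. -/
def IsSPGOutput {n : ℕ} (G : ℕ → Vec n → Vec n) (R : Vec n → ℝ) (z₁ : Vec n) (A : Set (Vec n))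
    (T : ℕ) (η : ℕ → ℝ) (out : Vec n) : Prop :=
  ∃ z : ℕ → Vec n, z 1 = z₁ ∧
    (∀ t ∈ Finset.Icc 1 T, z (t + 1) ∈ A ∧
      IsMinOn (fun w => inner ℝ (G t (z t)) w + R w + 1 / (2 * η t) * ‖w - z t‖ ^ 2)
        A (z (t + 1))) ∧
    out = (∑ t ∈ Finset.Icc 1 T, (t : ℝ))⁻¹ • ∑ t ∈ Finset.Icc 1 T, (t : ℝ) • z t

/-- `x`, `y` are the iterates of St-SPG with `K` stages on the sample path `ζ`. Step `t` of
stage `k` draws `ζ k t = (ξ_g, ξ_ℓ, ξ_h, ξ_ℓ')`; the first two entries are used in the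
`x`-subproblem and the last two in the `y`-subproblem. -/
structure IsStSPGRun {d m : ℕ} {Sg Sl Sh : Type*} (P : InfProjProblem d m)
    (O : Oracles d m Sg Sl Sh) (c : ProblemCase) (r : StepRule) (γ μ : ℝ) (Tx Ty : ℕ → ℕ)
    (K : ℕ) (x₁ : Vec d) (y₁ : Vec m) (ζ : ℕ → ℕ → Sg × Sl × Sh × Sl)
    (x : ℕ → Vec d) (y : ℕ → Vec m) : Prop where
  init_x : x 1 = x₁
  init_y : y 1 = y₁
  step_x : ∀ k ∈ Finset.Icc 1 K,
    IsSPGOutput (fun t z => O.xGrad c (x k) (y k) (ζ k t).1 (ζ k t).2.1 z)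
      (fun w => γ / 2 * ‖w - x k‖ ^ 2) (x k) P.X (Tx k) (stepSize r γ) (x (k + 1))
  step_y : ∀ k ∈ Finset.Icc 1 K,
    IsSPGOutput (fun t z => O.yGrad (x (k + 1)) (ζ k t).2.2.1 (ζ k t).2.2.2 z)
      (fun w => μ / 2 * ‖w - y k‖ ^ 2) (y k) P.Y (Ty k) (stepSize .nonsmooth μ) (y (k + 1))

end

/-! ### Strong convexity and single proximal steps -/

section Convexity

variable {E : Type*} [NormedAddCommGroup E] [InnerProductSpace ℝ E]

/-! Each stage lowers `P.f` twice, from `f(x_k, y_k)` to `f(x_{k+1}, y_k)` and then to `f(x_{k+1},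
y_{k+1})`, up to an error of expectation `O(1/k)`. The proximal term makes a subproblem strongly
convex with modulus `γ` (resp. `μ`), so an approximate solution gains at least `γ/4 (‖x_k - v_k‖² +
‖x_{k+1} - x_k‖²)` minus the error (`stage_descent`). Progress on the surrogate is progress on `f`,
because in the DC case linearizing `ℓ` against `y ≥ 0` gives a majorant of `f(·, y_k)`, up to a
constant, that touches it at `x_k` (`fx_sub_le`).

In one step of SPG the strong convexity of the proximal objective gives a recursion for `‖z_t -
v‖²`. The noise enters linearly only through its inner product with `v - z_t`, which is determined
by other samples and therefore averages out; what remains is a second moment times `2/(γt)`. With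
weights `t` the recursion telescopes, and a run of length at least `k/γ + 1` has expected error at
most a constant over `k` (`exists_stage_error`, `sum_error_le`).

Probability needs two supports. Neither the iterates nor their independence of later samples is
assumed measurable or given: each iterate is the minimizer of a strongly convex objective, hence
continuous in its parameters and measurable for the σ-algebra of the samples it uses
(`measurable_of_isMinOn`). And the noise term has mean zero only once `v - z_t` is known to be
square integrable, which follows inductively from the oscillation bound `M` and the recursion
itself.

Finally the stages are summed with weights `k^α`. Summation by parts bounds the decrease of `f` by
`K^α M`, the errors add up to at most `K^α · 2G²`, and `∑ k^α ≥ K^(α+1)/(α+1)`; an independent index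
`τ` turns the weighted mean into the stated expectation. -/

theorem IsMinOn.add_sq_le_of_strongConvexOn {A : Set E} {Φ : E → ℝ} {c : ℝ}
    (hΦ : StrongConvexOn A c Φ) {p v : E} (hp : p ∈ A) (hv : v ∈ A) (hmin : IsMinOn Φ A p) :
    Φ p + c / 2 * ‖v - p‖ ^ 2 ≤ Φ v := by
  -- Strong convexity on the segment from `p` to `v`, combined with minimality of `p` and divided by
  -- the weight `s` of `v`. The limit `s → 0` restores the full modulus.
  have key : ∀ s ∈ Ioo (0 : ℝ) 1, Φ p + (1 - s) * (c / 2 * ‖v - p‖ ^ 2) ≤ Φ v := by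
    intro s hs
    have h1 := hΦ.2 hp hv (sub_nonneg.2 hs.2.le) hs.1.le (by ring)
    have h2 : Φ p ≤ _ := hmin (hΦ.1 hp hv (sub_nonneg.2 hs.2.le) hs.1.le (by ring))
    have h3 := h2.trans h1
    rw [norm_sub_rev p v] at h3
    simp only [smul_eq_mul] at h3
    have h4 : s * (Φ p + (1 - s) * (c / 2 * ‖v - p‖ ^ 2)) ≤ s * Φ v := by linarith
    exact le_of_mul_le_mul_left h4 hs.1
  have hlim : Filter.Tendsto (fun s : ℝ => Φ p + (1 - s) * (c / 2 * ‖v - p‖ ^ 2))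
      (nhdsWithin 0 (Ioo 0 1)) (nhds (Φ p + (1 - 0) * (c / 2 * ‖v - p‖ ^ 2))) := by
    apply Filter.Tendsto.mono_left _ nhdsWithin_le_nhds
    exact Continuous.tendsto (by fun_prop) 0
  have : (nhdsWithin (0 : ℝ) (Ioo 0 1)).NeBot := by
    rw [nhdsWithin_Ioo_eq_nhdsGT one_pos]; infer_instance
  have := le_of_tendsto hlim (Filter.eventually_of_mem self_mem_nhdsWithin key)
  linarith

theorem ConvexOn.strongConvexOn_add_sq {A : Set E} {f : E → ℝ} (hf : ConvexOn ℝ A f) (c : ℝ)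
    (a : E) : StrongConvexOn A c (fun w => f w + c / 2 * ‖w - a‖ ^ 2) := by
  rw [strongConvexOn_iff_convex]
  refine ⟨hf.1, fun x hx y hy s t hs ht hst => ?_⟩
  have h := hf.2 hx hy hs ht hst
  simp only [smul_eq_mul] at h ⊢
  have e : ∀ w : E, c / 2 * ‖w - a‖ ^ 2 - c / 2 * ‖w‖ ^ 2 = c / 2 * ‖a‖ ^ 2 - c * inner ℝ w a := by
    intro w
    rw [norm_sub_sq_real]; ring
  have e1 := e (s • x + t • y)
  rw [inner_add_left, inner_smul_left, inner_smul_left] at e1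
  simp only [conj_trivial] at e1
  have e2 := e x
  have e3 := e y
  have e4 : t = 1 - s := by linarith
  subst e4
  nlinarith

theorem StrongConvexOn.add_sq {A : Set E} {f : E → ℝ} {m : ℝ} (hf : StrongConvexOn A m f) (c : ℝ)
    (a : E) : StrongConvexOn A (m + c) (fun w => f w + c / 2 * ‖w - a‖ ^ 2) := by
  rw [strongConvexOn_iff_convex] at hf
  have h := (hf.strongConvexOn_add_sq c a)
  rw [strongConvexOn_iff_convex] at h ⊢
  convert h using 2 with w
  ring

/-- The subgradient at a convex combination, tested at both endpoints: the linear terms cancel in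
the weighted sum. This yields convexity of the subproblems directly from the mean oracle gradients.
-/
theorem convexOn_of_forall_subgradient {A : Set E} (hA : Convex ℝ A) {f : E → ℝ} {s : E → E}
    (hs : ∀ x ∈ A, ∀ z ∈ A, f x + inner ℝ (s x) (z - x) ≤ f z) : ConvexOn ℝ A f := by
  refine ⟨hA, fun x hx y hy a b ha hb hab => ?_⟩
  have hp := hA hx hy ha hb hab
  set p := a • x + b • y with hpdef
  have h1 := hs p hp x hx
  have h2 := hs p hp y hy
  have h3 : a * inner ℝ (s p) (x - p) + b * inner ℝ (s p) (y - p) = 0 := by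
    rw [← real_inner_smul_right, ← real_inner_smul_right, ← inner_add_right]
    have : a • (x - p) + b • (y - p) = p - (a + b) • p := by
      rw [hpdef]; module
    rw [this, hab, one_smul, sub_self, inner_zero_right]
  simp only [smul_eq_mul]
  have h4 := mul_le_mul_of_nonneg_left h1 ha
  have h5 := mul_le_mul_of_nonneg_left h2 hb
  have h6 : a * f p + b * f p = f p := by rw [← add_mul, hab, one_mul]
  linarith

/-- The three-point inequality of a proximal step with the regularizer `γ/2 ‖· - z₁‖²`. -/
theorem prox_step_le {A : Set E} (hA : Convex ℝ A) {γ η : ℝ} {G z₁ z z' v : E} (hz' : z' ∈ A)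
    (hv : v ∈ A)
    (hmin : IsMinOn (fun w => inner ℝ G w + γ / 2 * ‖w - z₁‖ ^ 2 + 1 / (2 * η) * ‖w - z‖ ^ 2)
      A z') :
    inner ℝ G z' + γ / 2 * ‖z' - z₁‖ ^ 2 + 1 / (2 * η) * ‖z' - z‖ ^ 2
        + (γ + 1 / η) / 2 * ‖v - z'‖ ^ 2 ≤
      inner ℝ G v + γ / 2 * ‖v - z₁‖ ^ 2 + 1 / (2 * η) * ‖v - z‖ ^ 2 := by
  have h0 : ConvexOn ℝ A (fun w : E => (inner ℝ G w : ℝ)) := (innerₛₗ ℝ G).convexOn hA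
  have h1 := (h0.strongConvexOn_add_sq γ z₁).add_sq (1 / η) z
  have e : ∀ w : E, 1 / η / 2 * ‖w - z‖ ^ 2 = 1 / (2 * η) * ‖w - z‖ ^ 2 := by
    intro w
    rw [div_div, mul_comm η 2]
  simp only [e] at h1
  exact hmin.add_sq_le_of_strongConvexOn h1 hz' hv

/-- Progress of one stochastic proximal step, when `f` is Lipschitz up to the linear part `b`. -/
theorem prox_step_nonsmooth {A : Set E} (hA : Convex ℝ A) {f : E → ℝ} {γ η β : ℝ} (hη : 0 < η)
    {G s b z₁ z z' v : E} (hz' : z' ∈ A) (hv : v ∈ A)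
    (hmin : IsMinOn (fun w => inner ℝ G w + γ / 2 * ‖w - z₁‖ ^ 2 + 1 / (2 * η) * ‖w - z‖ ^ 2)
      A z')
    (hs : f z + inner ℝ s (v - z) ≤ f v)
    (hb : f z' - f z - inner ℝ b (z' - z) ≤ β * ‖z' - z‖) :
    (f z' + γ / 2 * ‖z' - z₁‖ ^ 2) - (f v + γ / 2 * ‖v - z₁‖ ^ 2) ≤
      inner ℝ (G - s) (v - z) + η / 2 * (2 * ‖G - b‖ ^ 2 + 2 * β ^ 2)
        + 1 / (2 * η) * ‖z - v‖ ^ 2 - (γ + 1 / η) / 2 * ‖z' - v‖ ^ 2 := by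
  have h := prox_step_le hA hz' hv hmin
  rw [norm_sub_rev v z', norm_sub_rev v z] at h
  -- The noise against `v - z` is kept, since it does not involve `z'` and can average out. Only `G
  -- - b` meets the new point, and together with `β` it is absorbed by the quadratic `1/(2η) ‖z' -
  -- z‖²`.
  have h1 : inner ℝ (G - b) (z - z') ≤ ‖G - b‖ * ‖z' - z‖ := by
    rw [norm_sub_rev z' z]; exact real_inner_le_norm _ _
  have h2 : (‖G - b‖ + β) * ‖z' - z‖ ≤
      η / 2 * (2 * ‖G - b‖ ^ 2 + 2 * β ^ 2) + 1 / (2 * η) * ‖z' - z‖ ^ 2 := by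
    set p := ‖G - b‖
    set n := ‖z' - z‖
    have e : η / 2 * (p + β) ^ 2 + 1 / (2 * η) * n ^ 2 - (p + β) * n
        = 1 / (2 * η) * (η * (p + β) - n) ^ 2 := by field_simp; ring
    have e2 : 0 ≤ 1 / (2 * η) * (η * (p + β) - n) ^ 2 := by positivity
    have e3 : η / 2 * (p + β) ^ 2 ≤ η / 2 * (2 * p ^ 2 + 2 * β ^ 2) := by
      apply mul_le_mul_of_nonneg_left _ (by positivity)
      nlinarith [sq_nonneg (p - β)]
    linarith
  simp only [inner_sub_left, inner_sub_right] at *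
  linarith

/-- Progress of one stochastic proximal step on a smooth function. -/
theorem prox_step_smooth {A : Set E} (hA : Convex ℝ A) {f : E → ℝ} {γ t : ℝ} (hγ : 0 < γ)
    (ht : 1 ≤ t) {G s z₁ z z' v : E} (hz' : z' ∈ A) (hv : v ∈ A)
    (hmin : IsMinOn (fun w => inner ℝ G w + γ / 2 * ‖w - z₁‖ ^ 2
      + 1 / (2 * (3 / (γ * (t + 1)))) * ‖w - z‖ ^ 2) A z')
    (hs : f z + inner ℝ s (v - z) ≤ f v)
    (hb : f z' - f z - inner ℝ s (z' - z) ≤ γ / 6 * ‖z' - z‖ ^ 2) :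
    (f z' + γ / 2 * ‖z' - z₁‖ ^ 2) - (f v + γ / 2 * ‖v - z₁‖ ^ 2) ≤
      inner ℝ (G - s) (v - z) + 2 / (γ * t) * (2 * ‖G - s‖ ^ 2)
        + γ * (t + 1) / 6 * ‖z - v‖ ^ 2
        - (γ + γ * (t + 1) / 3) / 2 * ‖z' - v‖ ^ 2 := by
  have h := prox_step_le hA hz' hv hmin
  rw [norm_sub_rev v z', norm_sub_rev v z] at h
  have e1 : 1 / (2 * (3 / (γ * (t + 1)))) = γ * (t + 1) / 6 := by field_simp; norm_num
  have e2 : 1 / (3 / (γ * (t + 1))) = γ * (t + 1) / 3 := by field_simp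
  rw [e1, e2] at h
  have h1 : inner ℝ (G - s) (z - z') ≤ ‖G - s‖ * ‖z' - z‖ := by
    rw [norm_sub_rev z' z]; exact real_inner_le_norm _ _
  -- The quadratic has coefficient `γ(t+1)/6`: the share `γ/6` pays for the smoothness of `f` and
  -- `γt/6` for the noise. Young's inequality would give `3/(2γt)`; the larger `4/(γt)` matches the
  -- form of the non-smooth bound.
  have h2 : ‖G - s‖ * ‖z' - z‖ ≤
      2 / (γ * t) * (2 * ‖G - s‖ ^ 2) + γ * t / 6 * ‖z' - z‖ ^ 2 := by
    set p := ‖G - s‖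
    set n := ‖z' - z‖
    have e : 3 / (2 * γ * t) * p ^ 2 + γ * t / 6 * n ^ 2 - p * n
        = 1 / (6 * γ * t) * (3 * p - γ * t * n) ^ 2 := by field_simp; ring
    have e2 : 0 ≤ 1 / (6 * γ * t) * (3 * p - γ * t * n) ^ 2 := by positivity
    have e3 : 2 / (γ * t) * (2 * p ^ 2) - 3 / (2 * γ * t) * p ^ 2 = 5 / (2 * γ * t) * p ^ 2 := by
      field_simp; ring
    have e4 : 0 ≤ 5 / (2 * γ * t) * p ^ 2 := by positivity
    linarith
  have h3 : γ * (t + 1) / 6 * ‖z' - z‖ ^ 2 = γ * t / 6 * ‖z' - z‖ ^ 2 + γ / 6 * ‖z' - z‖ ^ 2 := by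
    ring
  simp only [inner_sub_left, inner_sub_right] at *
  linarith

/-- Summation of the recursion of proximal steps with weights `t`. -/
theorem weighted_recursion_le {a D p p' c m : ℕ → ℝ} {T : ℕ} (hT : 1 ≤ T) (hD : ∀ t, 0 ≤ D t)
    (hstep : ∀ t ∈ Finset.Ico 1 T, a (t + 1) ≤ m t + p t * D t - p' t * D (t + 1))
    (hc : ∀ t ∈ Finset.Ico 1 T, ((t : ℝ) + 1) * p t = c t)
    (hc' : ∀ t ∈ Finset.Ico 1 T, c (t + 1) ≤ ((t : ℝ) + 1) * p' t) :
    ∑ t ∈ Finset.Icc 1 T, (t : ℝ) * a t + c T * D T ≤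
      a 1 + c 1 * D 1 + ∑ t ∈ Finset.Ico 1 T, ((t : ℝ) + 1) * m t := by
  induction T, hT using Nat.le_induction with
  | base => simp
  | succ T hT ih =>
    have hsub : ∀ t ∈ Finset.Ico 1 T, t ∈ Finset.Ico 1 (T + 1) := fun t ht => by
      simp only [Finset.mem_Ico] at *; omega
    have h := ih (fun t ht => hstep t (hsub t ht)) (fun t ht => hc t (hsub t ht))
      (fun t ht => hc' t (hsub t ht))
    have hmem : T ∈ Finset.Ico 1 (T + 1) := by simp [hT]
    -- Step `T` controls `a (T + 1)`, so it is multiplied by `T + 1`. The first iterate is produced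
    -- by no step, hence the leftover `a 1 + c 1 * D 1`.
    have h1 := mul_le_mul_of_nonneg_left (hstep T hmem) (by positivity : (0 : ℝ) ≤ (T : ℝ) + 1)
    have h2 := hc T hmem
    have h3 := mul_le_mul_of_nonneg_right (hc' T hmem) (hD (T + 1))
    rw [← Finset.insert_Icc_right_eq_Icc_add_one (by omega), Finset.sum_insert (by simp),
      Finset.sum_Ico_succ_top hT]
    push_cast
    rw [← h2] at h
    linarith

end Convexity

/-! ### Descent over a whole run of SPG -/

section Stage

variable {E : Type*} [NormedAddCommGroup E] [InnerProductSpace ℝ E]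

theorem sum_Icc_one_cast (T : ℕ) : ∑ t ∈ Finset.Icc 1 T, (t : ℝ) = T * (T + 1) / 2 := by
  induction T with
  | zero => simp
  | succ T ih =>
    rw [← Finset.insert_Icc_right_eq_Icc_add_one (by omega), Finset.sum_insert (by simp), ih]
    push_cast; ring

theorem ConvexOn.map_weightedAverage_le {A : Set E} {F : E → ℝ} (hF : ConvexOn ℝ A F) {T : ℕ}
    (hT : 1 ≤ T) {z : ℕ → E} (hz : ∀ t ∈ Finset.Icc 1 T, z t ∈ A) :
    F ((∑ t ∈ Finset.Icc 1 T, (t : ℝ))⁻¹ • ∑ t ∈ Finset.Icc 1 T, (t : ℝ) • z t) ≤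
      2 / (T * (T + 1)) * ∑ t ∈ Finset.Icc 1 T, (t : ℝ) * F (z t) := by
  have hT' : (0 : ℝ) < T := by exact_mod_cast hT
  have hpos : (0 : ℝ) < ∑ t ∈ Finset.Icc 1 T, (t : ℝ) := by rw [sum_Icc_one_cast]; positivity
  have h := hF.map_centerMass_le (t := Finset.Icc 1 T) (w := fun t => (t : ℝ)) (p := z)
    (fun i _ => by positivity) hpos hz
  simp only [Finset.centerMass, smul_eq_mul] at h
  refine h.trans (le_of_eq ?_)
  rw [sum_Icc_one_cast, inv_div]
  rfl

theorem Convex.weightedAverage_mem {A : Set E} (hA : Convex ℝ A) {T : ℕ}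
    (hT : 1 ≤ T) {z : ℕ → E} (hz : ∀ t ∈ Finset.Icc 1 T, z t ∈ A) :
    (∑ t ∈ Finset.Icc 1 T, (t : ℝ))⁻¹ • ∑ t ∈ Finset.Icc 1 T, (t : ℝ) • z t ∈ A := by
  have hT' : (0 : ℝ) < T := by exact_mod_cast hT
  have hpos : (0 : ℝ) < ∑ t ∈ Finset.Icc 1 T, (t : ℝ) := by rw [sum_Icc_one_cast]; positivity
  exact hA.centerMass_mem (t := Finset.Icc 1 T) (w := fun t => (t : ℝ)) (z := z)
    (fun i _ => by positivity) hpos hz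

theorem sq_norm_sub_le_add {E : Type*} [NormedAddCommGroup E] (a b c : E) {l : ℝ} (hl : 0 < l) :
    ‖a - c‖ ^ 2 ≤ (1 + l) * ‖b - a‖ ^ 2 + (1 + 1 / l) * ‖b - c‖ ^ 2 := by
  have h : ‖a - c‖ ≤ ‖b - a‖ + ‖b - c‖ := by
    rw [norm_sub_rev b a]; exact norm_sub_le_norm_sub_add_norm_sub a b c
  have h2 : ‖a - c‖ ^ 2 ≤ (‖b - a‖ + ‖b - c‖) ^ 2 := by gcongr
  have e : (1 + l) * ‖b - a‖ ^ 2 + (1 + 1 / l) * ‖b - c‖ ^ 2 - (‖b - a‖ + ‖b - c‖) ^ 2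
      = 1 / l * (l * ‖b - a‖ - ‖b - c‖) ^ 2 := by field_simp; ring
  have e2 : 0 ≤ 1 / l * (l * ‖b - a‖ - ‖b - c‖) ^ 2 := by positivity
  linarith

/-- Descent over one run of the stochastic proximal gradient method, for the weighted average
of its iterates. -/
theorem stage_descent {A : Set E} {f : E → ℝ} (hf : ConvexOn ℝ A f) {γ : ℝ} (hγ : 0 < γ) {T : ℕ}
    (hT : 2 ≤ T) (r : StepRule) {z : ℕ → E} (hz : ∀ t ∈ Finset.Icc 1 T, z t ∈ A) {v out : E}
    (hv : v ∈ A) (hmin : IsMinOn (fun w => f w + γ / 2 * ‖w - z 1‖ ^ 2) A v) {m : ℕ → ℝ}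
    (hstep : ∀ t ∈ Finset.Ico 1 T,
      (f (z (t + 1)) + γ / 2 * ‖z (t + 1) - z 1‖ ^ 2) - (f v + γ / 2 * ‖v - z 1‖ ^ 2) ≤
        m t + 1 / (2 * stepSize r γ t) * ‖z t - v‖ ^ 2
          - (γ + 1 / stepSize r γ t) / 2 * ‖z (t + 1) - v‖ ^ 2)
    (hout : out = (∑ t ∈ Finset.Icc 1 T, (t : ℝ))⁻¹ • ∑ t ∈ Finset.Icc 1 T, (t : ℝ) • z t) :
    γ / 4 * (‖z 1 - v‖ ^ 2 + ‖out - z 1‖ ^ 2) ≤ f (z 1) - f out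
      + 2 / (T * (T + 1)) * ∑ t ∈ Finset.Ico 1 T, ((t : ℝ) + 1) * m t := by
  set F : E → ℝ := fun w => f w + γ / 2 * ‖w - z 1‖ ^ 2 with hF
  have hFs : StrongConvexOn A γ F := hf.strongConvexOn_add_sq γ (z 1)
  have hFc : ConvexOn ℝ A F := by
    have := hFs.mono hγ.le
    rwa [strongConvexOn_zero] at this
  have hz1 : z 1 ∈ A := hz 1 (by simp; omega)
  have hS : F v + γ / 2 * ‖z 1 - v‖ ^ 2 ≤ F (z 1) := hmin.add_sq_le_of_strongConvexOn hFs hv hz1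
  have hF1 : F (z 1) = f (z 1) := by simp [hF]
  have hFo : F out = f out + γ / 2 * ‖out - z 1‖ ^ 2 := rfl
  have hT2 : (2 : ℝ) ≤ T := by exact_mod_cast hT
  have havg := hFc.map_weightedAverage_le (by omega) hz
  rw [← hout] at havg
  have hD1 : 0 ≤ ‖z 1 - v‖ ^ 2 := by positivity
  have hQ : 0 ≤ ‖out - z 1‖ ^ 2 := by positivity
  have hsplit : ∑ t ∈ Finset.Icc 1 T, (t : ℝ) * F (z t) =
      ∑ t ∈ Finset.Icc 1 T, (t : ℝ) * (F (z t) - F v) + T * (T + 1) / 2 * F v := by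
    rw [← sum_Icc_one_cast, Finset.sum_mul, ← Finset.sum_add_distrib]
    exact Finset.sum_congr rfl fun t _ => by ring
  set R := ∑ t ∈ Finset.Ico 1 T, ((t : ℝ) + 1) * m t with hR
  -- With `ρ = 2/(T(T+1))`, Jensen and the recursion give `F out - F v ≤ ρ (F z₁ - F v + κγ‖z₁ - v‖²
  -- + R)`. Since `F z₁ - F v ≥ γ/2 ‖z₁ - v‖²`, the factor left for `γ‖z₁ - v‖²` is `1/2 - ρ(1/2 +
  -- κ)`, and the last condition makes it at least `1/4`.
  have main : ∀ (c : ℕ → ℝ) (κ : ℝ), c 1 = κ * γ → 0 ≤ κ → 0 ≤ c T →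
      (∀ t ∈ Finset.Ico 1 T, ((t : ℝ) + 1) * (1 / (2 * stepSize r γ t)) = c t) →
      (∀ t ∈ Finset.Ico 1 T, c (t + 1) ≤ ((t : ℝ) + 1) * ((γ + 1 / stepSize r γ t) / 2)) →
      2 / (T * (T + 1)) * (1 / 2 + κ) ≤ 1 / 4 →
      γ / 4 * (‖z 1 - v‖ ^ 2 + ‖out - z 1‖ ^ 2) ≤ f (z 1) - f out + 2 / (T * (T + 1)) * R := by
    intro c κ hc1 hκ hcT hc hc' hρ
    have h := weighted_recursion_le (a := fun t => F (z t) - F v) (D := fun t => ‖z t - v‖ ^ 2)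
      (p := fun t => 1 / (2 * stepSize r γ t)) (p' := fun t => (γ + 1 / stepSize r γ t) / 2)
      (c := c) (m := m) (T := T) (by omega) (fun t => by positivity) hstep hc hc'
    have hcD : 0 ≤ c T * ‖z T - v‖ ^ 2 := by positivity
    set ρ := 2 / ((T : ℝ) * (T + 1)) with hρdef
    have hρ0 : 0 ≤ ρ := by positivity
    have hρT : ρ * (T * (T + 1) / 2 * F v) = F v := by rw [hρdef]; field_simp
    have h3 : F out ≤ ρ * (F (z 1) - F v + κ * γ * ‖z 1 - v‖ ^ 2 + R) + F v := by
      calc F out ≤ _ := havg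
        _ = ρ * ∑ t ∈ Finset.Icc 1 T, (t : ℝ) * (F (z t) - F v) + F v := by
          rw [hsplit, mul_add, hρT]
        _ ≤ _ := by
          rw [← hc1]
          gcongr
          linarith
    have hρ1 : ρ ≤ 1 := by nlinarith
    have h5 : γ / 2 * ‖z 1 - v‖ ^ 2 * (1 - ρ) ≤ (F (z 1) - F v) * (1 - ρ) := by
      apply mul_le_mul_of_nonneg_right _ (by linarith); linarith
    have h6 : (ρ * (1 / 2 + κ)) * (γ * ‖z 1 - v‖ ^ 2) ≤ 1 / 4 * (γ * ‖z 1 - v‖ ^ 2) :=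
      mul_le_mul_of_nonneg_right hρ (by positivity)
    have h7 : 0 ≤ γ * ‖out - z 1‖ ^ 2 := by positivity
    nlinarith
  cases r with
  | nonsmooth =>
    simp only [stepSize] at main hstep ⊢
    -- The final condition is an equality at `T = 2`, where `ρ = 1/3`.
    apply main (fun t => γ * (t * (t + 1)) / 8) (1 / 4)
    · norm_num; ring
    · norm_num
    · positivity
    · intro t ht
      have : (1 : ℝ) ≤ t := by exact_mod_cast (Finset.mem_Ico.1 ht).1
      field_simp; norm_num
    · intro t ht
      have h1 : (1 : ℝ) ≤ t := by exact_mod_cast (Finset.mem_Ico.1 ht).1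
      have e : 1 / (4 / (γ * (t : ℝ))) = γ * t / 4 := by field_simp
      rw [e]; push_cast
      have : 0 ≤ γ * ((t : ℝ) + 1) := by positivity
      nlinarith
    · rw [div_mul_eq_mul_div, div_le_iff₀ (by positivity)]; nlinarith
  | smooth =>
    have e2 : ∀ t : ℕ, 1 / (3 / (γ * ((t : ℝ) + 1))) = γ * (t + 1) / 3 := by
      intro t; field_simp
    have e1 : ∀ t : ℕ, 1 / (2 * (3 / (γ * ((t : ℝ) + 1)))) = γ * (t + 1) / 6 := by
      intro t; field_simp; norm_num
    simp only [stepSize, e1, e2] at main hstep ⊢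
    -- Here `κ = 2/3`, and `ρ(1/2 + κ) ≤ 1/4` fails at `T = 2`. That case keeps two terms the
    -- general argument discards: the strong convexity gain in averaging `z 1` and `z 2`, and the
    -- term in `‖z 2 - v‖²`.
    rcases hT.eq_or_lt with rfl | hT3
    · have h := hstep 1 (by simp)
      have hR' : R = 2 * m 1 := by rw [hR]; norm_num [Finset.sum_Ico_succ_top]
      have ho : out = (1 / 3 : ℝ) • z 1 + (2 / 3 : ℝ) • z 2 := by
        rw [hout]
        have : Finset.Icc 1 2 = {1, 2} := rfl
        rw [this]
        rw [Finset.sum_insert (by simp), Finset.sum_insert (by simp)]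
        simp only [Finset.sum_singleton]
        norm_num [smul_add, smul_smul]
      have hs := hFs.2 hz1 (hz 2 (by simp)) (by norm_num : (0 : ℝ) ≤ 1 / 3)
        (by norm_num : (0 : ℝ) ≤ 2 / 3) (by norm_num)
      rw [← ho] at hs
      have hoz : ‖out - z 1‖ ^ 2 = 4 / 9 * ‖z 2 - z 1‖ ^ 2 := by
        have : out - z 1 = (2 / 3 : ℝ) • (z 2 - z 1) := by rw [ho]; module
        rw [this, norm_smul, mul_pow]; norm_num
      -- What is needed is `‖z₁ - v‖² ≤ 8/5 ‖z₂ - z₁‖² + 4 ‖z₂ - v‖²`; the choice `l = 2/5` gives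
      -- the coefficients `7/5` and `7/2`.
      have htri := sq_norm_sub_le_add (z 1) (z 2) v (by norm_num : (0 : ℝ) < 2 / 5)
      rw [norm_sub_rev (z 1) (z 2)] at hs
      simp only [smul_eq_mul] at hs
      norm_num at h htri hs hR'
      rw [hR']
      push_cast
      rw [hoz] at hFo ⊢
      have h1 := mul_le_mul_of_nonneg_left htri hγ.le
      have : 0 ≤ γ * ‖z 2 - v‖ ^ 2 := by positivity
      have : 0 ≤ γ * ‖z 2 - z 1‖ ^ 2 := by positivity
      have hF2 : F (z 2) = f (z 2) + γ / 2 * ‖z 2 - z 1‖ ^ 2 := rfl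
      have hFv : F v = f v + γ / 2 * ‖v - z 1‖ ^ 2 := rfl
      linarith
    · have hT3' : (3 : ℝ) ≤ T := by exact_mod_cast hT3
      apply main (fun t => γ * ((t : ℝ) + 1) ^ 2 / 6) (2 / 3)
      · norm_num; ring
      · norm_num
      · positivity
      · intro t ht
        ring
      · intro t ht
        have h1 : (1 : ℝ) ≤ t := by exact_mod_cast (Finset.mem_Ico.1 ht).1
        push_cast
        have : 0 ≤ γ * (t : ℝ) := by positivity
        nlinarith
      · rw [div_mul_eq_mul_div, div_le_iff₀ (by positivity)]; nlinarith

/-- The accumulated error factor `n (n + H_n)` of a run with `n + 1` steps. -/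
theorem mul_add_harmonic_le (n : ℕ) :
    (n : ℝ) * ∑ t ∈ Finset.Ico 1 (n + 1), (1 + 1 / (t : ℝ)) ≤ 7 / 6 * ((n + 1) * (n + 2)) := by
  -- From `n = 6` on, each new summand is at most `1 + 1/6`, which explains the slope `7/6`; the
  -- smaller cases are checked by hand and fix the offset `3/2`.
  have h : ∀ n : ℕ, ∑ t ∈ Finset.Ico 1 (n + 1), (1 + 1 / (t : ℝ)) ≤ 7 / 6 * n + 3 / 2 := by
    intro n
    rcases le_or_gt n 5 with hn | hn
    · interval_cases n <;> norm_num [Finset.sum_Ico_succ_top]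
    · induction n, (show 6 ≤ n from hn) using Nat.le_induction with
      | base => norm_num [Finset.sum_Ico_succ_top]
      | succ n hn6 ih =>
        rw [Finset.sum_Ico_succ_top (by omega)]
        have h6 : (6 : ℝ) ≤ (n : ℝ) + 1 := by
          have : (6 : ℝ) ≤ n := by exact_mod_cast hn6
          linarith
        have h7 : 1 / ((n : ℝ) + 1) ≤ 1 / 6 := one_div_le_one_div_of_le (by norm_num) h6
        have := ih (by omega)
        push_cast
        linarith
  have h1 := mul_le_mul_of_nonneg_left (h n) (Nat.cast_nonneg (α := ℝ) n)
  have h2 : (0 : ℝ) ≤ n := Nat.cast_nonneg n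
  nlinarith

end Stage

/-! ### Gradient inequality and descent lemma on convex sets -/

section Differentiable

variable {E : Type*} [NormedAddCommGroup E] [NormedSpace ℝ E]

theorem Convex.add_smul_mem_of_mem_Icc {A : Set E} (hA : Convex ℝ A) {z w : E} (hz : z ∈ A)
    (hw : w ∈ A) {t : ℝ} (ht : t ∈ Icc (0 : ℝ) 1) : z + t • (w - z) ∈ A :=
  hA.add_smul_sub_mem hz hw ht

theorem HasFDerivWithinAt.hasDerivWithinAt_segment {A : Set E} (hA : Convex ℝ A) {f : E → ℝ}
    {z w : E} (hz : z ∈ A) (hw : w ∈ A) {t : ℝ} {f' : E →L[ℝ] ℝ}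
    (hf : HasFDerivWithinAt f f' A (z + t • (w - z))) :
    HasDerivWithinAt (fun t : ℝ => f (z + t • (w - z))) (f' (w - z)) (Icc 0 1) t := by
  have h1 : HasDerivWithinAt (fun t : ℝ => z + t • (w - z)) (w - z) (Icc 0 1) t := by
    simpa using ((hasDerivAt_id t).smul_const (w - z)).const_add z |>.hasDerivWithinAt
  exact hf.comp_hasDerivWithinAt t h1 fun s hs => hA.add_smul_mem_of_mem_Icc hz hw hs

/-- Only right slopes at `0` along the segment are used, so boundary points of `A` are allowed. -/
theorem ConvexOn.add_fderivWithin_le {A : Set E} {f : E → ℝ} (hf : ConvexOn ℝ A f)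
    {z w : E} (hz : z ∈ A) (hw : w ∈ A) {f' : E →L[ℝ] ℝ} (hf' : HasFDerivWithinAt f f' A z) :
    f z + f' (w - z) ≤ f w := by
  have h0 : HasFDerivWithinAt f f' A (z + (0 : ℝ) • (w - z)) := by simpa using hf'
  have h1 := (h0.hasDerivWithinAt_segment hf.1 hz hw).mono (Ioc_subset_Icc_self)
  rw [hasDerivWithinAt_iff_tendsto_slope' (by simp)] at h1
  have : (nhdsWithin (0 : ℝ) (Ioc 0 1)).NeBot := by
    rw [nhdsWithin_Ioc_eq_nhdsGT one_pos]; infer_instance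
  have h2 : f' (w - z) ≤ f w - f z := by
    refine le_of_tendsto h1 (Filter.eventually_of_mem self_mem_nhdsWithin fun t ht => ?_)
    rw [slope_def_field, div_le_iff₀ (by simpa using ht.1)]
    have h3 := hf.2 hz hw (sub_nonneg.2 ht.2) ht.1.le (by ring)
    have e : (1 - t) • z + t • w = z + t • (w - z) := by module
    rw [e] at h3
    simp only [smul_eq_mul, zero_smul, add_zero, sub_zero] at h3 ⊢
    linarith
  linarith

/-- The descent lemma on a convex set. -/
theorem sub_le_of_lipschitz_fderivWithin {A : Set E} (hA : Convex ℝ A) {f : E → ℝ}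
    {f' : E → E →L[ℝ] ℝ} (hf : ∀ x ∈ A, HasFDerivWithinAt f (f' x) A x) {L : ℝ}
    {z w : E} (hz : z ∈ A) (hw : w ∈ A)
    (hL : ∀ x ∈ A, (f' x - f' z) (w - z) ≤ L * ‖x - z‖ * ‖w - z‖) :
    f w - f z - f' z (w - z) ≤ L / 2 * ‖w - z‖ ^ 2 := by
  -- The Lipschitz bound makes the derivative of `ψ` nonpositive, so comparing `ψ 0` with `ψ 1`
  -- replaces integration of the derivative.
  set ψ : ℝ → ℝ := fun t => f (z + t • (w - z)) - t * f' z (w - z) - L / 2 * t ^ 2 * ‖w - z‖ ^ 2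
  have hd : ∀ t ∈ Icc (0 : ℝ) 1, HasDerivWithinAt ψ
      (f' (z + t • (w - z)) (w - z) - f' z (w - z) - L * t * ‖w - z‖ ^ 2) (Icc 0 1) t := by
    intro t ht
    have h1 := (hf _ (hA.add_smul_mem_of_mem_Icc hz hw ht)).hasDerivWithinAt_segment hA hz hw
    have h2 : HasDerivAt (fun t : ℝ => t * f' z (w - z)) (f' z (w - z)) t := by
      simpa using (hasDerivAt_id t).mul_const (f' z (w - z))
    have h3 : HasDerivAt (fun t : ℝ => L / 2 * t ^ 2 * ‖w - z‖ ^ 2) (L * t * ‖w - z‖ ^ 2) t := by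
      exact (((hasDerivAt_pow 2 t).const_mul (L / 2)).mul_const (‖w - z‖ ^ 2)).congr_deriv
        (by push_cast; ring)
    exact (h1.sub h2.hasDerivWithinAt).sub h3.hasDerivWithinAt
  have hanti : AntitoneOn ψ (Icc 0 1) := by
    refine antitoneOn_of_hasDerivWithinAt_nonpos (convex_Icc 0 1)
      (fun t ht => (hd t ht).continuousWithinAt)
      (fun t ht => (hd t (interior_subset ht)).mono interior_subset) fun t ht => ?_
    have ht' := interior_subset ht
    have h := hL _ (hA.add_smul_mem_of_mem_Icc hz hw ht')
    rw [add_sub_cancel_left, norm_smul, Real.norm_of_nonneg ht'.1,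
      sub_apply] at h
    nlinarith
  have h := hanti (left_mem_Icc.2 zero_le_one) (right_mem_Icc.2 zero_le_one) zero_le_one
  simp only [ψ, zero_smul, add_zero, one_smul, add_sub_cancel] at h
  linarith

end Differentiable

/-! ### Measurable dependence of minimizers on parameters -/

section Argmin

/-- A minimizer depends measurably on parameters on which the strongly convex objective depends
continuously, uniformly near the minimizer. -/
theorem measurable_of_isMinOn {Ω Θ E : Type*} [MeasurableSpace Ω] [TopologicalSpace Θ]
    [MeasurableSpace Θ] [BorelSpace Θ] [NormedAddCommGroup E] [NormedSpace ℝ E]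
    [MeasurableSpace E] [BorelSpace E] {A : Set E} {q : Ω → Θ} (hq : Measurable q)
    {F : Ω → E → ℝ} {w : Ω → E} {c : ℝ} (hc : 0 < c) (hw : ∀ ω, w ω ∈ A)
    (hmin : ∀ ω, IsMinOn (F ω) A (w ω)) (hconv : ∀ ω, ConvexOn ℝ A (F ω))
    (hgrowth : ∀ ω, ∀ z ∈ A, F ω (w ω) + c * ‖z - w ω‖ ^ 2 ≤ F ω z)
    (hmod : ∀ ω₀, ∃ δ : Ω → ℝ, Filter.Tendsto δ (Filter.comap q (nhds (q ω₀))) (nhds 0) ∧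
      ∀ ω, ∀ z ∈ A, ‖z - w ω₀‖ ≤ 1 →
        (F ω₀ z - F ω z) - (F ω₀ (w ω₀) - F ω (w ω₀)) ≤ δ ω) : Measurable w := by
  -- Continuity for the topology pulled back along `q` suffices: its Borel σ-algebra is the pullback
  -- of that of `Θ`, which measurability of `q` places below the given one.
  have hcont : @Continuous Ω E (TopologicalSpace.induced q inferInstance) _ w := by
    let : TopologicalSpace Ω := TopologicalSpace.induced q inferInstance
    refine continuous_iff_continuousAt.2 fun ω₀ => ?_
    rw [ContinuousAt, nhds_induced, Metric.tendsto_nhds]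
    intro ε hε
    obtain ⟨δ, hδ, hδ'⟩ := hmod ω₀
    have hev := (tendsto_order.1 hδ).2 (c * (min ε 1) ^ 2) (by positivity)
    filter_upwards [hev] with ω hω
    by_contra hcon
    rw [not_lt, dist_eq_norm] at hcon
    set n := ‖w ω - w ω₀‖ with hn
    have hn0 : 0 < n := hε.trans_le hcon
    set s := min ε 1 / n with hs
    have hs0 : 0 ≤ s := by positivity
    have hs1 : s ≤ 1 := (div_le_one hn0).2 ((min_le_left _ _).trans hcon)
    -- If the minimizers were `ε` apart, take the point of the segment at distance `min ε 1` from `w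
    -- ω₀`. Growth at `ω₀` makes it costly for `F ω₀`, while convexity makes it no worse than `w ω₀`
    -- for `F ω`; the gap contradicts the modulus. Moving to this point is why a modulus on the unit
    -- ball is enough.
    set z := w ω₀ + s • (w ω - w ω₀) with hz
    have hzA : z ∈ A := (hconv ω).1.add_smul_sub_mem (hw ω₀) (hw ω) ⟨hs0, hs1⟩
    have hzn : ‖z - w ω₀‖ = min ε 1 := by
      rw [hz, add_sub_cancel_left, norm_smul, Real.norm_of_nonneg hs0, hs]
      exact div_mul_cancel₀ _ hn0.ne'
    have h1 := hδ' ω z hzA (by rw [hzn]; exact min_le_right _ _)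
    have h2 := hgrowth ω₀ z hzA
    rw [hzn] at h2
    have h3 := (hconv ω).2 (hw ω₀) (hw ω) (sub_nonneg.2 hs1) hs0 (by ring)
    have e : (1 - s) • w ω₀ + s • w ω = z := by rw [hz]; module
    rw [e] at h3
    simp only [smul_eq_mul] at h3
    have h4 : F ω (w ω) ≤ F ω (w ω₀) := hmin ω (hw ω₀)
    nlinarith
  have hle : (borel Θ).comap q ≤ ‹MeasurableSpace Ω› := by
    rw [← BorelSpace.measurable_eq (α := Θ)]
    exact hq.comap_le
  refine Measurable.mono (ma := (borel Θ).comap q) ?_ hle le_rfl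
  rw [← borel_comap]
  let : TopologicalSpace Ω := TopologicalSpace.induced q inferInstance
  let : MeasurableSpace Ω := borel Ω
  have : BorelSpace Ω := ⟨rfl⟩
  exact hcont.measurable

end Argmin

/-! ### Integration against fresh samples -/

section FreshNoise

variable {Ω Θ S V : Type*} [MeasurableSpace Ω] [MeasurableSpace Θ] [MeasurableSpace S]
  [NormedAddCommGroup V] {Pr : Measure Ω}

theorem integrable_inner_of_memLp [InnerProductSpace ℝ V] {f g : Ω → V} (hf : MemLp f 2 Pr)
    (hg : MemLp g 2 Pr) : Integrable (fun ω => inner ℝ (f ω) (g ω)) Pr := by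
  refine (hf.integrable_norm_pow two_ne_zero |>.add (hg.integrable_norm_pow two_ne_zero)).mono'
    (hf.1.inner hg.1) (Filter.Eventually.of_forall fun ω => ?_)
  refine (norm_inner_le_norm _ _).trans ?_
  simp only [Pi.add_apply]
  nlinarith [sq_nonneg (‖f ω‖ - ‖g ω‖), sq_nonneg ‖f ω‖, sq_nonneg ‖g ω‖]

theorem memLp_two_of_integrable_sq {f : Ω → V} (hf : AEStronglyMeasurable f Pr)
    (h : Integrable (fun ω => ‖f ω‖ ^ 2) Pr) : MemLp f 2 Pr :=
  (memLp_two_iff_integrable_sq_norm hf).2 h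

variable [MeasurableSpace V] [BorelSpace V]
  [SecondCountableTopology V] [IsProbabilityMeasure Pr]
  {Q : Measure S} [IsProbabilityMeasure Q]

/-- Replaces the sample by an independent copy on `Ω × S`. Fubini then has `Ω` itself as outer
space, so that conditional bounds can be stated for almost every `ω`. -/
theorem ProbabilityTheory.IndepFun.map_prodMk_eq {θ : Ω → Θ} {ξ : Ω → S} (hθ : Measurable θ)
    (hξ : Measurable ξ) (hind : IndepFun θ ξ Pr) (hQ : Pr.map ξ = Q) :
    Pr.map (fun ω => (θ ω, ξ ω)) = (Pr.prod Q).map (Prod.map θ id) := by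
  rw [(indepFun_iff_map_prod_eq_prod_map_map hθ.aemeasurable hξ.aemeasurable).1 hind, hQ,
    ← Measure.map_prod_map _ _ hθ measurable_id, Measure.map_id]

/-- A second moment bound that holds conditionally on an independent parameter. -/
theorem SecondMomentLE.of_indepFun {θ : Ω → Θ} {ξ : Ω → S} (hθ : Measurable θ)
    (hξ : Measurable ξ) (hind : IndepFun θ ξ Pr) (hQ : Pr.map ξ = Q) {H : Θ × S → V}
    (hH : Measurable H) {C : ℝ} (h : ∀ᵐ ω ∂Pr, SecondMomentLE Q (fun s => H (θ ω, s)) C) :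
    SecondMomentLE Pr (fun ω => H (θ ω, ξ ω)) C := by
  have hmap := hind.map_prodMk_eq hθ hξ hQ
  have hpair : Measurable (fun ω => (θ ω, ξ ω)) := hθ.prodMk hξ
  have hpm : Measurable (Prod.map θ (id : S → S)) := hθ.prodMap measurable_id
  have hN : Measurable (fun q => ‖H q‖ ^ 2) := (hH.norm).pow_const 2
  have hNs : Measurable (fun p : Ω × S => ‖H (θ p.1, p.2)‖ ^ 2) := hN.comp hpm
  have hint : Integrable (fun p : Ω × S => ‖H (θ p.1, p.2)‖ ^ 2) (Pr.prod Q) := by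
    rw [integrable_prod_iff hNs.aestronglyMeasurable]
    refine ⟨h.mono fun ω hω => hω.1.integrable_norm_pow two_ne_zero, ?_⟩
    refine Integrable.mono' (integrable_const C)
      hNs.norm.stronglyMeasurable.integral_prod_right.aestronglyMeasurable
      (h.mono fun ω hω => ?_)
    rw [Real.norm_of_nonneg (integral_nonneg fun s => norm_nonneg _)]
    simpa using hω.2
  have hint' : Integrable (fun ω => ‖H (θ ω, ξ ω)‖ ^ 2) Pr := by
    have : Integrable (fun q => ‖H q‖ ^ 2) (Pr.map (fun ω => (θ ω, ξ ω))) := by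
      rw [hmap, integrable_map_measure hN.aestronglyMeasurable hpm.aemeasurable]
      exact hint
    exact this.comp_measurable hpair
  refine ⟨memLp_two_of_integrable_sq (hH.comp hpair).aestronglyMeasurable hint', ?_⟩
  have e : ∫ ω, ‖H (θ ω, ξ ω)‖ ^ 2 ∂Pr = ∫ p : Ω × S, ‖H (θ p.1, p.2)‖ ^ 2 ∂(Pr.prod Q) := by
    rw [← integral_map (f := fun q => ‖H q‖ ^ 2) hpair.aemeasurable hN.aestronglyMeasurable, hmap,
      integral_map hpm.aemeasurable hN.aestronglyMeasurable]
    rfl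
  rw [e, integral_prod _ hint]
  calc ∫ ω, ∫ s, ‖H (θ ω, s)‖ ^ 2 ∂Q ∂Pr ≤ ∫ _, C ∂Pr :=
        integral_mono_ae hint.integral_prod_left (integrable_const C) (h.mono fun ω hω => hω.2)
    _ = C := by simp

/-- Fresh centred noise is orthogonal to square integrable functions of the past. -/
theorem integral_inner_eq_zero_of_indepFun [InnerProductSpace ℝ V] [CompleteSpace V] {θ : Ω → Θ} {ξ : Ω → S}
    (hθ : Measurable θ)
    (hξ : Measurable ξ) (hind : IndepFun θ ξ Pr) (hQ : Pr.map ξ = Q) {H : Θ × S → V}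
    (hH : Measurable H) (hmem : MemLp (fun ω => H (θ ω, ξ ω)) 2 Pr)
    (hi : ∀ᵐ ω ∂Pr, Integrable (fun s => H (θ ω, s)) Q)
    (h : ∀ᵐ ω ∂Pr, ∫ s, H (θ ω, s) ∂Q = 0) {W : Θ → V} (hW : Measurable W)
    (hWmem : MemLp (fun ω => W (θ ω)) 2 Pr) :
    ∫ ω, inner ℝ (H (θ ω, ξ ω)) (W (θ ω)) ∂Pr = 0 := by
  have hmap := hind.map_prodMk_eq hθ hξ hQ
  have hpair : Measurable (fun ω => (θ ω, ξ ω)) := hθ.prodMk hξ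
  have hpm : Measurable (Prod.map θ (id : S → S)) := hθ.prodMap measurable_id
  have hI : Measurable (fun q : Θ × S => (inner ℝ (H q) (W q.1) : ℝ)) :=
    hH.inner (hW.comp measurable_fst)
  have hint : Integrable (fun p : Ω × S => (inner ℝ (H (θ p.1, p.2)) (W (θ p.1)) : ℝ))
      (Pr.prod Q) := by
    have : Integrable (fun q : Θ × S => (inner ℝ (H q) (W q.1) : ℝ))
        (Pr.map (fun ω => (θ ω, ξ ω))) := by
      rw [integrable_map_measure hI.aestronglyMeasurable hpair.aemeasurable]
      exact integrable_inner_of_memLp hmem hWmem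
    rw [hmap, integrable_map_measure hI.aestronglyMeasurable hpm.aemeasurable] at this
    exact this
  have e : ∫ ω, inner ℝ (H (θ ω, ξ ω)) (W (θ ω)) ∂Pr
      = ∫ p : Ω × S, inner ℝ (H (θ p.1, p.2)) (W (θ p.1)) ∂(Pr.prod Q) := by
    rw [← integral_map (f := fun q : Θ × S => (inner ℝ (H q) (W q.1) : ℝ)) hpair.aemeasurable
      hI.aestronglyMeasurable, hmap, integral_map hpm.aemeasurable hI.aestronglyMeasurable]
    rfl
  rw [e, integral_prod _ hint]
  -- With the past frozen, the inner integral over the sample pairs the zero mean of `H` with a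
  -- constant vector.
  refine integral_eq_zero_of_ae ?_
  filter_upwards [hi, h] with ω h1 h2
  have : ∫ s, inner ℝ (H (θ ω, s)) (W (θ ω)) ∂Q = ∫ s, inner ℝ (W (θ ω)) (H (θ ω, s)) ∂Q :=
    integral_congr_ae (Filter.Eventually.of_forall fun s => real_inner_comm _ _)
  simp only [this, integral_inner h1, h2, inner_zero_right, Pi.zero_apply]

end FreshNoise

/-! ### Expected error of a run of SPG -/

section StageError

/-- Control of `f` along one step of SPG: up to the linear part `b`, it is Lipschitz
(non-smooth case) or smooth with `b` the gradient (smooth case). -/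
def StepBound {n : ℕ} (r : StepRule) (f : Vec n → ℝ) (γ β : ℝ) (s b z z' : Vec n) : Prop :=
  match r with
  | .nonsmooth => f z' - f z - inner ℝ b (z' - z) ≤ β * ‖z' - z‖
  | .smooth => b = s ∧ f z' - f z - inner ℝ b (z' - z) ≤ γ / 6 * ‖z' - z‖ ^ 2

/-- Brings both step rules to one error term. In the non-smooth case `η/2 = 2/(γt)` exactly; in the
smooth case the `β` part is nonnegative slack. -/
theorem StepBound.progress {n : ℕ} {r : StepRule} {A : Set (Vec n)} (hA : Convex ℝ A)
    {f : Vec n → ℝ} {γ β : ℝ} (hγ : 0 < γ) {t : ℕ} (ht : 1 ≤ t) {G s b z₁ z z' v : Vec n}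
    (hz' : z' ∈ A) (hv : v ∈ A)
    (hmin : IsMinOn (fun w => inner ℝ G w + γ / 2 * ‖w - z₁‖ ^ 2
      + 1 / (2 * stepSize r γ t) * ‖w - z‖ ^ 2) A z')
    (hs : f z + inner ℝ s (v - z) ≤ f v) (hb : StepBound r f γ β s b z z') :
    (f z' + γ / 2 * ‖z' - z₁‖ ^ 2) - (f v + γ / 2 * ‖v - z₁‖ ^ 2) ≤
      (inner ℝ (G - s) (v - z) + 2 / (γ * t) * (2 * ‖G - b‖ ^ 2 + 2 * β ^ 2))
        + 1 / (2 * stepSize r γ t) * ‖z - v‖ ^ 2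
        - (γ + 1 / stepSize r γ t) / 2 * ‖z' - v‖ ^ 2 := by
  have ht' : (1 : ℝ) ≤ t := by exact_mod_cast ht
  cases r with
  | nonsmooth =>
    have h := prox_step_nonsmooth hA (by simp only [stepSize]; positivity) hz' hv hmin hs hb
    have e : stepSize .nonsmooth γ t / 2 = 2 / (γ * t) := by
      simp only [stepSize]; field_simp; norm_num
    rwa [e] at h
  | smooth =>
    obtain ⟨rfl, hb⟩ := hb
    simp only [stepSize] at hmin ⊢
    have h := prox_step_smooth hA hγ ht' hz' hv hmin hs hb
    have e1 : 1 / (2 * (3 / (γ * ((t : ℝ) + 1)))) = γ * (t + 1) / 6 := by field_simp; norm_num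
    have e2 : 1 / (3 / (γ * ((t : ℝ) + 1))) = γ * (t + 1) / 3 := by field_simp
    rw [e1, e2]
    have h2 : 0 ≤ 2 / (γ * t) * (2 * β ^ 2) := by positivity
    linarith

/-- This is where the stage length matters: for `T = n + 1` the hypothesis says `γn ≥ k`. The
weights turn the sum into `2Q/γ · (n + H_n)`, and the harmonic bound gives `4 · 7/6 = 14/3`. -/
theorem sum_error_le {γ Q : ℝ} (hγ : 0 < γ) (hQ : 0 ≤ Q) {k T : ℕ} (hk : 1 ≤ k)
    (hT : (k : ℝ) / γ + 1 ≤ T) :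
    2 / ((T : ℝ) * (T + 1)) * ∑ t ∈ Finset.Ico 1 T, ((t : ℝ) + 1) * (2 / (γ * t) * Q) ≤
      14 / 3 * Q / k := by
  have hk' : (1 : ℝ) ≤ k := by exact_mod_cast hk
  have hT1 : (1 : ℝ) < T := by
    have : 0 < (k : ℝ) / γ := by positivity
    linarith
  obtain ⟨n, rfl⟩ : ∃ n, T = n + 1 :=
    ⟨T - 1, by have : 1 < T := by exact_mod_cast hT1
               omega⟩
  have hn : (k : ℝ) ≤ γ * n := by
    push_cast at hT
    have : (k : ℝ) / γ ≤ n := by linarith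
    rw [div_le_iff₀ hγ] at this
    linarith
  have e : ∑ t ∈ Finset.Ico 1 (n + 1), ((t : ℝ) + 1) * (2 / (γ * t) * Q) =
      2 * Q / γ * ∑ t ∈ Finset.Ico 1 (n + 1), (1 + 1 / (t : ℝ)) := by
    rw [Finset.mul_sum]
    refine Finset.sum_congr rfl fun t ht => ?_
    have : (1 : ℝ) ≤ t := by exact_mod_cast (Finset.mem_Ico.1 ht).1
    field_simp
  rw [e]
  set H := ∑ t ∈ Finset.Ico 1 (n + 1), (1 + 1 / (t : ℝ))
  have hH : 0 ≤ H := Finset.sum_nonneg fun t _ => by positivity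
  have h := mul_add_harmonic_le n
  push_cast
  have e2 : 2 / (((n : ℝ) + 1) * (n + 1 + 1)) * (2 * Q / γ * H) =
      4 * Q * H / (γ * ((n + 1) * (n + 2))) := by
    field_simp; ring
  rw [e2, div_le_div_iff₀ (by positivity) (by positivity)]
  calc 4 * Q * H * k ≤ 4 * Q * H * (γ * n) := by gcongr
    _ = 4 * Q * γ * (n * H) := by ring
    _ ≤ 4 * Q * γ * (7 / 6 * ((n + 1) * (n + 2))) := by gcongr
    _ = _ := by ring

/-- Expected descent over one run of SPG, with the error split off as a random variable. -/
theorem exists_stage_error {n : ℕ} {Ω : Type*} [MeasurableSpace Ω] (Pr : Measure Ω)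
    [IsProbabilityMeasure Pr] {A : Set (Vec n)} (hA : Convex ℝ A) {γ : ℝ} (hγ : 0 < γ) {T k : ℕ}
    (hk : 1 ≤ k) (hT : (k : ℝ) / γ + 1 ≤ T) (r : StepRule) {f : Ω → Vec n → ℝ}
    {S : Ω → Vec n → Vec n} (hS : ∀ ω, ∀ z ∈ A, IsSubgradientOn (f ω) A z (S ω z))
    {g : ℕ → Ω → Vec n} {z : ℕ → Ω → Vec n} (hz1 : ∀ ω, z 1 ω ∈ A)
    (hz : ∀ ω, ∀ t ∈ Finset.Icc 1 T, z (t + 1) ω ∈ A ∧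
      IsMinOn (fun w => inner ℝ (g t ω) w + γ / 2 * ‖w - z 1 ω‖ ^ 2
        + 1 / (2 * stepSize r γ t) * ‖w - z t ω‖ ^ 2) A (z (t + 1) ω))
    {v out : Ω → Vec n}
    (hv : ∀ ω, v ω ∈ A ∧ IsMinOn (fun w => f ω w + γ / 2 * ‖w - z 1 ω‖ ^ 2) A (v ω))
    (hout : ∀ ω, out ω =
      (∑ t ∈ Finset.Icc 1 T, (t : ℝ))⁻¹ • ∑ t ∈ Finset.Icc 1 T, (t : ℝ) • z t ω)
    (hvm : Measurable v) (hzm : ∀ t ∈ Finset.Icc 1 T, Measurable (z t))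
    {b : ℕ → Ω → Vec n} {β C M : ℝ}
    (hb : ∀ᵐ ω ∂Pr, ∀ t ∈ Finset.Ico 1 T,
      StepBound r (f ω) γ β (S ω (z t ω)) (b t ω) (z t ω) (z (t + 1) ω))
    (hmom : ∀ t ∈ Finset.Ico 1 T, SecondMomentLE Pr (fun ω => g t ω - b t ω) C)
    (hnoise : ∀ t ∈ Finset.Ico 1 T, MemLp (fun ω => g t ω - S ω (z t ω)) 2 Pr)
    (horth : ∀ t ∈ Finset.Ico 1 T, MemLp (fun ω => v ω - z t ω) 2 Pr →
      ∫ ω, inner ℝ (g t ω - S ω (z t ω)) (v ω - z t ω) ∂Pr = 0)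
    (hM : ∀ ω, f ω (z 1 ω) - f ω (v ω) ≤ M) :
    ∃ e : Ω → ℝ, Integrable e Pr ∧ ∫ ω, e ω ∂Pr ≤ 14 / 3 * (2 * C + 2 * β ^ 2) / k ∧
      ∀ᵐ ω ∂Pr, γ / 4 * (‖z 1 ω - v ω‖ ^ 2 + ‖out ω - z 1 ω‖ ^ 2) ≤
        f ω (z 1 ω) - f ω (out ω) + e ω := by
  have hk' : (1 : ℝ) ≤ k := by exact_mod_cast hk
  have hT2 : 2 ≤ T := by
    have : 0 < (k : ℝ) / γ := by positivity
    have : (1 : ℝ) < T := by linarith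
    have : 1 < T := by exact_mod_cast this
    omega
  have hzA : ∀ ω, ∀ t ∈ Finset.Icc 1 T, z t ω ∈ A := by
    intro ω t ht
    rw [Finset.mem_Icc] at ht
    rcases ht.1.eq_or_lt with rfl | h
    · exact hz1 ω
    · have := (hz ω (t - 1) (by rw [Finset.mem_Icc]; omega)).1
      rwa [Nat.sub_add_cancel ht.1] at this
  have hconv : ∀ ω, ConvexOn ℝ A (f ω) := fun ω => convexOn_of_forall_subgradient hA (hS ω)
  set q : ℕ → Ω → ℝ := fun t ω => 2 * ‖g t ω - b t ω‖ ^ 2 + 2 * β ^ 2 with hq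
  set m : ℕ → Ω → ℝ := fun t ω => inner ℝ (g t ω - S ω (z t ω)) (v ω - z t ω)
    + 2 / (γ * t) * q t ω with hm
  have hprog : ∀ᵐ ω ∂Pr, ∀ t ∈ Finset.Ico 1 T,
      (f ω (z (t + 1) ω) + γ / 2 * ‖z (t + 1) ω - z 1 ω‖ ^ 2)
        - (f ω (v ω) + γ / 2 * ‖v ω - z 1 ω‖ ^ 2) ≤
      m t ω + 1 / (2 * stepSize r γ t) * ‖z t ω - v ω‖ ^ 2
        - (γ + 1 / stepSize r γ t) / 2 * ‖z (t + 1) ω - v ω‖ ^ 2 := by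
    filter_upwards [hb] with ω hω t ht
    have ht' : t ∈ Finset.Icc 1 T := by rw [Finset.mem_Icc]; rw [Finset.mem_Ico] at ht; omega
    exact StepBound.progress hA hγ (Finset.mem_Ico.1 ht).1 (hz ω t ht').1 (hv ω).1 (hz ω t ht').2
      (hS ω _ (hzA ω t ht') _ (hv ω).1) (hω t ht)
  have hqi : ∀ t ∈ Finset.Ico 1 T, Integrable (q t) Pr := fun t ht =>
    (((hmom t ht).1.integrable_norm_pow two_ne_zero).const_mul 2).add (integrable_const _)
  -- Square integrability of the distance to `v`, by induction. At the start strong convexity bounds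
  -- `γ/2 ‖z 1 - v‖²` by `M`. Later the progress inequality bounds the next distance by integrable
  -- terms, since its left side is nonnegative by minimality of `v`.
  have hmem : ∀ t, 1 ≤ t → t ≤ T → MemLp (fun ω => v ω - z t ω) 2 Pr := by
    intro t ht
    induction t, ht using Nat.le_induction with
    | base =>
      intro _
      have hm1 : Measurable (fun ω => v ω - z 1 ω) :=
        hvm.sub (hzm 1 (by rw [Finset.mem_Icc]; omega))
      refine memLp_two_of_integrable_sq hm1.aestronglyMeasurable
        ((integrable_const (2 * M / γ)).mono' (hm1.norm.pow_const 2).aestronglyMeasurable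
          (Filter.Eventually.of_forall fun ω => ?_))
      rw [Real.norm_of_nonneg (by positivity), le_div_iff₀ hγ]
      have h1 := (hv ω).2.add_sq_le_of_strongConvexOn ((hconv ω).strongConvexOn_add_sq γ (z 1 ω))
        (hv ω).1 (hz1 ω)
      have h2 := hM ω
      simp only [sub_self, norm_zero] at h1
      rw [norm_sub_rev (z 1 ω) (v ω)] at h1
      nlinarith
    | succ t ht ih =>
      intro htT
      have h := ih (by omega)
      have htI : t ∈ Finset.Ico 1 T := by rw [Finset.mem_Ico]; omega
      have hm1 : Measurable (fun ω => v ω - z (t + 1) ω) :=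
        hvm.sub (hzm (t + 1) (by rw [Finset.mem_Icc]; omega))
      have hmi : Integrable (m t) Pr :=
        (integrable_inner_of_memLp (hnoise t htI) h).add ((hqi t htI).const_mul _)
      refine memLp_two_of_integrable_sq hm1.aestronglyMeasurable
        (((hmi.add ((h.integrable_norm_pow two_ne_zero).const_mul
          (1 / (2 * stepSize r γ t)))).const_mul (2 / γ)).mono'
          (hm1.norm.pow_const 2).aestronglyMeasurable ?_)
      filter_upwards [hprog] with ω hω
      have h1 := hω t htI
      have h2 : f ω (v ω) + γ / 2 * ‖v ω - z 1 ω‖ ^ 2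
          ≤ f ω (z (t + 1) ω) + γ / 2 * ‖z (t + 1) ω - z 1 ω‖ ^ 2 :=
        (hv ω).2 (hzA ω (t + 1) (by rw [Finset.mem_Icc]; omega))
      rw [Real.norm_of_nonneg (by positivity)]
      simp only [Pi.add_apply]
      rw [norm_sub_rev (z (t + 1) ω) (v ω), norm_sub_rev (z t ω) (v ω)] at h1
      have hη : 0 ≤ 1 / stepSize r γ t := by
        cases r <;> simp only [stepSize] <;> positivity
      have h3 : 0 ≤ 1 / stepSize r γ t * ‖v ω - z (t + 1) ω‖ ^ 2 := by positivity
      rw [div_mul_eq_mul_div, le_div_iff₀ hγ]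
      nlinarith
  have hmem' : ∀ t ∈ Finset.Ico 1 T, MemLp (fun ω => v ω - z t ω) 2 Pr := fun t ht => by
    rw [Finset.mem_Ico] at ht; exact hmem t ht.1 ht.2.le
  have hinner : ∀ t ∈ Finset.Ico 1 T,
      Integrable (fun ω => inner ℝ (g t ω - S ω (z t ω)) (v ω - z t ω)) Pr := fun t ht =>
    integrable_inner_of_memLp (hnoise t ht) (hmem' t ht)
  have hmi : ∀ t ∈ Finset.Ico 1 T, Integrable (m t) Pr := fun t ht =>
    (hinner t ht).add ((hqi t ht).const_mul _)
  have hsi : ∀ t ∈ Finset.Ico 1 T, Integrable (fun ω => ((t : ℝ) + 1) * m t ω) Pr :=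
    fun t ht => (hmi t ht).const_mul _
  refine ⟨fun ω => 2 / ((T : ℝ) * (T + 1)) * ∑ t ∈ Finset.Ico 1 T, ((t : ℝ) + 1) * m t ω,
    (integrable_finsetSum _ hsi).const_mul _, ?_, ?_⟩
  · have hC : 0 ≤ C := (integral_nonneg fun ω => by positivity).trans
      (hmom 1 (by rw [Finset.mem_Ico]; omega)).2
    refine le_trans ?_ (sum_error_le hγ (by positivity) hk hT)
    rw [integral_const_mul, integral_finsetSum _ hsi]
    gcongr with t ht
    rw [integral_const_mul]
    gcongr
    rw [hm]
    simp only
    -- The linear noise term has mean zero, leaving only the second moment part `q`.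
    rw [integral_add (hinner t ht) ((hqi t ht).const_mul _), horth t ht (hmem' t ht), zero_add,
      integral_const_mul]
    gcongr
    rw [hq]
    simp only
    rw [integral_add (((hmom t ht).1.integrable_norm_pow two_ne_zero).const_mul 2)
      (integrable_const _), integral_const_mul]
    simp only [integral_const, probReal_univ, one_smul]
    gcongr
    exact (hmom t ht).2
  · filter_upwards [hprog] with ω hω
    exact stage_descent (hconv ω) hγ hT2 r (hzA ω) (hv ω).1 (hv ω).2 hω (hout ω)

end StageError

/-! ### Measurability of SPG iterates and proximal points -/

section Measurability

/-- After expanding the squares, the objective depends on the data only through the linear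
functional `G - γ z₁ - (1/η) z` and a constant, so this single vector serves as the parameter. -/
theorem measurable_spg_step {Ω : Type*} [MeasurableSpace Ω] {n : ℕ} {A : Set (Vec n)}
    (hA : Convex ℝ A) {γ η : ℝ} (hγ : 0 < γ) (hη : 0 < η) {G z₁ z z' : Ω → Vec n}
    (hG : Measurable G) (hz₁ : Measurable z₁) (hz : Measurable z)
    (h : ∀ ω, z' ω ∈ A ∧ IsMinOn (fun w => inner ℝ (G ω) w + γ / 2 * ‖w - z₁ ω‖ ^ 2
      + 1 / (2 * η) * ‖w - z ω‖ ^ 2) A (z' ω)) : Measurable z' := by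
  have hq : Measurable (fun ω => G ω - γ • z₁ ω - (1 / η) • z ω) :=
    (hG.sub (hz₁.const_smul γ)).sub (hz.const_smul (1 / η))
  have hconv : ∀ ω, ConvexOn ℝ A (fun w => inner ℝ (G ω) w + γ / 2 * ‖w - z₁ ω‖ ^ 2
      + 1 / (2 * η) * ‖w - z ω‖ ^ 2) := by
    intro ω
    have h0 : ConvexOn ℝ A (fun w : Vec n => (inner ℝ (G ω) w : ℝ)) :=
      (innerₛₗ ℝ (G ω)).convexOn hA
    have h1 := (h0.strongConvexOn_add_sq γ (z₁ ω)).add_sq (1 / η) (z ω)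
    have e : ∀ w : Vec n, 1 / η / 2 * ‖w - z ω‖ ^ 2 = 1 / (2 * η) * ‖w - z ω‖ ^ 2 := by
      intro w
      rw [div_div, mul_comm η 2]
    simp only [e] at h1
    exact strongConvexOn_zero.1 (h1.mono (by positivity))
  refine measurable_of_isMinOn (A := A) hq (c := γ / 2) (by positivity) (fun ω => (h ω).1)
    (fun ω => (h ω).2) hconv ?_ ?_
  · intro ω w hw
    have h1 := prox_step_le hA (h ω).1 hw (h ω).2
    have h2 : 0 ≤ 1 / η * ‖w - z' ω‖ ^ 2 := by positivity
    linarith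
  · intro ω₀
    refine ⟨fun ω => ‖(G ω₀ - γ • z₁ ω₀ - (1 / η) • z ω₀) - (G ω - γ • z₁ ω - (1 / η) • z ω)‖,
      ?_, ?_⟩
    · have : Filter.Tendsto (fun p => ‖(G ω₀ - γ • z₁ ω₀ - (1 / η) • z ω₀) - p‖)
          (nhds (G ω₀ - γ • z₁ ω₀ - (1 / η) • z ω₀)) (nhds 0) := by
        have hc : Continuous (fun p => ‖(G ω₀ - γ • z₁ ω₀ - (1 / η) • z ω₀) - p‖) := by fun_prop
        simpa using hc.tendsto (G ω₀ - γ • z₁ ω₀ - (1 / η) • z ω₀)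
      exact this.comp Filter.tendsto_comap
    · intro ω w _ hw1
      have e : ∀ a p : Vec n, ‖w - a‖ ^ 2 = ‖w‖ ^ 2 - 2 * inner ℝ a w + ‖a‖ ^ 2 := by
        intro a _
        rw [norm_sub_sq_real, real_inner_comm]
      have e' : ∀ a : Vec n,
          ‖z' ω₀ - a‖ ^ 2 = ‖z' ω₀‖ ^ 2 - 2 * inner ℝ a (z' ω₀) + ‖a‖ ^ 2 := by
        intro a
        rw [norm_sub_sq_real, real_inner_comm]
      have hle : inner ℝ ((G ω₀ - γ • z₁ ω₀ - (1 / η) • z ω₀) - (G ω - γ • z₁ ω - (1 / η) • z ω))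
          (w - z' ω₀) ≤
          ‖(G ω₀ - γ • z₁ ω₀ - (1 / η) • z ω₀) - (G ω - γ • z₁ ω - (1 / η) • z ω)‖ * 1 :=
        (real_inner_le_norm _ _).trans (by gcongr)
      rw [mul_one] at hle
      refine le_trans (le_of_eq ?_) hle
      have e3 : 1 / (2 * η) = 1 / η / 2 := by rw [div_div, mul_comm η 2]
      simp only [e _ 0, e', inner_sub_left, inner_sub_right, real_inner_smul_left, e3]
      ring

theorem stepSize_pos {γ : ℝ} (hγ : 0 < γ) (r : StepRule) {t : ℕ} (ht : 1 ≤ t) :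
    0 < stepSize r γ t := by
  have : (1 : ℝ) ≤ t := by exact_mod_cast ht
  cases r <;> simp only [stepSize] <;> positivity

/-- The bound `t₀` records causality: iterate `t₀` needs only the gradients of steps before `t₀`.
Applied with a σ-algebra that omits the sample of step `t₀`, this gives freshness of that sample. -/
theorem measurable_spg_iterate {Ω : Type*} [MeasurableSpace Ω] {n : ℕ} {A : Set (Vec n)}
    (hA : Convex ℝ A) {γ : ℝ} (hγ : 0 < γ) (r : StepRule) {G : ℕ → Ω → Vec n → Vec n}
    {z : ℕ → Ω → Vec n} {T t₀ : ℕ} (hz₁ : Measurable (z 1))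
    (hG : ∀ t, 1 ≤ t → t < t₀ → ∀ w : Ω → Vec n, Measurable w →
      Measurable (fun ω => G t ω (w ω)))
    (h : ∀ ω, ∀ t ∈ Finset.Icc 1 T, z (t + 1) ω ∈ A ∧
      IsMinOn (fun w => inner ℝ (G t ω (z t ω)) w + γ / 2 * ‖w - z 1 ω‖ ^ 2
        + 1 / (2 * stepSize r γ t) * ‖w - z t ω‖ ^ 2) A (z (t + 1) ω)) :
    ∀ t, 1 ≤ t → t ≤ t₀ → t ≤ T → Measurable (z t) := by
  intro t ht
  induction t, ht using Nat.le_induction with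
  | base => exact fun _ _ => hz₁
  | succ t ht ih =>
    intro h0 hT
    have hzt := ih (by omega) (by omega)
    exact measurable_spg_step hA hγ (stepSize_pos hγ r ht) (hG t ht (by omega) _ hzt) hz₁ hzt
      fun ω => h ω t (by rw [Finset.mem_Icc]; omega)

/-- Proximal points depend measurably on their parameters. -/
theorem measurable_prox {Ω : Type*} [MeasurableSpace Ω] {n p : ℕ} {A : Set (Vec n)} {c : ℝ}
    (hc : 0 < c) {φ : Ω → Vec n → ℝ} (hφ : ∀ ω, ConvexOn ℝ A (φ ω)) {θ : Ω → Vec p}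
    {x w : Ω → Vec n} (hθ : Measurable θ) (hx : Measurable x)
    (h : ∀ ω, w ω ∈ A ∧ IsMinOn (fun z => φ ω z + c / 2 * ‖z - x ω‖ ^ 2) A (w ω))
    (hmod : ∀ ω₀, ∃ Λ : ℝ, ∀ ω, ∀ z ∈ A, ‖z - w ω₀‖ ≤ 1 →
      (φ ω₀ z - φ ω z) - (φ ω₀ (w ω₀) - φ ω (w ω₀)) ≤ Λ * ‖θ ω - θ ω₀‖) : Measurable w := by
  have hstrong := fun ω => (hφ ω).strongConvexOn_add_sq c (x ω)
  refine measurable_of_isMinOn (A := A) (hθ.prodMk hx) (c := c / 2) (by positivity)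
    (fun ω => (h ω).1) (fun ω => (h ω).2) (fun ω => strongConvexOn_zero.1 ((hstrong ω).mono hc.le))
    (fun ω z hz => (h ω).2.add_sq_le_of_strongConvexOn (hstrong ω) (h ω).1 hz) fun ω₀ => ?_
  obtain ⟨Λ, hΛ⟩ := hmod ω₀
  refine ⟨fun ω => Λ * ‖θ ω - θ ω₀‖ + c * ‖x ω - x ω₀‖, ?_, fun ω z hz hz1 => ?_⟩
  · have hcont : Continuous (fun q : Vec p × Vec n => Λ * ‖q.1 - θ ω₀‖ + c * ‖q.2 - x ω₀‖) := by
      fun_prop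
    have h0 := hcont.tendsto (θ ω₀, x ω₀)
    have e0 : Λ * ‖θ ω₀ - θ ω₀‖ + c * ‖x ω₀ - x ω₀‖ = 0 := by simp
    rw [e0] at h0
    have h1 : Filter.Tendsto (fun ω => (θ ω, x ω))
        (Filter.comap (fun ω => (θ ω, x ω)) (nhds (θ ω₀, x ω₀))) (nhds (θ ω₀, x ω₀)) :=
      Filter.tendsto_comap
    have h2 := h0.comp h1
    exact h2
  · have h1 := hΛ ω z hz hz1
    have h2 : inner ℝ (x ω - x ω₀) (z - w ω₀) ≤ ‖x ω - x ω₀‖ * 1 :=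
      (real_inner_le_norm _ _).trans (by gcongr)
    have h3 : c / 2 * (‖z - x ω₀‖ ^ 2 - ‖z - x ω‖ ^ 2 - (‖w ω₀ - x ω₀‖ ^ 2 - ‖w ω₀ - x ω‖ ^ 2))
        = c * inner ℝ (x ω - x ω₀) (z - w ω₀) := by
      simp only [norm_sub_sq_real, inner_sub_left, inner_sub_right, real_inner_comm]
      ring
    have h4 := mul_le_mul_of_nonneg_left h2 hc.le
    linarith

end Measurability

/-! ### Freshness of samples and half-samples -/

section Independence

/-- If `f` is independent of a pair with independent components, then `f` together with the first
component is independent of the second one. -/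
theorem ProbabilityTheory.IndepFun.prodMk_left_of_prodMk_right {Ω X α β : Type*}
    [MeasurableSpace Ω] {μ : Measure Ω} [IsProbabilityMeasure μ] [MeasurableSpace X]
    [MeasurableSpace α] [MeasurableSpace β] {f : Ω → X} {a : Ω → α} {b : Ω → β}
    (hf : Measurable f) (ha : Measurable a) (hb : Measurable b)
    (h : IndepFun f (fun ω => (a ω, b ω)) μ) (hab : IndepFun a b μ) :
    IndepFun (fun ω => (f ω, a ω)) b μ := by
  have hfa : IndepFun f a μ := h.comp measurable_id measurable_fst
  have hA := (indepFun_iff_map_prod_eq_prod_map_map hf.aemeasurable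
    (ha.prodMk hb).aemeasurable).1 h
  rw [(indepFun_iff_map_prod_eq_prod_map_map ha.aemeasurable hb.aemeasurable).1 hab] at hA
  rw [indepFun_iff_map_prod_eq_prod_map_map (hf.prodMk ha).aemeasurable hb.aemeasurable,
    (indepFun_iff_map_prod_eq_prod_map_map hf.aemeasurable ha.aemeasurable).1 hfa]
  have : IsProbabilityMeasure (μ.map f) := Measure.isProbabilityMeasure_map hf.aemeasurable
  have : IsProbabilityMeasure (μ.map a) := Measure.isProbabilityMeasure_map ha.aemeasurable
  have : IsProbabilityMeasure (μ.map b) := Measure.isProbabilityMeasure_map hb.aemeasurable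
  rw [← MeasurableEquiv.prodAssoc.map_measurableEquiv_injective.eq_iff, Measure.prodAssoc_prod,
    ← hA, Measure.map_map MeasurableEquiv.prodAssoc.measurable ((hf.prodMk ha).prodMk hb)]
  rfl

/-- Fresh samples: `ζ p` is independent of everything determined by the other samples. -/
theorem ProbabilityTheory.iIndepFun.indepFun_of_measurable_iSup_compl {Ω ι α S : Type*}
    [mΩ : MeasurableSpace Ω] {μ : Measure Ω} [MeasurableSpace S] [MeasurableSpace α] {ζ : ι → Ω → S}
    (hζ : ∀ i, Measurable (ζ i)) (h : iIndepFun ζ μ) (p : ι) {θ : Ω → α}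
    (hθ : Measurable[⨆ i ∈ ({p}ᶜ : Set ι), MeasurableSpace.comap (ζ i) inferInstance] θ) :
    IndepFun θ (ζ p) μ := by
  have h1 := indep_iSup_of_disjoint (m := fun i => MeasurableSpace.comap (ζ i) inferInstance)
    (fun i => (hζ i).comap_le) h (S := {p}ᶜ) (T := {p}) disjoint_compl_left
  rw [IndepFun_iff_Indep]
  refine indep_of_indep_of_le_left (indep_of_indep_of_le_right h1 ?_) hθ.comap_le
  simp

/-- Fresh half-samples: the second half of `ζ p` is independent of everything determined by the
other samples and the first half. -/
theorem ProbabilityTheory.iIndepFun.indepFun_of_measurable_sup {Ω ι α β γ S : Type*}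
    [mΩ : MeasurableSpace Ω] {μ : Measure Ω} [IsProbabilityMeasure μ] [MeasurableSpace S]
    [MeasurableSpace α] [MeasurableSpace β] [MeasurableSpace γ] {ζ : ι → Ω → S}
    (hζ : ∀ i, Measurable (ζ i)) (h : iIndepFun ζ μ) (p : ι) {a : S → β} {b : S → γ}
    (ha : Measurable a) (hb : Measurable b)
    (hab : IndepFun (fun ω => a (ζ p ω)) (fun ω => b (ζ p ω)) μ) {θ : Ω → α}
    (hθ : Measurable[(⨆ i ∈ ({p}ᶜ : Set ι), MeasurableSpace.comap (ζ i) inferInstance) ⊔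
      MeasurableSpace.comap (fun ω => a (ζ p ω)) inferInstance] θ) :
    IndepFun θ (fun ω => b (ζ p ω)) μ := by
  set 𝓜 : MeasurableSpace Ω := ⨆ i ∈ ({p}ᶜ : Set ι), MeasurableSpace.comap (ζ i) inferInstance
    with h𝓜
  have hle : 𝓜 ≤ mΩ := iSup₂_le fun i _ => (hζ i).comap_le
  -- The identity into `Ω` with the σ-algebra `𝓜` represents all other samples as one random
  -- variable, to which the statement about pairs applies.
  have hid : @Measurable Ω Ω mΩ 𝓜 id := measurable_id'' hle
  have h0 : @IndepFun Ω Ω S mΩ 𝓜 _ id (ζ p) μ :=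
    @iIndepFun.indepFun_of_measurable_iSup_compl Ω ι Ω S mΩ μ _ 𝓜 ζ hζ h p id
      (@measurable_id Ω 𝓜)
  have h1 : @IndepFun Ω Ω (β × γ) mΩ 𝓜 _ id (fun ω => (a (ζ p ω), b (ζ p ω))) μ :=
    @IndepFun.comp Ω Ω S Ω (β × γ) mΩ μ id (ζ p) 𝓜 _ 𝓜 _ id (fun s => (a s, b s)) h0
      (@measurable_id Ω 𝓜) (ha.prodMk hb)
  have h2 := @IndepFun.prodMk_left_of_prodMk_right Ω Ω β γ mΩ μ _ 𝓜 _ _ id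
    (fun ω => a (ζ p ω)) (fun ω => b (ζ p ω)) hid (ha.comp (hζ p)) (hb.comp (hζ p)) h1 hab
  rw [IndepFun_iff_Indep] at h2 ⊢
  refine indep_of_indep_of_le_left h2 (hθ.comap_le.trans ?_)
  refine sup_le ?_ ?_
  · exact fun s hs => ⟨Prod.fst ⁻¹' s, @measurable_fst Ω β 𝓜 _ s hs, rfl⟩
  · exact fun s ⟨t, ht, hs⟩ => ⟨Prod.snd ⁻¹' t, @measurable_snd Ω β 𝓜 _ t ht, hs⟩

end Independence

/-! ### Second moments, centring and products -/

section Moments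

variable {S V : Type*} [MeasurableSpace S] [NormedAddCommGroup V] {Q : Measure S}

theorem SecondMomentLE.integrable [IsProbabilityMeasure Q] {f : S → V} {c : ℝ}
    (h : SecondMomentLE Q f c) : Integrable f Q := h.1.integrable (by norm_num)

theorem SecondMomentLE.of_norm_le {W : Type*} [NormedAddCommGroup W] {f : S → V} {g : S → W}
    {c D : ℝ} (h : SecondMomentLE Q f c) (hg : AEStronglyMeasurable g Q)
    (hle : ∀ s, ‖g s‖ ≤ D * ‖f s‖) : SecondMomentLE Q g (D ^ 2 * c) := by
  have hle2 : ∀ s, ‖g s‖ ^ 2 ≤ D ^ 2 * ‖f s‖ ^ 2 := fun s => by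
    rw [← mul_pow]; gcongr; exact hle s
  have hi := (h.1.integrable_norm_pow two_ne_zero).const_mul (D ^ 2)
  have hg2 : Integrable (fun s => ‖g s‖ ^ 2) Q := hi.mono' (hg.norm.pow 2)
    (Filter.Eventually.of_forall fun s => by
      rw [Real.norm_of_nonneg (by positivity)]; exact hle2 s)
  refine ⟨memLp_two_of_integrable_sq hg hg2, ?_⟩
  calc ∫ s, ‖g s‖ ^ 2 ∂Q ≤ ∫ s, D ^ 2 * ‖f s‖ ^ 2 ∂Q := integral_mono hg2 hi hle2
    _ = D ^ 2 * ∫ s, ‖f s‖ ^ 2 ∂Q := integral_const_mul _ _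
    _ ≤ D ^ 2 * c := by gcongr; exact h.2

theorem integral_sub_const_mul_add {p q r : S → ℝ} (hp : Integrable p Q) (hq : Integrable q Q)
    (hr : Integrable r Q) (c : ℝ) :
    ∫ s, (p s - c * q s + r s) ∂Q = ∫ s, p s ∂Q - c * ∫ s, q s ∂Q + ∫ s, r s ∂Q := by
  have h1 : Integrable (fun s => p s - c * q s) Q := hp.sub (hq.const_mul c)
  rw [integral_add h1 hr, integral_sub hp (hq.const_mul c), integral_const_mul]

/-- Nonnegativity of the variance of `‖f‖`. It turns the moment bounds on oracles into bounds on the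
mean subgradients. -/
theorem SecondMomentLE.norm_integral_le [NormedSpace ℝ V] [IsProbabilityMeasure Q] {f : S → V}
    {σ : ℝ} (hσ : 0 ≤ σ) (h : SecondMomentLE Q f (σ ^ 2)) : ‖∫ s, f s ∂Q‖ ≤ σ := by
  refine (norm_integral_le_integral_norm _).trans ?_
  set a := ∫ s, ‖f s‖ ∂Q
  have hi := h.1.integrable_norm_pow two_ne_zero
  have h1 : Integrable (fun s => ‖f s‖) Q := h.integrable.norm
  have h0 : 0 ≤ ∫ s, (‖f s‖ - a) ^ 2 ∂Q := integral_nonneg fun s => sq_nonneg _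
  have e : ∫ s, (‖f s‖ - a) ^ 2 ∂Q = ∫ s, ‖f s‖ ^ 2 ∂Q - a ^ 2 := by
    have : ∀ s, (‖f s‖ - a) ^ 2 = (‖f s‖ ^ 2 - 2 * a * ‖f s‖) + a ^ 2 := fun s => by ring
    simp only [this]
    rw [integral_sub_const_mul_add hi h1 (integrable_const _)]
    simp only [integral_const, probReal_univ, one_smul]
    ring
  exact (abs_le.1 (abs_le_of_sq_le_sq (by linarith [h.2]) hσ)).2

theorem integral_sub_integral_eq_zero [NormedSpace ℝ V] [CompleteSpace V] [IsProbabilityMeasure Q]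
    {f : S → V} (h : Integrable f Q) : ∫ s, (f s - ∫ s, f s ∂Q) ∂Q = 0 := by
  rw [integral_sub h (integrable_const _), integral_const, probReal_univ, one_smul, sub_self]

variable {S' : Type*} [MeasurableSpace S'] {Q' : Measure S'}

theorem memLp_comp_fst [IsProbabilityMeasure Q'] {f : S → V} (hf : MemLp f 2 Q) :
    MemLp (fun q : S × S' => f q.1) 2 (Q.prod Q') :=
  hf.comp_measurePreserving measurePreserving_fst

theorem memLp_comp_snd [IsProbabilityMeasure Q] [SFinite Q'] {f : S' → V} (hf : MemLp f 2 Q') :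
    MemLp (fun q : S × S' => f q.2) 2 (Q.prod Q') :=
  hf.comp_measurePreserving measurePreserving_snd

theorem integral_prod_fst [NormedSpace ℝ V] [SFinite Q] [IsProbabilityMeasure Q'] (f : S → V) :
    ∫ q : S × S', f q.1 ∂(Q.prod Q') = ∫ s, f s ∂Q := by
  rw [integral_fun_fst]; simp

theorem integral_prod_snd [NormedSpace ℝ V] [IsProbabilityMeasure Q] [SFinite Q'] (f : S' → V) :
    ∫ q : S × S', f q.2 ∂(Q.prod Q') = ∫ s, f s ∂Q' := by
  rw [integral_fun_snd]; simp

variable [IsProbabilityMeasure Q]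

theorem SecondMomentLE.prod_sub [IsProbabilityMeasure Q'] {f : S → V} {g : S' → V} {a b : ℝ} (hf : SecondMomentLE Q f a)
    (hg : SecondMomentLE Q' g b) :
    SecondMomentLE (Q.prod Q') (fun q => f q.1 - g q.2) (2 * a + 2 * b) := by
  have h1 := memLp_comp_fst (Q' := Q') hf.1
  have h2 := memLp_comp_snd (Q := Q) hg.1
  have i1 := h1.integrable_norm_pow two_ne_zero
  have i2 := h2.integrable_norm_pow two_ne_zero
  have e1 : ∫ q : S × S', ‖f q.1‖ ^ 2 ∂(Q.prod Q') = ∫ s, ‖f s‖ ^ 2 ∂Q :=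
    integral_prod_fst (fun s => ‖f s‖ ^ 2)
  have e2 : ∫ q : S × S', ‖g q.2‖ ^ 2 ∂(Q.prod Q') = ∫ s, ‖g s‖ ^ 2 ∂Q' :=
    integral_prod_snd (fun s => ‖g s‖ ^ 2)
  refine ⟨h1.sub h2, ?_⟩
  calc ∫ q : S × S', ‖f q.1 - g q.2‖ ^ 2 ∂(Q.prod Q')
      ≤ ∫ q : S × S', (2 * ‖f q.1‖ ^ 2 + 2 * ‖g q.2‖ ^ 2) ∂(Q.prod Q') := by
        refine integral_mono ((h1.sub h2).integrable_norm_pow two_ne_zero)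
          ((i1.const_mul 2).add (i2.const_mul 2)) fun q => ?_
        have := norm_sub_le (f q.1) (g q.2)
        have h3 : ‖f q.1 - g q.2‖ ^ 2 ≤ (‖f q.1‖ + ‖g q.2‖) ^ 2 := by gcongr
        simp only
        nlinarith [sq_nonneg (‖f q.1‖ - ‖g q.2‖)]
    _ = 2 * ∫ s, ‖f s‖ ^ 2 ∂Q + 2 * ∫ s, ‖g s‖ ^ 2 ∂Q' := by
        rw [integral_add (i1.const_mul 2) (i2.const_mul 2), integral_const_mul,
          integral_const_mul, e1,
          e2]
    _ ≤ _ := by linarith [hf.2, hg.2]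

variable [InnerProductSpace ℝ V]

theorem SecondMomentLE.sub_integral [CompleteSpace V] {f : S → V} {c : ℝ}
    (h : SecondMomentLE Q f c) : SecondMomentLE Q (fun s => f s - ∫ s, f s ∂Q) c := by
  set a := ∫ s, f s ∂Q with ha
  refine ⟨h.1.sub (memLp_const a), ?_⟩
  have hi := h.1.integrable_norm_pow two_ne_zero
  have h1 : Integrable (fun s => (inner ℝ a (f s) : ℝ)) Q := h.integrable.const_inner a
  have e : ∀ s, ‖f s - a‖ ^ 2 = (‖f s‖ ^ 2 - 2 * inner ℝ a (f s)) + ‖a‖ ^ 2 := fun s => by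
    rw [norm_sub_sq_real, real_inner_comm]
  simp only [e]
  rw [integral_sub_const_mul_add hi h1 (integrable_const _), integral_inner h.integrable, ← ha,
    real_inner_self_eq_norm_sq]
  simp only [integral_const, probReal_univ, one_smul]
  linarith [h.2, sq_nonneg ‖a‖]

variable [IsProbabilityMeasure Q']

/-- Centring one of two independent terms kills the cross term and avoids the factor `2` of
`SecondMomentLE.prod_sub`. -/
theorem SecondMomentLE.prod_sub_of_integral_eq_zero [CompleteSpace V] {f : S → V} {g : S' → V}
    {a b : ℝ} (hf : SecondMomentLE Q f a) (hg : SecondMomentLE Q' g b)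
    (h0 : ∫ s, g s ∂Q' = 0) :
    SecondMomentLE (Q.prod Q') (fun q => f q.1 - g q.2) (a + b) := by
  have h1 := memLp_comp_fst (Q' := Q') hf.1
  have h2 := memLp_comp_snd (Q := Q) hg.1
  have i1 := h1.integrable_norm_pow two_ne_zero
  have i2 := h2.integrable_norm_pow two_ne_zero
  have i3 := integrable_inner_of_memLp h1 h2
  have e1 : ∫ q : S × S', ‖f q.1‖ ^ 2 ∂(Q.prod Q') = ∫ s, ‖f s‖ ^ 2 ∂Q :=
    integral_prod_fst (fun s => ‖f s‖ ^ 2)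
  have e2 : ∫ q : S × S', ‖g q.2‖ ^ 2 ∂(Q.prod Q') = ∫ s, ‖g s‖ ^ 2 ∂Q' :=
    integral_prod_snd (fun s => ‖g s‖ ^ 2)
  refine ⟨h1.sub h2, ?_⟩
  have hz : ∫ q : S × S', inner ℝ (f q.1) (g q.2) ∂(Q.prod Q') = 0 := by
    rw [integral_prod _ i3]
    simp [integral_inner hg.integrable, h0]
  simp only [norm_sub_sq_real]
  rw [integral_sub_const_mul_add i1 i3 i2, hz, e1,
    e2]
  linarith [hf.2, hg.2]

theorem integral_prod_sub_eq_zero {f : S → V} {g : S' → V} (hf : MemLp f 2 Q) (hg : MemLp g 2 Q')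
    (h0 : ∫ s, f s ∂Q = 0) (h0' : ∫ s, g s ∂Q' = 0) :
    ∫ q : S × S', (f q.1 - g q.2) ∂(Q.prod Q') = 0 := by
  rw [integral_sub ((memLp_comp_fst hf).integrable (by norm_num))
    ((memLp_comp_snd hg).integrable (by norm_num)), integral_prod_fst, integral_prod_snd, h0, h0',
    sub_zero]

end Moments

/-! ### Stochastic gradients of the two subproblems -/

noncomputable section

set_option linter.unusedSectionVars false

open ContinuousLinearMap (adjoint)

theorem continuous_adjoint_apply {d m : ℕ} :
    Continuous (fun q : (Vec d →L[ℝ] Vec m) × Vec m => adjoint q.1 q.2) :=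
  isBoundedBilinearMap_apply.continuous.comp
    (((adjoint (𝕜 := ℝ) (E := Vec d) (F := Vec m)).continuous.comp continuous_fst).prodMk
      continuous_snd)

set_option maxHeartbeats 1000000 in
theorem measurable_uncurry_adjoint {d m : ℕ} :
    Measurable (fun q : (Vec d →L[ℝ] Vec m) × Vec m => adjoint q.1 q.2) := by
  have h := continuous_adjoint_apply (d := d) (m := m)
  exact h.measurable

theorem measurable_adjoint_apply {d m : ℕ} {Ω : Type*} [MeasurableSpace Ω]
    {L : Ω → Vec d →L[ℝ] Vec m} {y : Ω → Vec m} (hL : Measurable L) (hy : Measurable y) :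
    Measurable (fun ω => adjoint (L ω) (y ω)) := by
  have h := hL.prodMk hy
  exact Measurable.comp (f := fun ω => (L ω, y ω))
    (g := fun q : (Vec d →L[ℝ] Vec m) × Vec m => adjoint q.1 q.2) measurable_uncurry_adjoint h

theorem integral_adjoint_apply {d m : ℕ} {S : Type*} [MeasurableSpace S] {Q : Measure S}
    {L : S → Vec d →L[ℝ] Vec m} (h : Integrable L Q) (y : Vec m) :
    ∫ s, adjoint (L s) y ∂Q = adjoint (∫ s, L s ∂Q) y := by
  set T : (Vec d →L[ℝ] Vec m) →L[ℝ] Vec d := LinearMap.toContinuousLinearMap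
    { toFun := fun L => adjoint L y
      map_add' := fun a b => by rw [map_add, add_apply]
      map_smul' := fun a b => by rw [map_smulₛₗ]; simp }
  exact T.integral_comp_comm h

theorem norm_adjoint_apply_le {d m : ℕ} {D : ℝ} (L : Vec d →L[ℝ] Vec m) {y : Vec m}
    (hy : ‖y‖ ≤ D) : ‖adjoint L y‖ ≤ D * ‖L‖ := by
  calc ‖adjoint L y‖ ≤ ‖adjoint L‖ * ‖y‖ := (adjoint L).le_opNorm y
    _ = ‖y‖ * ‖L‖ := by rw [LinearIsometryEquiv.norm_map, mul_comm]
    _ ≤ D * ‖L‖ := by gcongr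

theorem integrable_of_memLp_sub_const {S V : Type*} [MeasurableSpace S] [NormedAddCommGroup V]
    {Q : Measure S} [IsProbabilityMeasure Q] {f : S → V} {a : V}
    (h : MemLp (fun s => f s - a) 2 Q) : Integrable f Q := by
  refine ((h.integrable (by norm_num)).add (integrable_const a)).congr
    (Filter.Eventually.of_forall fun s => ?_)
  simp

namespace InfProjProblem.IsAdmissible

variable {d m : ℕ} {P : InfProjProblem d m} {c : ProblemCase} {M : ℝ}

theorem convex_Y (hP : P.IsAdmissible c M) : Convex ℝ P.Y := by
  obtain ⟨ϱ, p, _, _, h⟩ := hP.uniformlyConvex_h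
  exact h.1.1

/-- The components of `ℓ` lie above their linearizations. -/
theorem add_J_le (hP : P.IsAdmissible c M) {z w : Vec d} (hz : z ∈ P.X) (hw : w ∈ P.X)
    (i : Fin m) : (P.ℓ z + P.J z (w - z)) i ≤ P.ℓ w i := by
  have h1 : HasFDerivWithinAt (fun x => P.ℓ x i)
      ((EuclideanSpace.proj i : Vec m →L[ℝ] ℝ).comp (P.J z)) P.X z :=
    (EuclideanSpace.proj i : Vec m →L[ℝ] ℝ).hasFDerivAt.comp_hasFDerivWithinAt z
      (hP.hasFDeriv_ℓ z hz)
  exact (hP.convexOn_ℓ i).add_fderivWithin_le hz hw h1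

theorem inner_le_of_nonneg {y u w : Vec m} (hy : ∀ i, 0 ≤ y i) (h : ∀ i, u i ≤ w i) :
    inner ℝ y u ≤ inner ℝ y w := by
  simp only [PiLp.inner_apply, RCLike.inner_apply, conj_trivial]
  exact Finset.sum_le_sum fun i _ => mul_le_mul_of_nonneg_right (h i) (hy i)

theorem inner_le_of_nonpos {y u w : Vec m} (hy : ∀ i, y i ≤ 0) (h : ∀ i, u i ≤ w i) :
    inner ℝ y w ≤ inner ℝ y u := by
  simp only [PiLp.inner_apply, RCLike.inner_apply, conj_trivial]
  exact Finset.sum_le_sum fun i _ => mul_le_mul_of_nonpos_right (h i) (hy i)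

/-- Progress on the `x`-subproblem is progress on `f`. -/
theorem fx_sub_le (hP : P.IsAdmissible c M) {x w : Vec d} {y : Vec m} (hx : x ∈ P.X)
    (hy : y ∈ P.Y) (hw : w ∈ P.X) :
    P.fx c x y x - P.fx c x y w ≤ P.f x y - P.f w y := by
  cases c with
  | dc =>
    -- The linearization at `x` lies below `ℓ` componentwise and `y ≥ 0`, so `f_x^k` dominates `g -
    -- ⟨y, ℓ⟩`, with equality at `x`.
    have h := inner_le_of_nonneg (hP.sign_Y y hy) (fun i => hP.add_J_le hx hw i)
    simp only [fx, f, sub_self, map_zero, add_zero]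
    linarith
  | biconvex => simp only [fx, f]; linarith

theorem fy_sub_eq (x : Vec d) (y w : Vec m) : P.fy x y - P.fy x w = P.f x y - P.f x w := by
  simp only [fy, f]; ring

end InfProjProblem.IsAdmissible

namespace Oracles

variable {d m : ℕ} {Sg Sl Sh : Type*} [MeasurableSpace Sg] [MeasurableSpace Sl]
  [MeasurableSpace Sh]

/-- The mean of the stochastic Jacobian of `ℓ`. -/
def JMean (O : Oracles d m Sg Sl Sh) (Pl : Measure Sl) (x : Vec d) : Vec d →L[ℝ] Vec m :=
  ∫ s, O.JO x s ∂Pl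

/-- The mean of the stochastic value of `ℓ`. -/
def lMean (O : Oracles d m Sg Sl Sh) (Pl : Measure Sl) (x : Vec d) : Vec m :=
  ∫ s, O.lO x s ∂Pl

/-- The mean of the stochastic subgradient of `h`. -/
def hMean (O : Oracles d m Sg Sl Sh) (Ph : Measure Sh) (y : Vec m) : Vec m :=
  ∫ s, O.hO y s ∂Ph

/-- The mean of the stochastic gradient of `f_x^k` at `z`. -/
def xMean (O : Oracles d m Sg Sl Sh) (Pg : Measure Sg) (Pl : Measure Sl) (c : ProblemCase)
    (x : Vec d) (y : Vec m) (z : Vec d) : Vec d :=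
  match c with
  | .dc => O.gMean Pg z - adjoint (O.JMean Pl x) y
  | .biconvex => O.gMean Pg z - adjoint (O.JMean Pl z) y

/-- The part of the gradient of `f_x^k` that is treated exactly in a step of SPG. -/
def xLin (O : Oracles d m Sg Sl Sh) (Pg : Measure Sg) (Pl : Measure Sl) (c : ProblemCase)
    (r : StepRule) (x : Vec d) (y : Vec m) (z : Vec d) : Vec d :=
  match r, c with
  | .nonsmooth, .dc => - adjoint (O.JMean Pl x) y
  | .nonsmooth, .biconvex => 0
  | .smooth, _ => O.xMean Pg Pl c x y z

/-- The Lipschitz constant of the part of `f_x^k` that is not treated exactly. -/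
def xLip (σ D : ℝ) (c : ProblemCase) (r : StepRule) : ℝ :=
  match r, c with
  | .nonsmooth, .dc => σ
  | .nonsmooth, .biconvex => σ + D * σ
  | .smooth, _ => 0

theorem xLip_sq_le (σ D : ℝ) (c : ProblemCase) (r : StepRule) :
    xLip σ D c r ^ 2 ≤ 2 * σ ^ 2 + 2 * D ^ 2 * σ ^ 2 := by
  cases r <;> cases c <;> simp only [xLip] <;>
    nlinarith [sq_nonneg (σ - D * σ), sq_nonneg σ, sq_nonneg (D * σ)]

variable {O : Oracles d m Sg Sl Sh} {P : InfProjProblem d m} {c : ProblemCase} {M : ℝ}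
  {Pg : Measure Sg} {Pl : Measure Sl} {Ph : Measure Sh}
  [IsProbabilityMeasure Pg] [IsProbabilityMeasure Pl] [IsProbabilityMeasure Ph] {σ D γ : ℝ}
  {r : StepRule}

namespace IsAdmissible

theorem measurable_gMean (hO : O.IsAdmissible P Pg Pl Ph σ) : Measurable (O.gMean Pg) :=
  (hO.measurable_gO.stronglyMeasurable.integral_prod_right (ν := Pg)).measurable

theorem measurable_JMean (hO : O.IsAdmissible P Pg Pl Ph σ) : Measurable (O.JMean Pl) :=
  (hO.measurable_JO.stronglyMeasurable.integral_prod_right (ν := Pl)).measurable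

theorem measurable_lMean (hO : O.IsAdmissible P Pg Pl Ph σ) : Measurable (O.lMean Pl) :=
  (hO.measurable_lO.stronglyMeasurable.integral_prod_right (ν := Pl)).measurable

theorem measurable_hMean (hO : O.IsAdmissible P Pg Pl Ph σ) : Measurable (O.hMean Ph) :=
  (hO.measurable_hO.stronglyMeasurable.integral_prod_right (ν := Ph)).measurable

variable {Ω : Type*} [MeasurableSpace Ω] {x z : Ω → Vec d} {y w : Ω → Vec m}

theorem measurable_xGrad (hO : O.IsAdmissible P Pg Pl Ph σ) (c : ProblemCase)
    {ξg : Ω → Sg} {ξl : Ω → Sl} (hx : Measurable x) (hy : Measurable y) (hg : Measurable ξg)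
    (hl : Measurable ξl) (hz : Measurable z) :
    Measurable (fun ω => O.xGrad c (x ω) (y ω) (ξg ω) (ξl ω) (z ω)) := by
  have h1 : Measurable (fun ω => O.gO (z ω) (ξg ω)) := hO.measurable_gO.comp (hz.prodMk hg)
  cases c with
  | dc => exact h1.sub (measurable_adjoint_apply (hO.measurable_JO.comp (hx.prodMk hl)) hy)
  | biconvex => exact h1.sub (measurable_adjoint_apply (hO.measurable_JO.comp (hz.prodMk hl)) hy)

theorem measurable_xMean (hO : O.IsAdmissible P Pg Pl Ph σ) (c : ProblemCase)
    (hx : Measurable x) (hy : Measurable y) (hz : Measurable z) :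
    Measurable (fun ω => O.xMean Pg Pl c (x ω) (y ω) (z ω)) := by
  have h1 := hO.measurable_gMean.comp hz
  cases c with
  | dc => exact h1.sub (measurable_adjoint_apply (hO.measurable_JMean.comp hx) hy)
  | biconvex => exact h1.sub (measurable_adjoint_apply (hO.measurable_JMean.comp hz) hy)

theorem measurable_xLin (hO : O.IsAdmissible P Pg Pl Ph σ) (c : ProblemCase) (r : StepRule)
    (hx : Measurable x) (hy : Measurable y) (hz : Measurable z) :
    Measurable (fun ω => O.xLin Pg Pl c r (x ω) (y ω) (z ω)) := by
  cases r with
  | smooth => exact hO.measurable_xMean c hx hy hz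
  | nonsmooth =>
    cases c with
    | dc => exact (measurable_adjoint_apply (hO.measurable_JMean.comp hx) hy).neg
    | biconvex => exact measurable_const

theorem measurable_yGrad (hO : O.IsAdmissible P Pg Pl Ph σ) {ξh : Ω → Sh} {ξl : Ω → Sl}
    (hx : Measurable x) (hh : Measurable ξh) (hl : Measurable ξl) (hw : Measurable w) :
    Measurable (fun ω => O.yGrad (x ω) (ξh ω) (ξl ω) (w ω)) :=
  (hO.measurable_hO.comp (hw.prodMk hh)).sub (hO.measurable_lO.comp (hx.prodMk hl))

variable {x z z' : Vec d} {y : Vec m}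

theorem JMean_eq (hO : O.IsAdmissible P Pg Pl Ph σ) (hx : x ∈ P.X) : O.JMean Pl x = P.J x :=
  hO.mean_JO x hx

theorem lMean_eq (hO : O.IsAdmissible P Pg Pl Ph σ) (hx : x ∈ P.X) : O.lMean Pl x = P.ℓ x :=
  hO.mean_lO x hx

/-- `xMean` is a subgradient of `f_x^k`. -/
theorem isSubgradientOn_xMean (hO : O.IsAdmissible P Pg Pl Ph σ) (hP : P.IsAdmissible c M)
    (hx : x ∈ P.X) (hy : y ∈ P.Y) (hz : z ∈ P.X) :
    IsSubgradientOn (P.fx c x y) P.X z (O.xMean Pg Pl c x y z) := by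
  intro w hw
  have h1 := hO.subgradient_g z hz w hw
  cases c with
  | dc =>
    simp only [InfProjProblem.fx, xMean, inner_sub_left, ContinuousLinearMap.adjoint_inner_left,
      hO.JMean_eq hx, inner_add_right]
    have e : P.J x (w - x) = P.J x (z - x) + P.J x (w - z) := by
      rw [← map_add]; congr 1; abel
    rw [e, inner_add_right]
    linarith
  | biconvex =>
    have h2 := InfProjProblem.IsAdmissible.inner_le_of_nonpos (hP.sign_Y y hy)
      (fun i => hP.add_J_le hz hw i)
    rw [inner_add_right] at h2
    simp only [InfProjProblem.fx, xMean, inner_sub_left, ContinuousLinearMap.adjoint_inner_left,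
      hO.JMean_eq hz]
    linarith

/-- A value of the Bochner integral in `mean_JO` does not give integrability; the noise condition
does. It is needed to exchange mean and adjoint. -/
theorem integrable_JO (hr : O.XCondition P Pg Pl c r σ D γ) (hx : x ∈ P.X) :
    Integrable (O.JO x) Pl := by
  have h1 : O.VarianceJ P Pl σ → Integrable (O.JO x) Pl := fun h =>
    integrable_of_memLp_sub_const (h x hx).1
  have h2 : O.SecondMomentJ P Pl σ → Integrable (O.JO x) Pl := fun h => (h x hx).integrable
  cases c <;> cases r <;> simp only [XCondition] at hr
  · exact hr.2.elim h1 h2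
  · obtain ⟨L, -, -, h, -⟩ := hr
    exact h.elim h1 h2
  · exact h2 hr.2
  · obtain ⟨L, L', -, -, -, -, h, -⟩ := hr
    exact h1 h

theorem integral_adjoint (hr : O.XCondition P Pg Pl c r σ D γ) (hx : x ∈ P.X) (y : Vec m) :
    ∫ s, adjoint (O.JO x s) y ∂Pl = adjoint (O.JMean Pl x) y :=
  integral_adjoint_apply (integrable_JO hr hx) y

theorem aestronglyMeasurable_adjoint (hO : O.IsAdmissible P Pg Pl Ph σ) (x : Vec d) (y : Vec m) :
    AEStronglyMeasurable (fun s => adjoint (O.JO x s) y) Pl :=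
  (measurable_adjoint_apply (hO.measurable_JO.comp measurable_prodMk_left)
    measurable_const).aestronglyMeasurable

theorem secondMomentLE_adjoint (hO : O.IsAdmissible P Pg Pl Ph σ) (h : O.SecondMomentJ P Pl σ)
    (hx : x ∈ P.X) (hy : ‖y‖ ≤ D) :
    SecondMomentLE Pl (fun s => adjoint (O.JO x s) y) (D ^ 2 * σ ^ 2) :=
  (h x hx).of_norm_le (hO.aestronglyMeasurable_adjoint x y) fun _ => norm_adjoint_apply_le _ hy

theorem secondMomentLE_adjoint_sub (hO : O.IsAdmissible P Pg Pl Ph σ)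
    (hr : O.XCondition P Pg Pl c r σ D γ) (hx : x ∈ P.X) (hy : ‖y‖ ≤ D) :
    SecondMomentLE Pl (fun s => adjoint (O.JO x s) y - adjoint (O.JMean Pl x) y)
      (D ^ 2 * σ ^ 2) := by
  have h1 : O.VarianceJ P Pl σ → SecondMomentLE Pl
      (fun s => adjoint (O.JO x s) y - adjoint (O.JMean Pl x) y) (D ^ 2 * σ ^ 2) := fun h => by
    refine (h x hx).of_norm_le ((hO.aestronglyMeasurable_adjoint x y).sub
      aestronglyMeasurable_const) fun s => ?_
    rw [hO.JMean_eq hx, ← sub_apply, ← map_sub]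
    exact norm_adjoint_apply_le _ hy
  have h2 : O.SecondMomentJ P Pl σ → SecondMomentLE Pl
      (fun s => adjoint (O.JO x s) y - adjoint (O.JMean Pl x) y) (D ^ 2 * σ ^ 2) := fun h => by
    rw [← integral_adjoint hr hx]
    exact (hO.secondMomentLE_adjoint h hx hy).sub_integral
  cases c <;> cases r <;> simp only [XCondition] at hr
  · exact hr.2.elim h1 h2
  · obtain ⟨L, -, -, h, -⟩ := hr
    exact h.elim h1 h2
  · exact h2 hr.2
  · obtain ⟨L, L', -, -, -, -, h, -⟩ := hr
    exact h1 h

theorem secondMomentLE_gO_sub (hr : O.XCondition P Pg Pl c r σ D γ) (hz : z ∈ P.X) :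
    SecondMomentLE Pg (fun s => O.gO z s - O.gMean Pg z) (σ ^ 2) := by
  have h1 : O.SecondMomentG P Pg σ →
      SecondMomentLE Pg (fun s => O.gO z s - O.gMean Pg z) (σ ^ 2) := fun h =>
    (h z hz).sub_integral
  cases c <;> cases r <;> simp only [XCondition] at hr
  · exact h1 hr.1
  · obtain ⟨L, -, h, -⟩ := hr
    exact h.2.2 z hz
  · exact h1 hr.1
  · obtain ⟨L, L', -, -, h, -⟩ := hr
    exact h.2.2 z hz

/-- The noise of the stochastic gradients of `f_x^k` has bounded second moment. -/
theorem secondMomentLE_xNoise (hO : O.IsAdmissible P Pg Pl Ph σ)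
    (hr : O.XCondition P Pg Pl c r σ D γ) (hx : x ∈ P.X) (hy : ‖y‖ ≤ D) (hz : z ∈ P.X) :
    SecondMomentLE (Pg.prod Pl) (fun ξ => O.xGrad c x y ξ.1 ξ.2 z - O.xMean Pg Pl c x y z)
      (2 * σ ^ 2 + 2 * D ^ 2 * σ ^ 2) := by
  rw [mul_assoc 2 (D ^ 2)]
  cases c with
  | dc =>
    convert (secondMomentLE_gO_sub hr hz).prod_sub (hO.secondMomentLE_adjoint_sub hr hx hy) using 2
      with ξ
    simp only [xGrad, xMean]; abel
  | biconvex =>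
    convert (secondMomentLE_gO_sub hr hz).prod_sub (hO.secondMomentLE_adjoint_sub hr hz hy) using 2
      with ξ
    simp only [xGrad, xMean]; abel

theorem integral_xNoise (hO : O.IsAdmissible P Pg Pl Ph σ)
    (hr : O.XCondition P Pg Pl c r σ D γ) (hx : x ∈ P.X) (hy : ‖y‖ ≤ D) (hz : z ∈ P.X) :
    ∫ ξ, (O.xGrad c x y ξ.1 ξ.2 z - O.xMean Pg Pl c x y z) ∂(Pg.prod Pl) = 0 := by
  have hg := (secondMomentLE_gO_sub hr hz).1
  have hg0 : ∫ s, (O.gO z s - O.gMean Pg z) ∂Pg = 0 :=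
    integral_sub_integral_eq_zero (integrable_of_memLp_sub_const hg)
  have key : ∀ w ∈ P.X, ∫ ξ : Sg × Sl, ((O.gO z ξ.1 - O.gMean Pg z)
      - (adjoint (O.JO w ξ.2) y - adjoint (O.JMean Pl w) y)) ∂(Pg.prod Pl) = 0 := by
    intro w hw
    have hJ := (hO.secondMomentLE_adjoint_sub hr hw hy).1
    refine integral_prod_sub_eq_zero hg hJ hg0 ?_
    rw [← integral_adjoint hr hw]
    exact integral_sub_integral_eq_zero (integrable_of_memLp_sub_const hJ)
  cases c with
  | dc =>
    rw [← key x hx]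
    congr 1; ext1 ξ
    simp only [xGrad, xMean]; abel
  | biconvex =>
    rw [← key z hz]
    congr 1; ext1 ξ
    simp only [xGrad, xMean]; abel

/-- Subtracting the exact linear part is what lets a variance bound on `∇ℓ` suffice in the DC case:
the size of `∇ℓ(x_k)` never enters. In the bi-convex non-smooth case nothing is subtracted and the
full second moment is used. -/
theorem secondMomentLE_xGrad_sub_xLin (hO : O.IsAdmissible P Pg Pl Ph σ)
    (hr : O.XCondition P Pg Pl c r σ D γ) (hx : x ∈ P.X) (hy : ‖y‖ ≤ D) (hz : z ∈ P.X) :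
    SecondMomentLE (Pg.prod Pl) (fun ξ => O.xGrad c x y ξ.1 ξ.2 z - O.xLin Pg Pl c r x y z)
      (2 * σ ^ 2 + 2 * D ^ 2 * σ ^ 2) := by
  cases r with
  | smooth => exact hO.secondMomentLE_xNoise hr hx hy hz
  | nonsmooth =>
    rw [mul_assoc 2 (D ^ 2)]
    cases c with
    | dc =>
      convert (hr.1 z hz).prod_sub (hO.secondMomentLE_adjoint_sub hr hx hy) using 2 with ξ
      simp only [xGrad, xLin]; abel
    | biconvex =>
      convert (hr.1 z hz).prod_sub (hO.secondMomentLE_adjoint hr.2 hz hy) using 2 with ξ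
      simp only [xGrad, xLin, sub_zero]

/-- The regularity of `f_x^k` used in a step of SPG. -/
theorem stepBound_x (hO : O.IsAdmissible P Pg Pl Ph σ) (hP : P.IsAdmissible c M) (hσ : 0 ≤ σ)
    (hD : 0 ≤ D) (hr : O.XCondition P Pg Pl c r σ D γ) (hx : x ∈ P.X) (hyY : y ∈ P.Y)
    (hy : ‖y‖ ≤ D) (hz : z ∈ P.X) (hz' : z' ∈ P.X) :
    StepBound r (P.fx c x y) γ (xLip σ D c r) (O.xMean Pg Pl c x y z) (O.xLin Pg Pl c r x y z)
      z z' := by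
  cases r with
  | nonsmooth =>
    -- The subgradient is taken at the new point `z'`, which bounds `f z' - f z` from above. Its
    -- mean is bounded by the second moment on all of `X`.
    have hs := hO.isSubgradientOn_xMean hP hx hyY hz' z hz
    have hg : O.SecondMomentG P Pg σ → ‖O.gMean Pg z'‖ ≤ σ := fun h =>
      (h z' hz').norm_integral_le hσ
    simp only [StepBound]
    cases c with
    | dc =>
      have h1 : inner ℝ (O.gMean Pg z') (z' - z) ≤ σ * ‖z' - z‖ :=
        (real_inner_le_norm _ _).trans (by gcongr; exact hg hr.1)
      simp only [xMean, xLin, xLip, inner_sub_left, inner_sub_right, inner_neg_left] at *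
      linarith
    | biconvex =>
      have h2 : ‖O.JMean Pl z'‖ ≤ σ := (hr.2 z' hz').norm_integral_le hσ
      have h3 : ‖O.xMean Pg Pl .biconvex x y z'‖ ≤ σ + D * σ := by
        refine (norm_sub_le _ _).trans (add_le_add (hg hr.1) ?_)
        exact (norm_adjoint_apply_le _ hy).trans (by gcongr)
      have h1 : inner ℝ (O.xMean Pg Pl .biconvex x y z') (z' - z) ≤ (σ + D * σ) * ‖z' - z‖ :=
        (real_inner_le_norm _ _).trans (by gcongr)
      simp only [xLin, xLip, inner_zero_left, inner_sub_right] at *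
      linarith
  | smooth =>
    refine ⟨rfl, ?_⟩
    have key : ∀ Lc : ℝ, 3 * Lc ≤ γ →
        (∀ p ∈ P.X, HasFDerivWithinAt (P.fx c x y) (innerSL ℝ (O.xMean Pg Pl c x y p)) P.X p) →
        (∀ p ∈ P.X, ‖O.xMean Pg Pl c x y p - O.xMean Pg Pl c x y z‖ ≤ Lc * ‖p - z‖) →
        P.fx c x y z' - P.fx c x y z - inner ℝ (O.xLin Pg Pl c .smooth x y z) (z' - z) ≤
          γ / 6 * ‖z' - z‖ ^ 2 := by
      intro Lc hLc hd hL
      have h := sub_le_of_lipschitz_fderivWithin hP.convex_X hd (L := Lc) hz hz' fun p hp => by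
        rw [← map_sub, innerSL_apply_apply]
        exact (real_inner_le_norm _ _).trans (by gcongr; exact hL p hp)
      rw [innerSL_apply_apply] at h
      have h2 : Lc / 2 * ‖z' - z‖ ^ 2 ≤ γ / 6 * ‖z' - z‖ ^ 2 :=
        mul_le_mul_of_nonneg_right (by linarith) (by positivity)
      exact h.trans h2
    cases c with
    | dc =>
      obtain ⟨L, hL0, ⟨hgrad, hlip, -⟩, -, hγ⟩ := hr
      refine key L hγ (fun p hp => ?_) fun p hp => ?_
      · have h1 := (hgrad p hp).hasFDerivWithinAt
        have h2 : HasFDerivWithinAt (fun w => inner ℝ y (P.ℓ x + P.J x (w - x)))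
            ((innerSL ℝ y).comp (P.J x)) P.X p := by
          have h3 : HasFDerivWithinAt (fun w => P.ℓ x + P.J x (w - x)) (P.J x) P.X p := by
            have := ((P.J x).hasFDerivWithinAt (s := P.X) (x := p)).const_add
              (P.ℓ x - P.J x x)
            refine this.congr (fun w _ => ?_) ?_ <;> simp only [map_sub] <;> abel
          exact (innerSL ℝ y).hasFDerivAt.comp_hasFDerivWithinAt p h3
        refine (h1.sub h2).congr_fderiv ?_
        ext w
        simp [xMean, ContinuousLinearMap.adjoint_inner_left, hO.JMean_eq hx]
      · simp only [xMean, sub_sub_sub_cancel_right]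
        exact hlip p hp z hz
    | biconvex =>
      obtain ⟨L, Lℓ, hL0, hLℓ, ⟨hgrad, hlip, -⟩, hJlip, -, hγ⟩ := hr
      refine key (L + D * Lℓ) hγ (fun p hp => ?_) fun p hp => ?_
      · have h1 := (hgrad p hp).hasFDerivWithinAt
        have h2 : HasFDerivWithinAt (fun w => inner ℝ y (P.ℓ w))
            ((innerSL ℝ y).comp (P.J p)) P.X p :=
          (innerSL ℝ y).hasFDerivAt.comp_hasFDerivWithinAt p (hP.hasFDeriv_ℓ p hp)
        refine (h1.sub h2).congr_fderiv ?_
        ext w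
        simp [xMean, ContinuousLinearMap.adjoint_inner_left, hO.JMean_eq hp]
      · have e : O.xMean Pg Pl .biconvex x y p - O.xMean Pg Pl .biconvex x y z =
            (O.gMean Pg p - O.gMean Pg z) - adjoint (P.J p - P.J z) y := by
          simp only [xMean, hO.JMean_eq hp, hO.JMean_eq hz, map_sub, sub_apply]
          abel
        rw [e]
        refine (norm_sub_le _ _).trans ?_
        have h1 := hlip p hp z hz
        have h2 : ‖adjoint (P.J p - P.J z) y‖ ≤ D * (Lℓ * ‖p - z‖) :=
          (norm_adjoint_apply_le _ hy).trans (by gcongr; exact hJlip p hp z hz)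
        linarith

variable {w w' : Vec m}

theorem isSubgradientOn_yMean (hO : O.IsAdmissible P Pg Pl Ph σ) (hx : x ∈ P.X) (hw : w ∈ P.Y) :
    IsSubgradientOn (P.fy x) P.Y w (O.hMean Ph w - O.lMean Pl x) := by
  intro u hu
  have h := hO.subgradient_h w hw u hu
  change P.h w + inner ℝ (O.hMean Ph w) (u - w) ≤ P.h u at h
  simp only [InfProjProblem.fy, inner_sub_left, inner_sub_right, hO.lMean_eq hx] at *
  rw [real_inner_comm (P.ℓ x) w, real_inner_comm (P.ℓ x) u] at *
  linarith

theorem secondMomentLE_lO_sub (hO : O.IsAdmissible P Pg Pl Ph σ) (hx : x ∈ P.X) :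
    SecondMomentLE Pl (fun s => O.lO x s - O.lMean Pl x) (σ ^ 2) := by
  rw [hO.lMean_eq hx]
  exact hO.variance_lO x hx

theorem integral_lO_sub (hO : O.IsAdmissible P Pg Pl Ph σ) (hx : x ∈ P.X) :
    ∫ s, (O.lO x s - O.lMean Pl x) ∂Pl = 0 :=
  integral_sub_integral_eq_zero (integrable_of_memLp_sub_const (hO.secondMomentLE_lO_sub hx).1)

theorem secondMomentLE_yNoise (hO : O.IsAdmissible P Pg Pl Ph σ) (hx : x ∈ P.X) (hw : w ∈ P.Y) :
    SecondMomentLE (Ph.prod Pl)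
      (fun ξ => O.yGrad x ξ.1 ξ.2 w - (O.hMean Ph w - O.lMean Pl x)) (2 * σ ^ 2 + 2 * σ ^ 2) := by
  convert (hO.secondMoment_hO w hw).sub_integral.prod_sub (hO.secondMomentLE_lO_sub hx) using 2
    with ξ
  simp only [yGrad, hMean]; abel

theorem integral_yNoise (hO : O.IsAdmissible P Pg Pl Ph σ) (hx : x ∈ P.X) (hw : w ∈ P.Y) :
    ∫ ξ, (O.yGrad x ξ.1 ξ.2 w - (O.hMean Ph w - O.lMean Pl x)) ∂(Ph.prod Pl) = 0 := by
  have h := hO.secondMoment_hO w hw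
  rw [← integral_prod_sub_eq_zero (Q := Ph) (Q' := Pl) h.sub_integral.1
    (hO.secondMomentLE_lO_sub hx).1 (integral_sub_integral_eq_zero h.integrable)
    (hO.integral_lO_sub hx)]
  congr 1; ext1 ξ
  simp only [yGrad, hMean]; abel

/-- The linear part `-ℓ(x)` of the `y`-subproblem is treated exactly, so only the noise of `ℓ` and
the second moment of `∂h` remain. The noise is centred, hence no cross term. -/
theorem secondMomentLE_yGrad_add (hO : O.IsAdmissible P Pg Pl Ph σ) (hx : x ∈ P.X)
    (hw : w ∈ P.Y) :
    SecondMomentLE (Ph.prod Pl) (fun ξ => O.yGrad x ξ.1 ξ.2 w - -O.lMean Pl x)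
      (σ ^ 2 + σ ^ 2) := by
  convert (hO.secondMoment_hO w hw).prod_sub_of_integral_eq_zero (hO.secondMomentLE_lO_sub hx)
    (hO.integral_lO_sub hx) using 2 with ξ
  simp only [yGrad]; abel

theorem stepBound_y (hO : O.IsAdmissible P Pg Pl Ph σ) (hσ : 0 ≤ σ) (hx : x ∈ P.X)
    (hw : w ∈ P.Y) (hw' : w' ∈ P.Y) (μ : ℝ) (s : Vec m) :
    StepBound .nonsmooth (P.fy x) μ σ s (-O.lMean Pl x) w w' := by
  have h := hO.subgradient_h w' hw' w hw
  change P.h w' + inner ℝ (O.hMean Ph w') (w - w') ≤ P.h w at h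
  have h1 : inner ℝ (O.hMean Ph w') (w' - w) ≤ σ * ‖w' - w‖ :=
    (real_inner_le_norm _ _).trans
      (by gcongr; exact (hO.secondMoment_hO w' hw').norm_integral_le hσ)
  simp only [StepBound, InfProjProblem.fy, inner_sub_right, inner_neg_left,
    hO.lMean_eq hx] at *
  rw [real_inner_comm w (P.ℓ x), real_inner_comm w' (P.ℓ x)] at *
  linarith

end IsAdmissible

end Oracles

end

/-! ### Measurability and sample laws along St-SPG -/

section Run

set_option linter.unusedSectionVars false

open ContinuousLinearMap (adjoint)

variable {d m : ℕ} {P : InfProjProblem d m} {c : ProblemCase} {M : ℝ}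
  {Sg Sl Sh : Type*} [MeasurableSpace Sg] [MeasurableSpace Sl] [MeasurableSpace Sh]
  {Pg : Measure Sg} {Pl : Measure Sl} {Ph : Measure Sh}
  [IsProbabilityMeasure Pg] [IsProbabilityMeasure Pl] [IsProbabilityMeasure Ph]
  {O : Oracles d m Sg Sl Sh} {σ D γ μ : ℝ} {r : StepRule} {Ω : Type*}

theorem Oracles.IsAdmissible.convexOn_fx (hO : O.IsAdmissible P Pg Pl Ph σ)
    (hP : P.IsAdmissible c M) {x : Vec d} {y : Vec m} (hx : x ∈ P.X) (hy : y ∈ P.Y) :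
    ConvexOn ℝ P.X (P.fx c x y) :=
  convexOn_of_forall_subgradient hP.convex_X fun _ hz => hO.isSubgradientOn_xMean hP hx hy hz

theorem Oracles.IsAdmissible.convexOn_fy (hO : O.IsAdmissible P Pg Pl Ph σ)
    (hP : P.IsAdmissible c M) {x : Vec d} (hx : x ∈ P.X) : ConvexOn ℝ P.Y (P.fy x) :=
  convexOn_of_forall_subgradient (s := fun w => O.hMean Ph w - O.lMean Pl x) hP.convex_Y
    fun _ hw => hO.isSubgradientOn_yMean hx hw

/-- Up to constants the objective sees the parameters through `x` and the vector `∇ℓ(x)ᵀ y` (DC), or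
through `x` and `y` (bi-convex). The oracle mean stands in for `P.J`, being measurable on the whole
space. -/
theorem measurable_argmin_x [mΩ : MeasurableSpace Ω] (hO : O.IsAdmissible P Pg Pl Ph σ)
    (hP : P.IsAdmissible c M) (hγ : 0 < γ) {x v : Ω → Vec d} {y : Ω → Vec m} (hx : Measurable x)
    (hy : Measurable y) (hxX : ∀ ω, x ω ∈ P.X) (hyY : ∀ ω, y ω ∈ P.Y)
    (hv : ∀ ω, v ω ∈ P.X ∧
      IsMinOn (fun w => P.fx c (x ω) (y ω) w + γ / 2 * ‖w - x ω‖ ^ 2) P.X (v ω)) :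
    Measurable v := by
  have hconv := fun ω => hO.convexOn_fx hP (hxX ω) (hyY ω)
  cases c with
  | dc =>
    refine measurable_prox hγ hconv (θ := fun ω => adjoint (O.JMean Pl (x ω)) (y ω))
      (measurable_adjoint_apply (hO.measurable_JMean.comp hx) hy) hx hv fun ω₀ =>
        ⟨1, fun ω z hz hz1 => ?_⟩
    have h1 : inner ℝ (adjoint (O.JMean Pl (x ω)) (y ω) - adjoint (O.JMean Pl (x ω₀)) (y ω₀))
        (z - v ω₀) ≤
        ‖adjoint (O.JMean Pl (x ω)) (y ω) - adjoint (O.JMean Pl (x ω₀)) (y ω₀)‖ * 1 :=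
      (real_inner_le_norm _ _).trans (by gcongr)
    rw [mul_one] at h1
    rw [one_mul]
    refine le_trans (le_of_eq ?_) h1
    simp only [InfProjProblem.fx, inner_sub_left, ContinuousLinearMap.adjoint_inner_left,
      hO.JMean_eq (hxX _), inner_add_right, map_sub, inner_sub_right]
    ring
  | biconvex =>
    refine measurable_prox hγ hconv hy hx hv fun ω₀ => ?_
    -- The modulus is needed only within distance `1` of the minimizer, where `ℓ` is bounded by
    -- compactness.
    have hcomp : IsCompact (P.X ∩ Metric.closedBall (v ω₀) 1) :=
      (isCompact_closedBall _ _).inter_left hP.isClosed_X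
    have hcont : ContinuousOn P.ℓ (P.X ∩ Metric.closedBall (v ω₀) 1) := fun z hz =>
      ((hP.hasFDeriv_ℓ z hz.1).continuousWithinAt).mono inter_subset_left
    obtain ⟨B, hB⟩ := hcomp.exists_bound_of_continuousOn hcont
    refine ⟨B + B, fun ω z hz hz1 => ?_⟩
    have hz2 : ‖P.ℓ z‖ ≤ B := hB z ⟨hz, by rwa [mem_closedBall_iff_norm]⟩
    have hv2 : ‖P.ℓ (v ω₀)‖ ≤ B := hB _ ⟨(hv ω₀).1, Metric.mem_closedBall_self zero_le_one⟩
    have h1 : inner ℝ (y ω - y ω₀) (P.ℓ z - P.ℓ (v ω₀)) ≤ (B + B) * ‖y ω - y ω₀‖ := by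
      rw [mul_comm]
      exact (real_inner_le_norm _ _).trans
        (by gcongr; exact (norm_sub_le _ _).trans (add_le_add hz2 hv2))
    refine le_trans (le_of_eq ?_) h1
    simp only [InfProjProblem.fx, inner_sub_left, inner_sub_right]
    ring

theorem measurable_argmin_y [mΩ : MeasurableSpace Ω] (hO : O.IsAdmissible P Pg Pl Ph σ)
    (hP : P.IsAdmissible c M) (hμ : 0 < μ) {x : Ω → Vec d} {y u : Ω → Vec m} (hx : Measurable x)
    (hy : Measurable y) (hxX : ∀ ω, x ω ∈ P.X)
    (hu : ∀ ω, u ω ∈ P.Y ∧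
      IsMinOn (fun w => P.fy (x ω) w + μ / 2 * ‖w - y ω‖ ^ 2) P.Y (u ω)) :
    Measurable u := by
  refine measurable_prox hμ (fun ω => hO.convexOn_fy hP (hxX ω))
    (θ := fun ω => O.lMean Pl (x ω)) (hO.measurable_lMean.comp hx) hy hu fun ω₀ =>
      ⟨1, fun ω z hz hz1 => ?_⟩
  have h1 : inner ℝ (O.lMean Pl (x ω) - O.lMean Pl (x ω₀)) (z - u ω₀) ≤
      ‖O.lMean Pl (x ω) - O.lMean Pl (x ω₀)‖ * 1 :=
    (real_inner_le_norm _ _).trans (by gcongr)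
  rw [mul_one] at h1
  rw [one_mul]
  refine le_trans (le_of_eq ?_) h1
  simp only [InfProjProblem.fy, inner_sub_left, hO.lMean_eq (hxX _), inner_sub_right,
    real_inner_comm]
  ring

theorem two_le_of_stage {γ : ℝ} (hγ : 0 < γ) {k T : ℕ} (hk : 1 ≤ k) (hT : (k : ℝ) / γ + 1 ≤ T) :
    2 ≤ T := by
  have hk' : (1 : ℝ) ≤ k := by exact_mod_cast hk
  have : 0 < (k : ℝ) / γ := by positivity
  have : (1 : ℝ) < T := by linarith
  have : 1 < T := by exact_mod_cast this
  omega

theorem IsSPGOutput.mem {n : ℕ} {G : ℕ → Vec n → Vec n} {R : Vec n → ℝ} {z₁ : Vec n}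
    {A : Set (Vec n)} (hA : Convex ℝ A) {T : ℕ} (hT : 1 ≤ T) {η : ℕ → ℝ} {out : Vec n}
    (h : IsSPGOutput G R z₁ A T η out) (hz₁ : z₁ ∈ A) : out ∈ A := by
  obtain ⟨z, h1, hz, rfl⟩ := h
  refine hA.weightedAverage_mem hT fun t ht => ?_
  rw [Finset.mem_Icc] at ht
  rcases ht.1.eq_or_lt with rfl | h
  · rwa [h1]
  · have := (hz (t - 1) (by rw [Finset.mem_Icc]; omega)).1
    rwa [Nat.sub_add_cancel ht.1] at this

variable {Tx Ty : ℕ → ℕ} {K : ℕ} {x₁ : Vec d} {y₁ : Vec m}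
  {ζ : ℕ → ℕ → Ω → Sg × Sl × Sh × Sl} {x : ℕ → Ω → Vec d} {y : ℕ → Ω → Vec m}

theorem IsStSPGRun.mem {ζ : ℕ → ℕ → Sg × Sl × Sh × Sl} {x : ℕ → Vec d} {y : ℕ → Vec m}
    (hP : P.IsAdmissible c M)
    (h : IsStSPGRun P O c r γ μ Tx Ty K x₁ y₁ ζ x y)
    (hTx : ∀ k ∈ Finset.Icc 1 K, 1 ≤ Tx k) (hTy : ∀ k ∈ Finset.Icc 1 K, 1 ≤ Ty k)
    (hx₁ : x₁ ∈ P.X) (hy₁ : y₁ ∈ P.Y) {k : ℕ} (hk : 1 ≤ k) :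
    k ≤ K + 1 → x k ∈ P.X ∧ y k ∈ P.Y := by
  induction k, hk using Nat.le_induction with
  | base =>
    intro _
    rw [h.init_x, h.init_y]
    exact ⟨hx₁, hy₁⟩
  | succ k hk ih =>
    intro hkK
    have hk' : k ∈ Finset.Icc 1 K := by rw [Finset.mem_Icc]; omega
    obtain ⟨hx, hy⟩ := ih (by omega)
    exact ⟨(h.step_x k hk').mem hP.convex_X (hTx k hk') hx,
      (h.step_y k hk').mem hP.convex_Y (hTy k hk') hy⟩

theorem measurable_weightedAverage [mΩ : MeasurableSpace Ω] {n : ℕ} {z : ℕ → Ω → Vec n} {T : ℕ}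
    (h : ∀ t ∈ Finset.Icc 1 T, Measurable (z t)) :
    Measurable (fun ω => (∑ t ∈ Finset.Icc 1 T, (t : ℝ))⁻¹ •
      ∑ t ∈ Finset.Icc 1 T, (t : ℝ) • z t ω) := by
  have h1 : Measurable (fun ω => ∑ t ∈ Finset.Icc 1 T, (t : ℝ) • z t ω) :=
    Finset.measurable_fun_sum _ fun t ht => (h t ht).const_smul (t : ℝ)
  exact h1.const_smul (∑ t ∈ Finset.Icc 1 T, (t : ℝ))⁻¹

/-- Of the samples of stage `k`, only the halves of the `x`-step are required to be measurable. The
`y`-step relies on this, as it conditions on one half of its current sample. -/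
theorem IsStSPGRun.measurable_x_succ [mΩ : MeasurableSpace Ω] (hO : O.IsAdmissible P Pg Pl Ph σ)
    (hP : P.IsAdmissible c M) (hγ : 0 < γ)
    (hrun : ∀ ω, IsStSPGRun P O c r γ μ Tx Ty K x₁ y₁
      (fun k t => ζ k t ω) (fun k => x k ω) (fun k => y k ω))
    {k : ℕ} (hk : k ∈ Finset.Icc 1 K) (hx : Measurable (x k)) (hy : Measurable (y k))
    (hg : ∀ t, Measurable (fun ω => (ζ k t ω).1)) (hl : ∀ t, Measurable (fun ω => (ζ k t ω).2.1)) :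
    Measurable (x (k + 1)) := by
  choose z hz1 hz hout using fun ω => (hrun ω).step_x k hk
  have hz1m : Measurable (fun ω => z ω 1) := by simpa only [hz1] using hx
  have h := measurable_spg_iterate (z := fun t ω => z ω t) (T := Tx k) (t₀ := Tx k) hP.convex_X hγ r
    (G := fun t ω w => O.xGrad c (x k ω) (y k ω) (ζ k t ω).1 (ζ k t ω).2.1 w) hz1m
    (fun t _ _ w hw => hO.measurable_xGrad c hx hy (hg t) (hl t) hw)
    (fun ω t ht => by simpa only [hz1] using hz ω t ht)
  have : x (k + 1) = fun ω => _ := funext hout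
  rw [this]
  exact measurable_weightedAverage fun t ht => by
    rw [Finset.mem_Icc] at ht; exact h t ht.1 ht.2 ht.2

theorem IsStSPGRun.measurable_y_succ [mΩ : MeasurableSpace Ω] (hO : O.IsAdmissible P Pg Pl Ph σ)
    (hP : P.IsAdmissible c M) (hμ : 0 < μ)
    (hrun : ∀ ω, IsStSPGRun P O c r γ μ Tx Ty K x₁ y₁
      (fun k t => ζ k t ω) (fun k => x k ω) (fun k => y k ω))
    {k : ℕ} (hk : k ∈ Finset.Icc 1 K) (hx : Measurable (x (k + 1))) (hy : Measurable (y k))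
    (hh : ∀ t, Measurable (fun ω => (ζ k t ω).2.2.1))
    (hl : ∀ t, Measurable (fun ω => (ζ k t ω).2.2.2)) :
    Measurable (y (k + 1)) := by
  choose z hz1 hz hout using fun ω => (hrun ω).step_y k hk
  have hz1m : Measurable (fun ω => z ω 1) := by simpa only [hz1] using hy
  have h := measurable_spg_iterate (z := fun t ω => z ω t) (T := Ty k) (t₀ := Ty k) hP.convex_Y hμ
    .nonsmooth
    (G := fun t ω w => O.yGrad (x (k + 1) ω) (ζ k t ω).2.2.1 (ζ k t ω).2.2.2 w) hz1m
    (fun t _ _ w hw => hO.measurable_yGrad hx (hh t) (hl t) hw)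
    (fun ω t ht => by simpa only [hz1] using hz ω t ht)
  have : y (k + 1) = fun ω => _ := funext hout
  rw [this]
  exact measurable_weightedAverage fun t ht => by
    rw [Finset.mem_Icc] at ht; exact h t ht.1 ht.2 ht.2

/-- The iterates of stage `k` are determined by the samples of the stages before. -/
theorem IsStSPGRun.measurable_iterate [mΩ : MeasurableSpace Ω] (hO : O.IsAdmissible P Pg Pl Ph σ)
    (hP : P.IsAdmissible c M) (hγ : 0 < γ) (hμ : 0 < μ)
    (hrun : ∀ ω, IsStSPGRun P O c r γ μ Tx Ty K x₁ y₁
      (fun k t => ζ k t ω) (fun k => x k ω) (fun k => y k ω))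
    {k : ℕ} (hk : 1 ≤ k) :
    k ≤ K + 1 → (∀ j < k, ∀ t, Measurable (ζ j t)) → Measurable (x k) ∧ Measurable (y k) := by
  induction k, hk using Nat.le_induction with
  | base =>
    intro _ _
    have h1 : x 1 = fun _ => x₁ := funext fun ω => (hrun ω).init_x
    have h2 : y 1 = fun _ => y₁ := funext fun ω => (hrun ω).init_y
    rw [h1, h2]
    exact ⟨measurable_const, measurable_const⟩
  | succ k hk ih =>
    intro hkK hζ
    have hk' : k ∈ Finset.Icc 1 K := by rw [Finset.mem_Icc]; omega
    obtain ⟨hx, hy⟩ := ih (by omega) fun j hj => hζ j (by omega)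
    have hζk := hζ k (by omega)
    have hx' := IsStSPGRun.measurable_x_succ hO hP hγ hrun hk' hx hy
      (fun t => (hζk t).fst) (fun t => (hζk t).snd.fst)
    exact ⟨hx', IsStSPGRun.measurable_y_succ hO hP hμ hrun hk' hx' hy
      (fun t => (hζk t).snd.snd.fst) (fun t => (hζk t).snd.snd.snd)⟩

/-- A pair whose law is a product consists of independent variables with the marginal laws. -/
theorem marginals_of_map_prodMk_eq {α β : Type*} [MeasurableSpace α] [MeasurableSpace β]
    [MeasurableSpace Ω] {Pr : Measure Ω} [IsProbabilityMeasure Pr] {ν : Measure α} {ρ : Measure β}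
    [IsProbabilityMeasure ν] [IsProbabilityMeasure ρ] {a : Ω → α} {b : Ω → β} (ha : Measurable a)
    (hb : Measurable b) (h : Pr.map (fun ω => (a ω, b ω)) = ν.prod ρ) :
    Pr.map a = ν ∧ Pr.map b = ρ ∧ IndepFun a b Pr := by
  have h1 : Pr.map a = ν := by
    have : Pr.map a = (Pr.map (fun ω => (a ω, b ω))).map Prod.fst := by
      rw [Measure.map_map measurable_fst (ha.prodMk hb)]; rfl
    rw [this, h, Measure.map_fst_prod]; simp
  have h2 : Pr.map b = ρ := by
    have : Pr.map b = (Pr.map (fun ω => (a ω, b ω))).map Prod.snd := by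
      rw [Measure.map_map measurable_snd (ha.prodMk hb)]; rfl
    rw [this, h, Measure.map_snd_prod]; simp
  refine ⟨h1, h2, ?_⟩
  rw [indepFun_iff_map_prod_eq_prod_map_map ha.aemeasurable hb.aemeasurable, h, h1, h2]

theorem sample_marginals [MeasurableSpace Ω] {Pr : Measure Ω} [IsProbabilityMeasure Pr]
    {ξ : Ω → Sg × Sl × Sh × Sl} (hξ : Measurable ξ)
    (hlaw : Pr.map ξ = Pg.prod (Pl.prod (Ph.prod Pl))) :
    Pr.map (fun ω => ((ξ ω).1, (ξ ω).2.1)) = Pg.prod Pl ∧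
      Pr.map (fun ω => (ξ ω).2.2) = Ph.prod Pl ∧
      IndepFun (fun ω => ((ξ ω).1, (ξ ω).2.1)) (fun ω => (ξ ω).2.2) Pr := by
  refine marginals_of_map_prodMk_eq (hξ.fst.prodMk hξ.snd.fst) hξ.snd.snd ?_
  rw [← MeasurableEquiv.prodAssoc.map_measurableEquiv_injective.eq_iff, Measure.prodAssoc_prod,
    ← hlaw, Measure.map_map MeasurableEquiv.prodAssoc.measurable
      ((hξ.fst.prodMk hξ.snd.fst).prodMk hξ.snd.snd)]
  rfl

end Run

/-! ### Expected descent in the two steps of a stage -/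

section StageErrors

variable {d m : ℕ} {P : InfProjProblem d m} {c : ProblemCase} {M : ℝ}
  {Sg Sl Sh : Type*} [MeasurableSpace Sg] [MeasurableSpace Sl] [MeasurableSpace Sh]
  {Pg : Measure Sg} {Pl : Measure Sl} {Ph : Measure Sh}
  [IsProbabilityMeasure Pg] [IsProbabilityMeasure Pl] [IsProbabilityMeasure Ph]
  {O : Oracles d m Sg Sl Sh} {σ D γ μ : ℝ} {r : StepRule} {Ω : Type*}
  {Tx Ty : ℕ → ℕ} {K : ℕ} {x₁ : Vec d} {y₁ : Vec m}
  {ζ : ℕ → ℕ → Ω → Sg × Sl × Sh × Sl} {x : ℕ → Ω → Vec d} {y : ℕ → Ω → Vec m}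

/-- The σ-algebra of all samples but the one with index `p`. -/
abbrev samplesExcept (ζ : ℕ → ℕ → Ω → Sg × Sl × Sh × Sl) (p : ℕ × ℕ) : MeasurableSpace Ω :=
  ⨆ i ∈ ({p}ᶜ : Set (ℕ × ℕ)), MeasurableSpace.comap (ζ i.1 i.2) inferInstance

theorem measurable_samplesExcept {p i : ℕ × ℕ} (h : i ≠ p) :
    Measurable[samplesExcept ζ p] (ζ i.1 i.2) := by
  refine Measurable.of_comap_le ?_
  exact le_iSup₂_of_le (f := fun (i : ℕ × ℕ) (_ : i ∈ ({p}ᶜ : Set (ℕ × ℕ))) =>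
    MeasurableSpace.comap (ζ i.1 i.2) inferInstance) i h le_rfl

theorem norm_le_of_sq_le_sq {V : Type*} [NormedAddCommGroup V] {a : V} (hD : 0 ≤ D)
    (h : ‖a‖ ^ 2 ≤ D ^ 2) : ‖a‖ ≤ D :=
  (sq_le_sq₀ (norm_nonneg a) hD).1 h

/-- Expected descent of `f` in the `x`-step of a stage. -/
theorem exists_x_stage_error [mΩ : MeasurableSpace Ω] (Pr : Measure Ω) [IsProbabilityMeasure Pr]
    (hP : P.IsAdmissible c M) (hO : O.IsAdmissible P Pg Pl Ph σ) (hσ : 0 ≤ σ) (hD : 0 ≤ D)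
    (hγ : 0 < γ) (hμ : 0 < μ) (hr : O.XCondition P Pg Pl c r σ D γ)
    (hTx : ∀ k ∈ Finset.Icc 1 K, (k : ℝ) / γ + 1 ≤ Tx k)
    (hζ_meas : ∀ k t, Measurable (ζ k t))
    (hζ_law : ∀ k t, Pr.map (ζ k t) = Pg.prod (Pl.prod (Ph.prod Pl)))
    (hζ_indep : iIndepFun (fun p : ℕ × ℕ => ζ p.1 p.2) Pr)
    (hrun : ∀ ω, IsStSPGRun P O c r γ μ Tx Ty K x₁ y₁
      (fun k t => ζ k t ω) (fun k => x k ω) (fun k => y k ω))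
    {k : ℕ} (hk : k ∈ Finset.Icc 1 K) (hxX : ∀ ω, x k ω ∈ P.X) (hyY : ∀ ω, y k ω ∈ P.Y)
    (hx'X : ∀ ω, x (k + 1) ω ∈ P.X) (hy : ∀ᵐ ω ∂Pr, ‖y k ω‖ ^ 2 ≤ D ^ 2) {v : Ω → Vec d}
    (hv : ∀ ω, v ω ∈ P.X ∧
      IsMinOn (fun w => P.fx c (x k ω) (y k ω) w + γ / 2 * ‖w - x k ω‖ ^ 2) P.X (v ω)) :
    ∃ e : Ω → ℝ, Integrable e Pr ∧
      ∫ ω, e ω ∂Pr ≤ 14 / 3 * (4 * (2 * σ ^ 2 + 2 * D ^ 2 * σ ^ 2)) / k ∧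
      ∀ᵐ ω ∂Pr, γ / 4 * (‖x k ω - v ω‖ ^ 2 + ‖x (k + 1) ω - x k ω‖ ^ 2) ≤
        P.f (x k ω) (y k ω) - P.f (x (k + 1) ω) (y k ω) + e ω := by
  have hk1 := (Finset.mem_Icc.1 hk).1
  have hkK := (Finset.mem_Icc.1 hk).2
  choose z hz1 hz hout using fun ω => (hrun ω).step_x k hk
  -- measurability of the state before step `t`
  have hstate : ∀ 𝓜 : MeasurableSpace Ω, ∀ t₀, (∀ j < k, ∀ t, Measurable[𝓜] (ζ j t)) →
      (∀ t < t₀, Measurable[𝓜] (ζ k t)) →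
      Measurable[𝓜] (x k) ∧ Measurable[𝓜] (y k) ∧ Measurable[𝓜] v ∧
        ∀ t, 1 ≤ t → t ≤ t₀ → t ≤ Tx k → Measurable[𝓜] (fun ω => z ω t) := by
    intro 𝓜 t₀ h1 h2
    obtain ⟨hx, hy⟩ := IsStSPGRun.measurable_iterate (mΩ := 𝓜) hO hP hγ hμ hrun hk1 (by omega) h1
    refine ⟨hx, hy, measurable_argmin_x (mΩ := 𝓜) hO hP hγ hx hy hxX hyY hv, ?_⟩
    have hz1m : Measurable[𝓜] (fun ω => z ω 1) := by simpa only [hz1] using hx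
    exact measurable_spg_iterate (z := fun t ω => z ω t) (T := Tx k) (t₀ := t₀) hP.convex_X hγ r
      (G := fun t ω w => O.xGrad c (x k ω) (y k ω) (ζ k t ω).1 (ζ k t ω).2.1 w) hz1m
      (fun t _ ht w hw => hO.measurable_xGrad c hx hy (h2 t ht).fst (h2 t ht).snd.fst hw)
      (fun ω t ht => by simpa only [hz1] using hz ω t ht)
  obtain ⟨-, -, hvm, hzm⟩ := hstate mΩ (Tx k) (fun j _ t => hζ_meas j t) (fun t _ => hζ_meas k t)
  have hzX : ∀ ω, ∀ t, 1 ≤ t → t ≤ Tx k → z ω t ∈ P.X := by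
    intro ω t ht htT
    rcases ht.eq_or_lt with rfl | h
    · rw [hz1]; exact hxX ω
    · have := (hz ω (t - 1) (by rw [Finset.mem_Icc]; omega)).1
      rwa [Nat.sub_add_cancel ht] at this
  have hy' : ∀ᵐ ω ∂Pr, ‖y k ω‖ ≤ D := hy.mono fun ω h => norm_le_of_sq_le_sq hD h
  -- the state before step `t` and the sample of step `t`
  set θ : ℕ → Ω → Vec d × Vec m × Vec d × Vec d := fun t ω => (x k ω, y k ω, z ω t, v ω) with hθ
  set ξ : ℕ → Ω → Sg × Sl := fun t ω => ((ζ k t ω).1, (ζ k t ω).2.1) with hξ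
  have hξm : ∀ t, Measurable (ξ t) := fun t => (hζ_meas k t).fst.prodMk (hζ_meas k t).snd.fst
  -- Everything the noise of step `t` is paired with, including `v`, is determined by samples other
  -- than `(k, t)`.
  have hθ𝓜 : ∀ t ∈ Finset.Ico 1 (Tx k), Measurable[samplesExcept ζ (k, t)] (θ t) := by
    intro t ht
    rw [Finset.mem_Ico] at ht
    obtain ⟨h1, h2, h3, h4⟩ := hstate (samplesExcept ζ (k, t)) t
      (fun j hj s => measurable_samplesExcept (i := (j, s)) (by simp; omega))
      (fun s hs => measurable_samplesExcept (i := (k, s)) (by simp; omega))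
    exact h1.prodMk (h2.prodMk ((h4 t ht.1 le_rfl ht.2.le).prodMk h3))
  have hθm : ∀ t ∈ Finset.Ico 1 (Tx k), Measurable (θ t) := fun t ht =>
    (hθ𝓜 t ht).mono (iSup₂_le fun i _ => (hζ_meas i.1 i.2).comap_le) le_rfl
  have hfst : Measurable (fun s : Sg × Sl × Sh × Sl => (s.1, s.2.1)) := by fun_prop
  have hind : ∀ t ∈ Finset.Ico 1 (Tx k), IndepFun (θ t) (ξ t) Pr := by
    intro t ht
    have h1 : IndepFun (θ t) (ζ k t) Pr :=
      iIndepFun.indepFun_of_measurable_iSup_compl (ζ := fun i : ℕ × ℕ => ζ i.1 i.2)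
        (fun i => hζ_meas i.1 i.2) hζ_indep (k, t) (hθ𝓜 t ht)
    exact h1.comp (φ := id) (ψ := fun s : Sg × Sl × Sh × Sl => (s.1, s.2.1)) measurable_id hfst
  have hlaw : ∀ t, Pr.map (ξ t) = Pg.prod Pl := fun t =>
    (sample_marginals (hζ_meas k t) (hζ_law k t)).1
  have hπx : Measurable (fun q : (Vec d × Vec m × Vec d × Vec d) × Sg × Sl => q.1.1) := by fun_prop
  have hπy : Measurable (fun q : (Vec d × Vec m × Vec d × Vec d) × Sg × Sl => q.1.2.1) := by
    fun_prop
  have hπz : Measurable (fun q : (Vec d × Vec m × Vec d × Vec d) × Sg × Sl => q.1.2.2.1) := by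
    fun_prop
  have hGm : Measurable (fun q : (Vec d × Vec m × Vec d × Vec d) × Sg × Sl =>
      O.xGrad c q.1.1 q.1.2.1 q.2.1 q.2.2 q.1.2.2.1) :=
    hO.measurable_xGrad c hπx hπy measurable_snd.fst measurable_snd.snd hπz
  have hNm : Measurable (fun q : (Vec d × Vec m × Vec d × Vec d) × Sg × Sl =>
      O.xGrad c q.1.1 q.1.2.1 q.2.1 q.2.2 q.1.2.2.1 - O.xMean Pg Pl c q.1.1 q.1.2.1 q.1.2.2.1) :=
    hGm.sub (hO.measurable_xMean c hπx hπy hπz)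
  have hBm : Measurable (fun q : (Vec d × Vec m × Vec d × Vec d) × Sg × Sl =>
      O.xGrad c q.1.1 q.1.2.1 q.2.1 q.2.2 q.1.2.2.1 - O.xLin Pg Pl c r q.1.1 q.1.2.1 q.1.2.2.1) :=
    hGm.sub (hO.measurable_xLin c r hπx hπy hπz)
  have hnoise : ∀ t ∈ Finset.Ico 1 (Tx k), SecondMomentLE Pr
      (fun ω => O.xGrad c (x k ω) (y k ω) (ζ k t ω).1 (ζ k t ω).2.1 (z ω t)
        - O.xMean Pg Pl c (x k ω) (y k ω) (z ω t)) (2 * σ ^ 2 + 2 * D ^ 2 * σ ^ 2) := by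
    intro t ht
    have ht' := Finset.mem_Ico.1 ht
    exact SecondMomentLE.of_indepFun (hθm t ht) (hξm t) (hind t ht) (hlaw t) hNm
      (hy'.mono fun ω hω => hO.secondMomentLE_xNoise hr (hxX ω) hω (hzX ω t ht'.1 ht'.2.le))
  obtain ⟨e, he, he', hle⟩ := exists_stage_error Pr hP.convex_X hγ hk1 (hTx k hk) r
    (f := fun ω => P.fx c (x k ω) (y k ω))
    (S := fun ω w => O.xMean Pg Pl c (x k ω) (y k ω) w)
    (fun ω w hw => hO.isSubgradientOn_xMean hP (hxX ω) (hyY ω) hw)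
    (g := fun t ω => O.xGrad c (x k ω) (y k ω) (ζ k t ω).1 (ζ k t ω).2.1 (z ω t))
    (z := fun t ω => z ω t) (fun ω => by simpa only [hz1] using hxX ω)
    (fun ω t ht => by simpa only [hz1] using hz ω t ht) (v := v)
    (fun ω => by simpa only [hz1] using hv ω) hout hvm
    (fun t ht => by rw [Finset.mem_Icc] at ht; exact hzm t ht.1 ht.2 ht.2)
    (b := fun t ω => O.xLin Pg Pl c r (x k ω) (y k ω) (z ω t)) (β := Oracles.xLip σ D c r)
    (C := 2 * σ ^ 2 + 2 * D ^ 2 * σ ^ 2) (M := M)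
    (hy'.mono fun ω hω t ht => by
      rw [Finset.mem_Ico] at ht
      exact hO.stepBound_x hP hσ hD hr (hxX ω) (hyY ω) hω (hzX ω t ht.1 ht.2.le)
        (hzX ω (t + 1) (by omega) ht.2))
    (fun t ht => by
      have ht' := Finset.mem_Ico.1 ht
      exact SecondMomentLE.of_indepFun (hθm t ht) (hξm t) (hind t ht) (hlaw t) hBm
        (hy'.mono fun ω hω =>
          hO.secondMomentLE_xGrad_sub_xLin hr (hxX ω) hω (hzX ω t ht'.1 ht'.2.le)))
    (fun t ht => (hnoise t ht).1)
    (fun t ht hW => by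
      have ht' := Finset.mem_Ico.1 ht
      exact integral_inner_eq_zero_of_indepFun (hθm t ht) (hξm t) (hind t ht) (hlaw t) hNm
        (hnoise t ht).1
        (hy'.mono fun ω hω =>
          (hO.secondMomentLE_xNoise hr (hxX ω) hω (hzX ω t ht'.1 ht'.2.le)).integrable)
        (hy'.mono fun ω hω => hO.integral_xNoise hr (hxX ω) hω (hzX ω t ht'.1 ht'.2.le))
        (W := fun q => q.2.2.2 - q.2.2.1) (by fun_prop) hW)
    (fun ω => by
      simp only [hz1]
      exact (hP.fx_sub_le (hxX ω) (hyY ω) (hv ω).1).trans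
        (hP.oscillation _ (hxX ω) _ (hyY ω) _ (hv ω).1 _ (hyY ω)))
  refine ⟨e, he, he'.trans ?_, hle.mono fun ω hω => ?_⟩
  -- Both `C` and `β²` are at most `2σ² + 2D²σ²`, so `2C + 2β²` is at most four times that.
  · have := Oracles.xLip_sq_le σ D c r
    gcongr
    linarith
  · simp only [hz1] at hω
    exact hω.trans (by linarith [hP.fx_sub_le (hxX ω) (hyY ω) (hx'X ω)])

/-- Expected descent of `f` in the `y`-step of a stage. -/
theorem exists_y_stage_error [mΩ : MeasurableSpace Ω] (Pr : Measure Ω) [IsProbabilityMeasure Pr]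
    (hP : P.IsAdmissible c M) (hO : O.IsAdmissible P Pg Pl Ph σ) (hσ : 0 ≤ σ)
    (hγ : 0 < γ) (hμ : 0 < μ)
    (hTy : ∀ k ∈ Finset.Icc 1 K, (k : ℝ) / μ + 1 ≤ Ty k)
    (hζ_meas : ∀ k t, Measurable (ζ k t))
    (hζ_law : ∀ k t, Pr.map (ζ k t) = Pg.prod (Pl.prod (Ph.prod Pl)))
    (hζ_indep : iIndepFun (fun p : ℕ × ℕ => ζ p.1 p.2) Pr)
    (hrun : ∀ ω, IsStSPGRun P O c r γ μ Tx Ty K x₁ y₁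
      (fun k t => ζ k t ω) (fun k => x k ω) (fun k => y k ω))
    {k : ℕ} (hk : k ∈ Finset.Icc 1 K) (hyY : ∀ ω, y k ω ∈ P.Y)
    (hx'X : ∀ ω, x (k + 1) ω ∈ P.X) {u : Ω → Vec m}
    (hu : ∀ ω, u ω ∈ P.Y ∧
      IsMinOn (fun w => P.fy (x (k + 1) ω) w + μ / 2 * ‖w - y k ω‖ ^ 2) P.Y (u ω)) :
    ∃ e : Ω → ℝ, Integrable e Pr ∧
      ∫ ω, e ω ∂Pr ≤ 14 / 3 * (6 * σ ^ 2) / k ∧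
      ∀ᵐ ω ∂Pr, μ / 4 * (‖y k ω - u ω‖ ^ 2 + ‖y (k + 1) ω - y k ω‖ ^ 2) ≤
        P.f (x (k + 1) ω) (y k ω) - P.f (x (k + 1) ω) (y (k + 1) ω) + e ω := by
  have hk1 := (Finset.mem_Icc.1 hk).1
  have hkK := (Finset.mem_Icc.1 hk).2
  choose z hz1 hz hout using fun ω => (hrun ω).step_y k hk
  -- The iterate `x (k + 1)` depends on the first halves of stage `k`, including that of sample `t`.
  -- So those halves are required for every `t`, whole samples only before `t₀`, and freshness is
  -- claimed for the second half alone.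
  have hstate : ∀ 𝓜 : MeasurableSpace Ω, ∀ t₀, (∀ j < k, ∀ t, Measurable[𝓜] (ζ j t)) →
      (∀ t, Measurable[𝓜] (fun ω => ((ζ k t ω).1, (ζ k t ω).2.1))) →
      (∀ t < t₀, Measurable[𝓜] (ζ k t)) →
      Measurable[𝓜] (x (k + 1)) ∧ Measurable[𝓜] u ∧
        ∀ t, 1 ≤ t → t ≤ t₀ → t ≤ Ty k → Measurable[𝓜] (fun ω => z ω t) := by
    intro 𝓜 t₀ h1 h2 h3
    obtain ⟨hx, hy⟩ := IsStSPGRun.measurable_iterate (mΩ := 𝓜) hO hP hγ hμ hrun hk1 (by omega) h1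
    have hx' := IsStSPGRun.measurable_x_succ (mΩ := 𝓜) hO hP hγ hrun hk hx hy
      (fun t => (h2 t).fst) (fun t => (h2 t).snd)
    refine ⟨hx', measurable_argmin_y (mΩ := 𝓜) hO hP hμ hx' hy hx'X hu, ?_⟩
    have hz1m : Measurable[𝓜] (fun ω => z ω 1) := by simpa only [hz1] using hy
    exact measurable_spg_iterate (z := fun t ω => z ω t) (T := Ty k) (t₀ := t₀) hP.convex_Y hμ
      .nonsmooth
      (G := fun t ω w => O.yGrad (x (k + 1) ω) (ζ k t ω).2.2.1 (ζ k t ω).2.2.2 w) hz1m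
      (fun t _ ht w hw => hO.measurable_yGrad hx' (h3 t ht).snd.snd.fst (h3 t ht).snd.snd.snd hw)
      (fun ω t ht => by simpa only [hz1] using hz ω t ht)
  obtain ⟨-, hum, hzm⟩ := hstate mΩ (Ty k) (fun j _ t => hζ_meas j t)
    (fun t => (hζ_meas k t).fst.prodMk (hζ_meas k t).snd.fst) (fun t _ => hζ_meas k t)
  have hzY : ∀ ω, ∀ t, 1 ≤ t → t ≤ Ty k → z ω t ∈ P.Y := by
    intro ω t ht htT
    rcases ht.eq_or_lt with rfl | h
    · rw [hz1]; exact hyY ω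
    · have := (hz ω (t - 1) (by rw [Finset.mem_Icc]; omega)).1
      rwa [Nat.sub_add_cancel ht] at this
  set θ : ℕ → Ω → Vec d × Vec m × Vec m := fun t ω => (x (k + 1) ω, z ω t, u ω) with hθ
  set ξ : ℕ → Ω → Sh × Sl := fun t ω => (ζ k t ω).2.2 with hξ
  have hξm : ∀ t, Measurable (ξ t) := fun t => (hζ_meas k t).snd.snd
  have hfst : Measurable (fun s : Sg × Sl × Sh × Sl => (s.1, s.2.1)) := by fun_prop
  have hsnd : Measurable (fun s : Sg × Sl × Sh × Sl => s.2.2) := by fun_prop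
  have hθ𝓜 : ∀ t ∈ Finset.Ico 1 (Ty k), Measurable[samplesExcept ζ (k, t) ⊔
      MeasurableSpace.comap (fun ω => ((ζ k t ω).1, (ζ k t ω).2.1)) inferInstance] (θ t) := by
    intro t ht
    rw [Finset.mem_Ico] at ht
    have hsub : ∀ i : ℕ × ℕ, i ≠ (k, t) → Measurable[samplesExcept ζ (k, t) ⊔
        MeasurableSpace.comap (fun ω => ((ζ k t ω).1, (ζ k t ω).2.1)) inferInstance]
        (ζ i.1 i.2) := fun i hi => (measurable_samplesExcept hi).mono le_sup_left le_rfl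
    obtain ⟨h1, h3, h4⟩ := hstate (samplesExcept ζ (k, t) ⊔
        MeasurableSpace.comap (fun ω => ((ζ k t ω).1, (ζ k t ω).2.1)) inferInstance) t
      (fun j hj s => hsub (j, s) (by simp; omega))
      (fun s => by
        rcases eq_or_ne s t with rfl | hs
        · exact Measurable.of_comap_le le_sup_right
        · exact hfst.comp (hsub (k, s) (by simpa using hs)))
      (fun s hs => hsub (k, s) (by simp; omega))
    exact h1.prodMk ((h4 t ht.1 le_rfl ht.2.le).prodMk h3)
  have hθm : ∀ t ∈ Finset.Ico 1 (Ty k), Measurable (θ t) := fun t ht =>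
    (hθ𝓜 t ht).mono (sup_le (iSup₂_le fun i _ => (hζ_meas i.1 i.2).comap_le)
      (hfst.comp (hζ_meas k t)).comap_le) le_rfl
  have hmarg := fun t => sample_marginals (hζ_meas k t) (hζ_law k t)
  have hind : ∀ t ∈ Finset.Ico 1 (Ty k), IndepFun (θ t) (ξ t) Pr := fun t ht =>
    iIndepFun.indepFun_of_measurable_sup (ζ := fun i : ℕ × ℕ => ζ i.1 i.2)
      (fun i => hζ_meas i.1 i.2) hζ_indep (k, t) (a := fun s : Sg × Sl × Sh × Sl => (s.1, s.2.1))
      (b := fun s : Sg × Sl × Sh × Sl => s.2.2) hfst hsnd (hmarg t).2.2 (hθ𝓜 t ht)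
  have hlaw : ∀ t, Pr.map (ξ t) = Ph.prod Pl := fun t => (hmarg t).2.1
  have hπx : Measurable (fun q : (Vec d × Vec m × Vec m) × Sh × Sl => q.1.1) := by fun_prop
  have hπz : Measurable (fun q : (Vec d × Vec m × Vec m) × Sh × Sl => q.1.2.1) := by fun_prop
  have hGm : Measurable (fun q : (Vec d × Vec m × Vec m) × Sh × Sl =>
      O.yGrad q.1.1 q.2.1 q.2.2 q.1.2.1) :=
    hO.measurable_yGrad hπx measurable_snd.fst measurable_snd.snd hπz
  have hNm := hGm.sub ((hO.measurable_hMean.comp hπz).sub (hO.measurable_lMean.comp hπx))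
  have hBm := hGm.sub (hO.measurable_lMean.comp hπx).neg
  have hnoise : ∀ t ∈ Finset.Ico 1 (Ty k), SecondMomentLE Pr
      (fun ω => O.yGrad (x (k + 1) ω) (ζ k t ω).2.2.1 (ζ k t ω).2.2.2 (z ω t)
        - (O.hMean Ph (z ω t) - O.lMean Pl (x (k + 1) ω))) (2 * σ ^ 2 + 2 * σ ^ 2) := by
    intro t ht
    have ht' := Finset.mem_Ico.1 ht
    exact SecondMomentLE.of_indepFun (hθm t ht) (hξm t) (hind t ht) (hlaw t) hNm
      (Filter.Eventually.of_forall fun ω =>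
        hO.secondMomentLE_yNoise (hx'X ω) (hzY ω t ht'.1 ht'.2.le))
  obtain ⟨e, he, he', hle⟩ := exists_stage_error Pr hP.convex_Y hμ hk1 (hTy k hk) .nonsmooth
    (f := fun ω => P.fy (x (k + 1) ω))
    (S := fun ω w => O.hMean Ph w - O.lMean Pl (x (k + 1) ω))
    (fun ω w hw => hO.isSubgradientOn_yMean (hx'X ω) hw)
    (g := fun t ω => O.yGrad (x (k + 1) ω) (ζ k t ω).2.2.1 (ζ k t ω).2.2.2 (z ω t))
    (z := fun t ω => z ω t) (fun ω => by simpa only [hz1] using hyY ω)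
    (fun ω t ht => by simpa only [hz1] using hz ω t ht) (v := u)
    (fun ω => by simpa only [hz1] using hu ω) hout hum
    (fun t ht => by rw [Finset.mem_Icc] at ht; exact hzm t ht.1 ht.2 ht.2)
    (b := fun t ω => -O.lMean Pl (x (k + 1) ω)) (β := σ)
    (C := σ ^ 2 + σ ^ 2) (M := M)
    (Filter.Eventually.of_forall fun ω t ht => by
      rw [Finset.mem_Ico] at ht
      exact hO.stepBound_y hσ (hx'X ω) (hzY ω t ht.1 ht.2.le) (hzY ω (t + 1) (by omega) ht.2) μ _)
    (fun t ht => by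
      have ht' := Finset.mem_Ico.1 ht
      exact SecondMomentLE.of_indepFun (hθm t ht) (hξm t) (hind t ht) (hlaw t) hBm
        (Filter.Eventually.of_forall fun ω =>
          hO.secondMomentLE_yGrad_add (hx'X ω) (hzY ω t ht'.1 ht'.2.le)))
    (fun t ht => (hnoise t ht).1)
    (fun t ht hW => by
      have ht' := Finset.mem_Ico.1 ht
      exact integral_inner_eq_zero_of_indepFun (hθm t ht) (hξm t) (hind t ht) (hlaw t) hNm
        (hnoise t ht).1
        (Filter.Eventually.of_forall fun ω =>
          (hO.secondMomentLE_yNoise (hx'X ω) (hzY ω t ht'.1 ht'.2.le)).integrable)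
        (Filter.Eventually.of_forall fun ω =>
          hO.integral_yNoise (hx'X ω) (hzY ω t ht'.1 ht'.2.le))
        (W := fun q => q.2.2 - q.2.1) (by fun_prop) hW)
    (fun ω => by
      simp only [hz1]
      rw [InfProjProblem.IsAdmissible.fy_sub_eq]
      exact hP.oscillation _ (hx'X ω) _ (hyY ω) _ (hx'X ω) _ (hu ω).1)
  refine ⟨e, he, he'.trans (le_of_eq ?_), hle.mono fun ω hω => ?_⟩
  -- `6σ² = 2C + 2β²` with `C = 2σ²` and `β = σ`.
  · ring
  · simp only [hz1, InfProjProblem.IsAdmissible.fy_sub_eq] at hω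
    exact hω

end StageErrors

/-! ### Weighted summation over stages and the random index -/

section Averaging

/-- Summation by parts. The induction carries `M + a (K + 1) - a (n + 1)`, which is nonnegative by
the oscillation bound, so raising the weight from `w n` to `w (n + 1)` only enlarges the bound. -/
theorem sum_weighted_telescope_le {w a : ℕ → ℝ} {K : ℕ} (hK : 1 ≤ K) {M : ℝ}
    (hw0 : ∀ k, 0 ≤ w k) (hw : Monotone w)
    (ha : ∀ k ∈ Finset.Icc 1 (K + 1), a k - a (K + 1) ≤ M) :
    ∑ k ∈ Finset.Icc 1 K, w k * (a k - a (k + 1)) ≤ w K * M := by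
  have key : ∀ n, 1 ≤ n → n ≤ K →
      ∑ k ∈ Finset.Icc 1 n, w k * (a k - a (k + 1)) ≤ w n * (M + a (K + 1) - a (n + 1)) := by
    intro n hn
    induction n, hn using Nat.le_induction with
    | base =>
      intro _
      have h := mul_le_mul_of_nonneg_left (ha 1 (by simp)) (hw0 1)
      simp only [Finset.Icc_self, Finset.sum_singleton]
      linarith
    | succ n hn ih =>
      intro hnK
      rw [← Finset.insert_Icc_right_eq_Icc_add_one (by omega), Finset.sum_insert (by simp)]
      have h1 := ih (by omega)
      have h2 := ha (n + 1) (by rw [Finset.mem_Icc]; omega)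
      have h3 := mul_le_mul_of_nonneg_right (hw n.le_succ)
        (by linarith : 0 ≤ M + a (K + 1) - a (n + 1))
      rw [Nat.succ_eq_add_one] at h3
      linarith
  have h := key K hK le_rfl
  rwa [add_sub_cancel_right] at h

theorem rpow_succ_le_sum_rpow {α : ℝ} (hα : 0 ≤ α) (K : ℕ) :
    (K : ℝ) ^ α * K ≤ (α + 1) * ∑ s ∈ Finset.Icc 1 K, (s : ℝ) ^ α := by
  induction K with
  | zero => simp
  | succ K ih =>
    rw [← Finset.insert_Icc_right_eq_Icc_add_one (by omega), Finset.sum_insert (by simp), mul_add]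
    have hpos : (0 : ℝ) < (K : ℝ) + 1 := by positivity
    -- Bernoulli at `-1/(K+1)` is the increment bound `(K+1)^(α+1) - K^(α+1) ≤ (α+1)(K+1)^α`.
    have hb := one_add_mul_self_le_rpow_one_add (s := -(1 / ((K : ℝ) + 1))) (p := α + 1)
      (by rw [neg_le_neg_iff, div_le_one hpos]; linarith [Nat.cast_nonneg (α := ℝ) K])
      (by linarith)
    have e : 1 + -(1 / ((K : ℝ) + 1)) = K / (K + 1) := by field_simp; ring
    rw [e, Real.div_rpow (by positivity) (by positivity), le_div_iff₀ (by positivity)] at hb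
    have e1 : ((K : ℝ) + 1) ^ (α + 1) = ((K : ℝ) + 1) ^ α * (K + 1) := Real.rpow_add_one hpos.ne' α
    have e2 : (K : ℝ) ^ (α + 1) ≤ (K : ℝ) ^ α * K := by
      rcases Nat.eq_zero_or_pos K with rfl | hK
      · rw [Nat.cast_zero, Real.zero_rpow (by linarith), mul_zero]
      · exact (Real.rpow_add_one (by positivity) α).le
    rw [e1] at hb
    push_cast
    have e3 : (1 + (α + 1) * -(1 / ((K : ℝ) + 1))) * (((K : ℝ) + 1) ^ α * (K + 1)) =
        ((K : ℝ) + 1) ^ α * (K + 1) - (α + 1) * ((K : ℝ) + 1) ^ α := by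
      field_simp; ring
    rw [e3] at hb
    linarith

variable {Ω : Type*} [MeasurableSpace Ω] {Pr : Measure Ω} [IsProbabilityMeasure Pr]

/-- Expectation of a sequence of variables at an independent random index. -/
theorem integral_random_index {τ : Ω → ℕ} (hτ : Measurable τ) {I : Finset ℕ} {p : ℕ → ℝ}
    (hp : ∀ k ∈ I, Pr.real {ω | τ ω = k} = p k) (hsum : ∑ k ∈ I, p k = 1) {Φ : ℕ → Ω → ℝ}
    (hΦ : ∀ k ∈ I, Integrable (Φ k) Pr) (hind : ∀ k ∈ I, IndepFun τ (Φ k) Pr) :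
    Integrable (fun ω => Φ (τ ω) ω) Pr ∧
      ∫ ω, Φ (τ ω) ω ∂Pr = ∑ k ∈ I, p k * ∫ ω, Φ k ω ∂Pr := by
  have hset : ∀ k, MeasurableSet {ω | τ ω = k} := fun k => hτ (measurableSet_singleton k)
  -- The prescribed probabilities sum to `1`, so no mass is left outside `I`.
  have hae : ∀ᵐ ω ∂Pr, τ ω ∈ I := by
    have hU : {ω | τ ω ∈ I} = ⋃ k ∈ I, {ω | τ ω = k} := by
      ext ω; simp
    have h1 : Pr.real {ω | τ ω ∈ I} = 1 := by
      rw [hU, measureReal_biUnion_finset, Finset.sum_congr rfl hp, hsum]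
      · intro i _ j _ hij
        exact Set.disjoint_left.2 fun ω (hi : τ ω = i) (hj : τ ω = j) => hij (hi.symm.trans hj)
      · exact fun k _ => hset k
    rw [ae_iff]
    have hm : MeasurableSet {ω | τ ω ∈ I} := hτ I.measurableSet
    have h2 : Pr {ω | τ ω ∈ I} = 1 := by
      rw [measureReal_def] at h1
      rw [← ENNReal.ofReal_toReal (measure_ne_top Pr _), h1, ENNReal.ofReal_one]
    exact (prob_compl_eq_zero_iff hm).2 h2
  set χ : ℕ → ℕ → ℝ := fun k n => if n = k then 1 else 0
  have hχm : ∀ k, Measurable (χ k) := fun k => measurable_of_countable _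
  have hχi : ∀ k, Integrable (fun ω => χ k (τ ω)) Pr := fun k =>
    (integrable_const (1 : ℝ)).mono' ((hχm k).comp hτ).aestronglyMeasurable
      (Filter.Eventually.of_forall fun ω => by simp only [χ]; split_ifs <;> simp)
  have hχ : ∀ k ∈ I, ∫ ω, χ k (τ ω) ∂Pr = p k := by
    intro k hk
    have : (fun ω => χ k (τ ω)) = {ω | τ ω = k}.indicator 1 := by
      ext ω; simp [χ, Set.indicator_apply]
    rw [this, integral_indicator_one (hset k), hp k hk]
  have hind' : ∀ k ∈ I, IndepFun (fun ω => χ k (τ ω)) (Φ k) Pr := fun k hk =>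
    (hind k hk).comp (hχm k) measurable_id
  have hmul : ∀ k ∈ I, Integrable (fun ω => χ k (τ ω) * Φ k ω) Pr := fun k hk =>
    (hind' k hk).integrable_mul (hχi k) (hΦ k hk)
  have heq : (fun ω => ∑ k ∈ I, χ k (τ ω) * Φ k ω) =ᵐ[Pr] fun ω => Φ (τ ω) ω := by
    filter_upwards [hae] with ω hω
    rw [Finset.sum_eq_single_of_mem (τ ω) hω]
    · simp [χ]
    · intro k _ hk
      simp [χ, hk.symm]
  refine ⟨(integrable_finsetSum _ hmul).congr heq, ?_⟩
  rw [← integral_congr_ae heq, integral_finsetSum _ hmul]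
  refine Finset.sum_congr rfl fun k hk => ?_
  rw [(hind' k hk).integral_fun_mul_eq_mul_integral (hχi k).1 (hΦ k hk).1, hχ k hk]

/-- Weighted summation of the expected descent of alternating steps. -/
theorem sum_weighted_integral_le {K : ℕ} (hK : 1 ≤ K) {α M Q p p' : ℝ} (hα : 1 ≤ α) (hp : 0 < p)
    (hp' : 0 < p') {W V a a' e e' : ℕ → Ω → ℝ}
    (hW0 : ∀ k ω, 0 ≤ W k ω) (hV0 : ∀ k ω, 0 ≤ V k ω)
    (hWm : ∀ k ∈ Finset.Icc 1 K, AEStronglyMeasurable (W k) Pr)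
    (hVm : ∀ k ∈ Finset.Icc 1 K, AEStronglyMeasurable (V k) Pr)
    (he : ∀ k ∈ Finset.Icc 1 K, Integrable (e k) Pr)
    (he' : ∀ k ∈ Finset.Icc 1 K, Integrable (e' k) Pr)
    (hee' : ∀ k ∈ Finset.Icc 1 K, ∫ ω, e k ω ∂Pr + ∫ ω, e' k ω ∂Pr ≤ Q / k)
    (hW : ∀ k ∈ Finset.Icc 1 K, ∀ᵐ ω ∂Pr, p * W k ω ≤ a k ω - a' k ω + e k ω)
    (hV : ∀ k ∈ Finset.Icc 1 K, ∀ᵐ ω ∂Pr, p' * V k ω ≤ a' k ω - a (k + 1) ω + e' k ω)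
    (ha : ∀ ω, ∀ k ∈ Finset.Icc 1 (K + 1), a k ω - a (K + 1) ω ≤ M)
    (ha₁ : ∀ ω, ∀ k ∈ Finset.Icc 1 K, a k ω - a' k ω ≤ M)
    (ha₂ : ∀ ω, ∀ k ∈ Finset.Icc 1 K, a' k ω - a (k + 1) ω ≤ M) (hQ : 0 ≤ Q) :
    (∀ k ∈ Finset.Icc 1 K, Integrable (W k) Pr) ∧ (∀ k ∈ Finset.Icc 1 K, Integrable (V k) Pr) ∧
      p * ∑ k ∈ Finset.Icc 1 K, (k : ℝ) ^ α * ∫ ω, W k ω ∂Pr ≤ (K : ℝ) ^ α * (M + Q) ∧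
      p' * ∑ k ∈ Finset.Icc 1 K, (k : ℝ) ^ α * ∫ ω, V k ω ∂Pr ≤ (K : ℝ) ^ α * (M + Q) := by
  -- Integrability comes from the descent inequality: the decrease of `f` is at most `M` pathwise,
  -- so `U` is dominated by `(M + b)/q`.
  have hdom : ∀ {q : ℝ} {U b : Ω → ℝ}, 0 < q → (∀ ω, 0 ≤ U ω) → AEStronglyMeasurable U Pr →
      Integrable b Pr → (∀ᵐ ω ∂Pr, q * U ω ≤ M + b ω) → Integrable U Pr := by
    intro q U b hq hU hUm hb h
    refine (((integrable_const M).add hb).const_mul (1 / q)).mono' hUm (h.mono fun ω hω => ?_)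
    rw [Real.norm_of_nonneg (hU ω), div_mul_eq_mul_div, le_div_iff₀ hq]
    simp only [Pi.add_apply]
    linarith
  have hWi : ∀ k ∈ Finset.Icc 1 K, Integrable (W k) Pr := fun k hk =>
    hdom hp (hW0 k) (hWm k hk) (he k hk) ((hW k hk).mono fun ω hω => by linarith [ha₁ ω k hk])
  have hVi : ∀ k ∈ Finset.Icc 1 K, Integrable (V k) Pr := fun k hk =>
    hdom hp' (hV0 k) (hVm k hk) (he' k hk) ((hV k hk).mono fun ω hω => by linarith [ha₂ ω k hk])
  have hpath : ∀ᵐ ω ∂Pr,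
      ∑ k ∈ Finset.Icc 1 K, (k : ℝ) ^ α * (p * W k ω + p' * V k ω - (e k ω + e' k ω)) ≤
        (K : ℝ) ^ α * M := by
    have h1 := (Finset.eventually_all (Finset.Icc 1 K)).2 hW
    have h2 := (Finset.eventually_all (Finset.Icc 1 K)).2 hV
    filter_upwards [h1, h2] with ω h1 h2
    refine le_trans (Finset.sum_le_sum fun k hk => ?_)
      (sum_weighted_telescope_le (w := fun k => (k : ℝ) ^ α) (a := fun k => a k ω) hK
        (fun k => by positivity) (fun i j hij => by
          have : (i : ℝ) ≤ j := by exact_mod_cast hij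
          exact Real.rpow_le_rpow (by positivity) this (by linarith)) (ha ω))
    exact mul_le_mul_of_nonneg_left (by linarith [h1 k hk, h2 k hk])
      (Real.rpow_nonneg (Nat.cast_nonneg k) α)
  have hterm : ∀ k ∈ Finset.Icc 1 K, Integrable
      (fun ω => (k : ℝ) ^ α * (p * W k ω + p' * V k ω - (e k ω + e' k ω))) Pr := fun k hk =>
    ((((hWi k hk).const_mul p).add ((hVi k hk).const_mul p')).sub
      ((he k hk).add (he' k hk))).const_mul _
  have hint := integral_mono_ae (integrable_finsetSum _ hterm) (integrable_const _) hpath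
  rw [integral_finsetSum _ hterm, integral_const, probReal_univ, one_smul] at hint
  have hval : ∀ k ∈ Finset.Icc 1 K,
      ∫ ω, (k : ℝ) ^ α * (p * W k ω + p' * V k ω - (e k ω + e' k ω)) ∂Pr =
      p * ((k : ℝ) ^ α * ∫ ω, W k ω ∂Pr) + p' * ((k : ℝ) ^ α * ∫ ω, V k ω ∂Pr)
        - (k : ℝ) ^ α * (∫ ω, e k ω ∂Pr + ∫ ω, e' k ω ∂Pr) := by
    intro k hk
    have i1 : Integrable (fun ω => p * W k ω + p' * V k ω) Pr :=
      ((hWi k hk).const_mul p).add ((hVi k hk).const_mul p')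
    have i2 : Integrable (fun ω => e k ω + e' k ω) Pr := (he k hk).add (he' k hk)
    rw [integral_const_mul, integral_sub i1 i2, integral_add ((hWi k hk).const_mul p)
      ((hVi k hk).const_mul p'), integral_add (he k hk) (he' k hk), integral_const_mul,
      integral_const_mul]
    ring
  rw [Finset.sum_congr rfl hval, Finset.sum_sub_distrib, Finset.sum_add_distrib, ← Finset.mul_sum,
    ← Finset.mul_sum] at hint
  have herr : ∑ k ∈ Finset.Icc 1 K, (k : ℝ) ^ α * (∫ ω, e k ω ∂Pr + ∫ ω, e' k ω ∂Pr) ≤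
      (K : ℝ) ^ α * Q := by
    have hK' : (1 : ℝ) ≤ K := by exact_mod_cast hK
    -- The factor `1/k` lowers the exponent to `α - 1 ≥ 0`, so each of the `K` terms is at most
    -- `K^(α-1) Q`.
    have hle : ∀ k ∈ Finset.Icc 1 K,
        (k : ℝ) ^ α * (∫ ω, e k ω ∂Pr + ∫ ω, e' k ω ∂Pr) ≤ (K : ℝ) ^ (α - 1) * Q := by
      intro k hk
      have hk1 : (1 : ℝ) ≤ k := by exact_mod_cast (Finset.mem_Icc.1 hk).1
      have hkK : (k : ℝ) ≤ K := by exact_mod_cast (Finset.mem_Icc.1 hk).2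
      calc (k : ℝ) ^ α * (∫ ω, e k ω ∂Pr + ∫ ω, e' k ω ∂Pr) ≤ (k : ℝ) ^ α * (Q / k) := by
            gcongr; exact hee' k hk
        _ = (k : ℝ) ^ (α - 1) * Q := by
            rw [Real.rpow_sub_one (by positivity)]; ring
        _ ≤ (K : ℝ) ^ (α - 1) * Q := by
            gcongr
    refine (Finset.sum_le_sum hle).trans (le_of_eq ?_)
    rw [Finset.sum_const, Nat.card_Icc, Real.rpow_sub_one (by positivity), nsmul_eq_mul]
    simp only [add_tsub_cancel_right]
    field_simp
  -- Both weighted sums are nonnegative, so each alone obeys the bound for their total.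
  have hWn : 0 ≤ p * ∑ k ∈ Finset.Icc 1 K, (k : ℝ) ^ α * ∫ ω, W k ω ∂Pr :=
    mul_nonneg hp.le (Finset.sum_nonneg fun k _ =>
      mul_nonneg (by positivity) (integral_nonneg (hW0 k)))
  have hVn : 0 ≤ p' * ∑ k ∈ Finset.Icc 1 K, (k : ℝ) ^ α * ∫ ω, V k ω ∂Pr :=
    mul_nonneg hp'.le (Finset.sum_nonneg fun k _ =>
      mul_nonneg (by positivity) (integral_nonneg (hV0 k)))
  exact ⟨hWi, hVi, by linarith, by linarith⟩

/-- The rate for the random index `τ` with law proportional to `k ^ α`. -/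
theorem random_index_rate {V : Type*} [NormedAddCommGroup V] [MeasurableSpace V] [BorelSpace V]
    [SecondCountableTopology V] {K : ℕ} (hK : 1 ≤ K) {α B γ : ℝ} (hα : 1 ≤ α) (hγ : 0 < γ)
    (hB : 0 ≤ B) {τ : Ω → ℕ} (hτ : Measurable τ)
    (hlaw : ∀ k ∈ Finset.Icc 1 K,
      Pr.real {ω | τ ω = k} = (k : ℝ) ^ α / ∑ s ∈ Finset.Icc 1 K, (s : ℝ) ^ α)
    {x v : ℕ → Ω → V} (hx : ∀ k ∈ Finset.Icc 1 (K + 1), Measurable (x k))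
    (hv : ∀ k ∈ Finset.Icc 1 K, Measurable (v k))
    (hind : ∀ k, IndepFun τ (fun ω => (x k ω, x (k + 1) ω, v k ω)) Pr)
    (hW : ∀ k ∈ Finset.Icc 1 K,
      Integrable (fun ω => ‖x k ω - v k ω‖ ^ 2 + ‖x (k + 1) ω - x k ω‖ ^ 2) Pr)
    (hle : γ / 4 * ∑ k ∈ Finset.Icc 1 K, (k : ℝ) ^ α *
      ∫ ω, (‖x k ω - v k ω‖ ^ 2 + ‖x (k + 1) ω - x k ω‖ ^ 2) ∂Pr ≤ (K : ℝ) ^ α * B) :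
    Integrable (fun ω => ‖x (τ ω + 1) ω - v (τ ω) ω‖ ^ 2) Pr ∧
      Integrable (fun ω => ‖x (τ ω) ω - v (τ ω) ω‖ ^ 2 + ‖x (τ ω + 1) ω - x (τ ω) ω‖ ^ 2) Pr ∧
      1 / 2 * ∫ ω, ‖x (τ ω + 1) ω - v (τ ω) ω‖ ^ 2 ∂Pr ≤
        ∫ ω, (‖x (τ ω) ω - v (τ ω) ω‖ ^ 2 + ‖x (τ ω + 1) ω - x (τ ω) ω‖ ^ 2) ∂Pr ∧
      ∫ ω, (‖x (τ ω) ω - v (τ ω) ω‖ ^ 2 + ‖x (τ ω + 1) ω - x (τ ω) ω‖ ^ 2) ∂Pr ≤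
        4 * B * (α + 1) / (γ * K) := by
  have hK' : (1 : ℝ) ≤ K := by exact_mod_cast hK
  set S := ∑ s ∈ Finset.Icc 1 K, (s : ℝ) ^ α with hS
  have hSpos : 0 < S := Finset.sum_pos
    (fun s hs => Real.rpow_pos_of_pos (by exact_mod_cast (Finset.mem_Icc.1 hs).1) α)
    ⟨1, by rw [Finset.mem_Icc]; omega⟩
  have hsum : ∑ k ∈ Finset.Icc 1 K, (k : ℝ) ^ α / S = 1 := by
    rw [← Finset.sum_div, div_self hSpos.ne']
  have htri : ∀ a b c : V, ‖b - c‖ ^ 2 ≤ 2 * (‖a - c‖ ^ 2 + ‖b - a‖ ^ 2) := by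
    intro a b c
    have h := sq_norm_sub_le_add b a c one_pos
    rw [norm_sub_rev a b] at h
    linarith
  have hI : ∀ k ∈ Finset.Icc 1 K, Integrable (fun ω => ‖x (k + 1) ω - v k ω‖ ^ 2) Pr := by
    intro k hk
    have hk' := Finset.mem_Icc.1 hk
    refine ((hW k hk).const_mul 2).mono' (((hx (k + 1) (by rw [Finset.mem_Icc]; omega)).sub
      (hv k hk)).norm.pow_const 2).aestronglyMeasurable (Filter.Eventually.of_forall fun ω => ?_)
    rw [Real.norm_of_nonneg (by positivity)]
    exact htri _ _ _
  obtain ⟨h1, -⟩ := integral_random_index hτ hlaw hsum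
    (Φ := fun k ω => ‖x (k + 1) ω - v k ω‖ ^ 2) hI fun k _ =>
      (hind k).comp (φ := id) (ψ := fun s : V × V × V => ‖s.2.1 - s.2.2‖ ^ 2) measurable_id
        (by fun_prop)
  obtain ⟨h2, h2'⟩ := integral_random_index hτ hlaw hsum
    (Φ := fun k ω => ‖x k ω - v k ω‖ ^ 2 + ‖x (k + 1) ω - x k ω‖ ^ 2) hW fun k _ =>
      (hind k).comp (φ := id) (ψ := fun s : V × V × V => ‖s.1 - s.2.2‖ ^ 2 + ‖s.2.1 - s.1‖ ^ 2)
        measurable_id (by fun_prop)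
  refine ⟨h1, h2, ?_, ?_⟩
  · rw [← integral_const_mul]
    refine integral_mono (h1.const_mul _) h2 fun ω => ?_
    have := htri (x (τ ω) ω) (x (τ ω + 1) ω) (v (τ ω) ω)
    simp only
    linarith
  · rw [h2']
    have e : ∑ k ∈ Finset.Icc 1 K, (k : ℝ) ^ α / S *
        ∫ ω, (‖x k ω - v k ω‖ ^ 2 + ‖x (k + 1) ω - x k ω‖ ^ 2) ∂Pr =
        (∑ k ∈ Finset.Icc 1 K, (k : ℝ) ^ α *
          ∫ ω, (‖x k ω - v k ω‖ ^ 2 + ‖x (k + 1) ω - x k ω‖ ^ 2) ∂Pr) / S := by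
      rw [Finset.sum_div]
      exact Finset.sum_congr rfl fun k _ => by ring
    rw [e, div_le_div_iff₀ hSpos (by positivity)]
    have h3 := rpow_succ_le_sum_rpow (by linarith : 0 ≤ α) K
    rw [← hS] at h3
    calc _ = 4 * K * (γ / 4 * ∑ k ∈ Finset.Icc 1 K, (k : ℝ) ^ α *
          ∫ ω, (‖x k ω - v k ω‖ ^ 2 + ‖x (k + 1) ω - x k ω‖ ^ 2) ∂Pr) := by ring
      _ ≤ 4 * K * ((K : ℝ) ^ α * B) := by gcongr
      _ = 4 * B * ((K : ℝ) ^ α * K) := by ring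
      _ ≤ 4 * B * ((α + 1) * S) := by gcongr
      _ = _ := by ring

end Averaging

/-! ### The convergence theorem -/

theorem theorem2
    {d m : ℕ} (P : InfProjProblem d m) (c : ProblemCase) (M : ℝ) (hP : P.IsAdmissible c M)
    -- oracles and their noise
    {Sg Sl Sh : Type*} [MeasurableSpace Sg] [MeasurableSpace Sl] [MeasurableSpace Sh]
    (Pg : Measure Sg) (Pl : Measure Sl) (Ph : Measure Sh)
    [IsProbabilityMeasure Pg] [IsProbabilityMeasure Pl] [IsProbabilityMeasure Ph]
    (O : Oracles d m Sg Sl Sh) (σ D : ℝ) (hσ : 0 ≤ σ) (hD : 0 ≤ D)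
    (hO : O.IsAdmissible P Pg Pl Ph σ)
    -- parameters
    (γ μ α : ℝ) (hγ : 0 < γ) (hμ : 0 < μ) (hα : 1 ≤ α) (K : ℕ) (hK : 1 ≤ K)
    (r : StepRule) (hr : O.XCondition P Pg Pl c r σ D γ)
    (Tx Ty : ℕ → ℕ)
    (hTx : ∀ k ∈ Finset.Icc 1 K, (k : ℝ) / γ + 1 ≤ Tx k)
    (hTy : ∀ k ∈ Finset.Icc 1 K, (k : ℝ) / μ + 1 ≤ Ty k)
    (x₁ : Vec d) (hx₁ : x₁ ∈ P.X) (y₁ : Vec m) (hy₁ : y₁ ∈ P.Y)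
    -- independent samples
    {Ω : Type*} [MeasurableSpace Ω] (Pr : Measure Ω) [IsProbabilityMeasure Pr]
    (ζ : ℕ → ℕ → Ω → Sg × Sl × Sh × Sl)
    (hζ_meas : ∀ k t, Measurable (ζ k t))
    (hζ_law : ∀ k t, Pr.map (ζ k t) = Pg.prod (Pl.prod (Ph.prod Pl)))
    (hζ_indep : iIndepFun (fun p : ℕ × ℕ => ζ p.1 p.2) Pr)
    -- the iterates of St-SPG
    (x : ℕ → Ω → Vec d) (y : ℕ → Ω → Vec m)
    (hrun : ∀ ω, IsStSPGRun P O c r γ μ Tx Ty K x₁ y₁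
      (fun k t => ζ k t ω) (fun k => x k ω) (fun k => y k ω))
    (hbound_y : ∀ k ∈ Finset.Icc 1 K, ∀ᵐ ω ∂Pr, ‖y k ω‖ ^ 2 ≤ D ^ 2)
    (hbound_ℓ : ∀ k ∈ Finset.Icc 1 K,
      SecondMomentLE (Pr.prod Pl) (fun q => O.lO (x (k + 1) q.1) q.2) (D ^ 2))
    -- the exact solutions of the subproblems
    (v : ℕ → Ω → Vec d) (u : ℕ → Ω → Vec m)
    (hv_meas : ∀ k, Measurable (v k)) (hu_meas : ∀ k, Measurable (u k))
    (hv : ∀ k ∈ Finset.Icc 1 K, ∀ ω, v k ω ∈ P.X ∧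
      IsMinOn (fun w => P.fx c (x k ω) (y k ω) w + γ / 2 * ‖w - x k ω‖ ^ 2) P.X (v k ω))
    (hu : ∀ k ∈ Finset.Icc 1 K, ∀ ω, u k ω ∈ P.Y ∧
      IsMinOn (fun w => P.fy (x (k + 1) ω) w + μ / 2 * ‖w - y k ω‖ ^ 2) P.Y (u k ω))
    -- the random index, drawn independently of the run
    (τ : Ω → ℕ) (hτ_meas : Measurable τ)
    (hτ_law : ∀ k ∈ Finset.Icc 1 K,
      Pr.real {ω | τ ω = k} = (k : ℝ) ^ α / ∑ s ∈ Finset.Icc 1 K, (s : ℝ) ^ α)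
    (hτ_indep : IndepFun τ (fun ω k => (x k ω, y k ω, v k ω, u k ω)) Pr)
    -- the constant
    (G : ℝ)
    (hG : G = Real.sqrt (17 * max (2 * σ ^ 2 + 2 * D ^ 2 * σ ^ 2) (2 * σ ^ 2 + 2 * D ^ 2))) :
    (Integrable (fun ω => ‖x (τ ω + 1) ω - v (τ ω) ω‖ ^ 2) Pr ∧
      Integrable (fun ω => ‖x (τ ω) ω - v (τ ω) ω‖ ^ 2 + ‖x (τ ω + 1) ω - x (τ ω) ω‖ ^ 2) Pr ∧
      1 / 2 * ∫ ω, ‖x (τ ω + 1) ω - v (τ ω) ω‖ ^ 2 ∂Pr ≤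
        ∫ ω, (‖x (τ ω) ω - v (τ ω) ω‖ ^ 2 + ‖x (τ ω + 1) ω - x (τ ω) ω‖ ^ 2) ∂Pr ∧
      ∫ ω, (‖x (τ ω) ω - v (τ ω) ω‖ ^ 2 + ‖x (τ ω + 1) ω - x (τ ω) ω‖ ^ 2) ∂Pr ≤
        4 * (M + 2 * G ^ 2) * (α + 1) / (γ * K)) ∧
    (Integrable (fun ω => ‖y (τ ω + 1) ω - u (τ ω) ω‖ ^ 2) Pr ∧
      Integrable (fun ω => ‖y (τ ω) ω - u (τ ω) ω‖ ^ 2 + ‖y (τ ω + 1) ω - y (τ ω) ω‖ ^ 2) Pr ∧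
      1 / 2 * ∫ ω, ‖y (τ ω + 1) ω - u (τ ω) ω‖ ^ 2 ∂Pr ≤
        ∫ ω, (‖y (τ ω) ω - u (τ ω) ω‖ ^ 2 + ‖y (τ ω + 1) ω - y (τ ω) ω‖ ^ 2) ∂Pr ∧
      ∫ ω, (‖y (τ ω) ω - u (τ ω) ω‖ ^ 2 + ‖y (τ ω + 1) ω - y (τ ω) ω‖ ^ 2) ∂Pr ≤
        4 * (M + 2 * G ^ 2) * (α + 1) / (μ * K)) := by
  have hTx2 : ∀ k ∈ Finset.Icc 1 K, 1 ≤ Tx k := fun k hk =>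
    one_le_two.trans (two_le_of_stage hγ (Finset.mem_Icc.1 hk).1 (hTx k hk))
  have hTy2 : ∀ k ∈ Finset.Icc 1 K, 1 ≤ Ty k := fun k hk =>
    one_le_two.trans (two_le_of_stage hμ (Finset.mem_Icc.1 hk).1 (hTy k hk))
  have hmem : ∀ k ∈ Finset.Icc 1 (K + 1), ∀ ω, x k ω ∈ P.X ∧ y k ω ∈ P.Y := fun k hk ω =>
    (hrun ω).mem hP hTx2 hTy2 hx₁ hy₁ (Finset.mem_Icc.1 hk).1 (Finset.mem_Icc.1 hk).2
  have hxym : ∀ k ∈ Finset.Icc 1 (K + 1), Measurable (x k) ∧ Measurable (y k) := fun k hk =>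
    IsStSPGRun.measurable_iterate hO hP hγ hμ hrun (Finset.mem_Icc.1 hk).1 (Finset.mem_Icc.1 hk).2
      fun j _ t => hζ_meas j t
  have hl : ∀ k ∈ Finset.Icc 1 K, k ∈ Finset.Icc 1 (K + 1) := by
    intro k hk
    rw [Finset.mem_Icc] at hk ⊢
    omega
  have hr' : ∀ k ∈ Finset.Icc 1 K, k + 1 ∈ Finset.Icc 1 (K + 1) := by
    intro k hk
    rw [Finset.mem_Icc] at hk ⊢
    omega
  have hex := fun (k : ℕ) (hk : k ∈ Finset.Icc 1 K) =>
    exists_x_stage_error Pr hP hO hσ hD hγ hμ hr hTx hζ_meas hζ_law hζ_indep hrun hk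
      (fun ω => (hmem k (hl k hk) ω).1) (fun ω => (hmem k (hl k hk) ω).2)
      (fun ω => (hmem _ (hr' k hk) ω).1) (hbound_y k hk) (hv k hk)
  have hey := fun (k : ℕ) (hk : k ∈ Finset.Icc 1 K) =>
    exists_y_stage_error Pr hP hO hσ hγ hμ hTy hζ_meas hζ_law hζ_indep hrun hk
      (fun ω => (hmem k (hl k hk) ω).2) (fun ω => (hmem _ (hr' k hk) ω).1) (hu k hk)
  choose! e he he_le he_ae using hex
  choose! e' he' he'_le he'_ae using hey
  have hM : 0 ≤ M := by simpa using hP.oscillation x₁ hx₁ y₁ hy₁ x₁ hx₁ y₁ hy₁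
  have hG2 : G ^ 2 = 17 * max (2 * σ ^ 2 + 2 * D ^ 2 * σ ^ 2) (2 * σ ^ 2 + 2 * D ^ 2) := by
    rw [hG, Real.sq_sqrt]
    exact mul_nonneg (by norm_num) (le_max_of_le_left (by positivity))
  have hQ : ∀ k ∈ Finset.Icc 1 K, ∫ ω, e k ω ∂Pr + ∫ ω, e' k ω ∂Pr ≤ 2 * G ^ 2 / k := by
    intro k hk
    refine (add_le_add (he_le k hk) (he'_le k hk)).trans ?_
    rw [← add_div, hG2]
    gcongr
    -- With `A = 2σ² + 2D²σ²` one has `6σ² ≤ 3A`, so the errors total `14/3 · 7A = 98/3 A`, below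
    -- the `34 A` contained in `2G²`.
    have h1 := le_max_left (2 * σ ^ 2 + 2 * D ^ 2 * σ ^ 2) (2 * σ ^ 2 + 2 * D ^ 2)
    nlinarith [mul_nonneg (sq_nonneg D) (sq_nonneg σ), sq_nonneg σ]
  obtain ⟨hW, hV, hWle, hVle⟩ := sum_weighted_integral_le (Pr := Pr) hK (M := M) hα
    (p := γ / 4) (p' := μ / 4) (by positivity) (by positivity)
    (W := fun k ω => ‖x k ω - v k ω‖ ^ 2 + ‖x (k + 1) ω - x k ω‖ ^ 2)
    (V := fun k ω => ‖y k ω - u k ω‖ ^ 2 + ‖y (k + 1) ω - y k ω‖ ^ 2)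
    (a := fun k ω => P.f (x k ω) (y k ω)) (a' := fun k ω => P.f (x (k + 1) ω) (y k ω))
    (fun k ω => by positivity) (fun k ω => by positivity)
    (fun k hk => ((((hxym k (hl k hk)).1.sub (hv_meas k)).norm.pow_const 2).add
      (((hxym _ (hr' k hk)).1.sub (hxym k (hl k hk)).1).norm.pow_const 2)).aestronglyMeasurable)
    (fun k hk => ((((hxym k (hl k hk)).2.sub (hu_meas k)).norm.pow_const 2).add
      (((hxym _ (hr' k hk)).2.sub (hxym k (hl k hk)).2).norm.pow_const 2)).aestronglyMeasurable)
    he he' hQ he_ae he'_ae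
    (fun ω k hk => hP.oscillation _ (hmem k hk ω).1 _ (hmem k hk ω).2 _
      (hmem (K + 1) (by simp) ω).1 _ (hmem (K + 1) (by simp) ω).2)
    (fun ω k hk => hP.oscillation _ (hmem k (hl k hk) ω).1 _ (hmem k (hl k hk) ω).2 _
      (hmem _ (hr' k hk) ω).1 _ (hmem k (hl k hk) ω).2)
    (fun ω k hk => hP.oscillation _ (hmem _ (hr' k hk) ω).1 _ (hmem k (hl k hk) ω).2 _
      (hmem _ (hr' k hk) ω).1 _ (hmem _ (hr' k hk) ω).2)
    (by positivity)
  exact ⟨random_index_rate hK hα hγ (by positivity) hτ_meas hτ_law (fun k hk => (hxym k hk).1)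
      (fun k _ => hv_meas k) (fun k => hτ_indep.comp (φ := id)
        (ψ := fun s : ℕ → Vec d × Vec m × Vec d × Vec m => ((s k).1, (s (k + 1)).1, (s k).2.2.1))
        measurable_id (by fun_prop)) hW hWle,
    random_index_rate hK hα hμ (by positivity) hτ_meas hτ_law (fun k hk => (hxym k hk).2)
      (fun k _ => hu_meas k) (fun k => hτ_indep.comp (φ := id)
        (ψ := fun s : ℕ → Vec d × Vec m × Vec d × Vec m =>
          ((s k).2.1, (s (k + 1)).2.1, (s k).2.2.2))
        measurable_id (by fun_prop)) hV hVle⟩
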